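/- **The theory $SA$.** Variables: $n,m,\dots$ over natural numbers and $x_i^{(k)}$ of sort $k$ $(k=1,2,\dots)$ over sets of natural numbers. Numerical terms are built from numerical variables, $0$, $1$, $+$, $\cdot$; atomic formulas are $t=\tau$ and $t\in_k x^{(k)}$; formulas are built with $\bot,\wedge,\vee,\supset,\forall,\exists$ ($\neg\varphi$ is $\varphi\supset\bot$, $\varphi\equiv\psi$ is $(\varphi\supset\psi)\wedge(\psi\supset\varphi)$). A formula is $k$-simple if it has no set quantifiers and no variables of sorts $>k$. Axioms: classical predicate logic with equality (of numbers); the Peano axioms for successor, $+$, $\cdot$; induction for all formulas; comprehension $\exists z^{(k)}\forall n(n\in z\equiv\varphi(n))$ for $k$-simple $\varphi$ not containing $z$; choice $$\forall n\,\exists!x^{(k)}\varphi(n,x)\supset\exists y^{(k+1)}\forall n\,\exists x^{(k)}\,[\varphi(n,x)\wedge\forall m(m\in x\equiv(n,m)\in y)]$$ for $k$-simple $\varphi$, where $\exists!$ refers to extensional equality of sets and $(n,m)=\tfrac12(n+m)(n+m+1)+m$. $SA_s$ is the fragment of $SA$ with sorts $\le s$ only; $SA_0$ is Peano arithmetic $PA$.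 **The theory $BT^{cl}$.** Variables: numerical ones (type $\omega$) and $X^k$ of type $k=0,1,2,\dots$; variables $x,y,\dots$ of type $0$ range over operations. Constants: the number $0$ and the operation constants $\underline k,\underline s,\underline d,\underline p,\underline p_1,\underline p_2,\underline c_n$ $(n\ge0)$. Atomic formulas: $Ap(f,x,y)$, $x=_{0\omega}m$, $x=_{0k}Y^k$, $X^k\in_kY^{k+1}$, where constants of the right type may replace variables. External terms are built from variables and constants by application $t\tau$. One writes $t\simeq x$ for $x=_{0\sigma}t$ if $t$ is a variable or constant of type $\sigma$; $t_1t_2\simeq x$ for $\exists y,z(t_1\simeq y\wedge t_2\simeq z\wedge Ap(y,z,x))$; $t\simeq\tau$ for $\exists x(t\simeq x\wedge\tau\simeq x)$; $t\downarrow$ for $\exists x(t\simeq x)$; $t\cong\tau$ for $\forall x(t\simeq x\equiv\tau\simeq x)$; and $t\in_kX$ for $\exists Z^k(t\simeq Z\wedge Z\in_kX)$. A formula is $n$-elementary if it contains only types $\le n$ ($\omega$ being smaller than all others), no quantifiers over type $n$ and no symbol $=_{0n}$. Fix an injective Gödel numbering $\llcorner\cdot\lrcorner$. The logic is classical predicate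 logic. The axioms and rules, for all $k,j\ge0$, are: * Equality: $x=_{00}x$; $\;u=_{0k}X^k\wedge v=_{0k}X\wedge u=_{0j}Y^j\supset v=_{0j}Y$; $\;u=_{0\omega}m\wedge v=_{0\omega}m\supset u=_{00}v$; $\;u=_{0\omega}m\wedge u=_{00}v\supset v=_{0\omega}m$; $\;Ap(f,x,y)\wedge f=_{00}g\wedge x=_{00}u\wedge y=_{00}v\supset Ap(g,u,v)$; $\;X\in_kY\wedge X\simeq U\wedge Y\simeq Z\supset U\in_kZ$. * Combinatorial axioms: $Ap(f,x,y)\wedge Ap(f,x,z)\supset y=_{00}z$; $\;\underline kxy\simeq x$; $\;\underline sxy\downarrow$; $\;\underline sxyz\cong xz(yz)$; $\;\underline pxy\downarrow$; $\;\neg(\underline pxy\simeq0)$; $\;\underline p_ix\downarrow$ and $\underline p_i(\underline px_1x_2)\simeq x_i$ $(i=1,2)$; $\;\exists m(\underline pn0\simeq m)$; $\;\exists Z^k(\underline pxY^k\simeq Z)$; $\;n\simeq m\supset\underline dxynm\simeq x$; $\;\neg(n\simeq m)\supset\underline dxynm\simeq y$; $\;\exists x(x=_{0\omega}n)$; $\;\exists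 x(x=_{0k}Y^k)$. Here $\underline pn0$ is the successor of $n$. * Induction rule: from $\varphi[n/0]$ and $\varphi\supset\exists m(\underline pn0\simeq m\wedge\varphi[n/m])$ infer $\varphi$, for any formula $\varphi$. * Comprehension: $\exists U^{k+1}[\underline c_n(\widetilde X)\simeq U\wedge\forall Z^k(Z\in_kU\equiv\varphi)]$, where $\widetilde X$ is a finite list of variables of types $\le k+1$, $\varphi$ is a $(k+1)$-elementary formula with all its parameters among $Z^k,\widetilde X$, $U$ is a variable not in $\widetilde X$, and $n=\llcorner Z^k.\widetilde X.\varphi\lrcorner$; lists are coded by iterated pairing with $\underline p$ (for the empty list, $\underline c_n(\widetilde X)$ is $\underline c_n$). $BT^{cl}_s$ is the fragment of $BT^{cl}$ with types $\le s$ only. **Arithmetic in $BT$.** Let $\lambda x.t$ be the usual abstraction by $\underline s,\underline k$, and let $R=WW$ be the recursion operator, where $$W=\lambda w.\lambda a.\lambda f.\lambda y.\;\underline d\,(\lambda u.a)\,\bigl(\lambda u.f(\underline p_1y)(wwaf(\underline p_1y))\bigr)\,y\,0\,0.$$ Arithmetical terms are read in $BT$ as external terms: $0$ as $0$, $1$ as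 $\underline p00$, and $+$, $\cdot$ as $\lambda x.\lambda y.R\,x\,(\lambda v.\lambda z.\underline pz0)\,y$ and $\lambda x.\lambda y.R\,0\,(\lambda v.\lambda z.z+x)\,y$. The equation $t=\tau$ is read as $t\simeq\tau$. In this way every formula of $PA$ is a formula of $BT$. **The translation.** For $t$ of type $k$ put $\{t\}=\underline c_e(t)$ with $e=\llcorner Z^k.Y^k.(Z\simeq Y)\lrcorner$. Put $\{n\}^0=n$ and $\{n\}^{k+1}=\{\{n\}^k\}$, where $\{n\}^0$ counts as an object of type $0$ and $\{n\}^k$ as one of type $k$. For $k\ge1$ let $M_k(X^k)$ be $\forall Z^{k-1}\bigl(Z\in_{k-1} X\supset\exists n(\{n\}^{k-1}\simeq Z)\bigr)$. For a formula $\varphi$ of $SA$ define $\varphi^*$ by: $(t=\tau)^*$ is $t=\tau$; $(t\in_kx_i^{(k)})^*$ is $\{t\}^{k-1}\in_{k-1}X_i^k$; $^*$ commutes with $\bot$, the connectives and numerical quantifiers; $(\forall x_i^{(k)}\psi)^*$ is $\forall X_i^k[M_k(X_i)\supset\psi^*]$; $(\exists x_i^{(k)}\psi)^*$ is $\exists X_i^k[M_k(X_i)\wedge\psi^*]$.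 Let $\overline{\overline\psi}$ be the closure of $\psi$, i.e. $\psi$ preceded by universal quantifiers over all its parameters (in any order). **Theorem.** 1. If $\psi$ is an arithmetical formula (a formula of $PA$), then $BT_0^{cl}\vdash\psi^*\equiv\psi$. 2. For every $s\ge0$: if $SA_s\vdash\psi$, then $BT_s^{cl}\vdash(\overline{\overline\psi})^*$. -/

import Mathlib

namespace MSArith

/-! ## Many-sorted first-order logic

Variables are pairs (sort, index).  Bound variables are de Bruijn indices counted separately for
each sort: a quantifier over the sort `σ` binds the variable of sort `σ` with index `0`, the free
variable `i` of sort `σ` is referred to by `i + 1` below it, and the variables of all other sorts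
keep their indices. -/

/-- A many-sorted signature: sorts, function symbols with argument sorts and value sort
(constants have no argument sorts), relation symbols with argument sorts. -/
structure Sig where
  Srt : Type
  dec : DecidableEq Srt
  Fn : List Srt → Srt → Type
  Rel : List Srt → Type

instance (S : Sig) : DecidableEq S.Srt := S.dec

inductive Term (S : Sig) : S.Srt → Type
  | var (σ : S.Srt) (i : ℕ) : Term S σ
  | app {l : List S.Srt} {σ : S.Srt} (f : S.Fn l σ)
      (ts : (j : Fin l.length) → Term S (l.get j)) : Term S σ

/-- Tuples of terms of prescribed sorts. -/
abbrev Args (S : Sig) (l : List S.Srt) : Type := (j : Fin l.length) → Term S (l.get j)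

def Args.nil {S : Sig} : Args S [] := fun j => j.elim0

def Args.cons {S : Sig} {σ : S.Srt} {l : List S.Srt} (t : Term S σ) (ts : Args S l) :
    Args S (σ :: l) :=
  Fin.cons (α := fun j : Fin (l.length + 1) => Term S ((σ :: l).get j)) t ts

inductive Formula (S : Sig) : Type
  | falsum : Formula S
  | rel {l : List S.Srt} (r : S.Rel l) (ts : Args S l) : Formula S
  | and (φ ψ : Formula S) : Formula S
  | or (φ ψ : Formula S) : Formula S
  | imp (φ ψ : Formula S) : Formula S
  | all (σ : S.Srt) (φ : Formula S) : Formula S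
  | ex (σ : S.Srt) (φ : Formula S) : Formula S

infixr:64 " ⋏ " => Formula.and
infixr:63 " ⋎ " => Formula.or
infixr:62 " ➝ " => Formula.imp

def Formula.neg {S : Sig} (φ : Formula S) : Formula S := φ ➝ Formula.falsum

def Formula.iff {S : Sig} (φ ψ : Formula S) : Formula S := (φ ➝ ψ) ⋏ (ψ ➝ φ)

infix:61 " ⟷ " => Formula.iff

section Substitution

variable {S : Sig}

/-- Renamings of variables. -/
abbrev Ren (S : Sig) : Type := S.Srt → ℕ → ℕ

/-- Simultaneous substitutions. -/
abbrev Sub (S : Sig) : Type := (τ : S.Srt) → ℕ → Term S τ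

/-- Makes room for a new variable `0` of sort `σ`. -/
def Ren.shift (σ : S.Srt) : Ren S := fun τ i => if τ = σ then i + 1 else i

/-- The action of a renaming below a quantifier over `σ`. -/
def Ren.up (σ : S.Srt) (ρ : Ren S) : Ren S := fun τ i =>
  if τ = σ then (match i with
    | 0 => 0
    | j + 1 => ρ τ j + 1)
  else ρ τ i

/-- Turns the free variable `i` of sort `σ` into the variable bound by a new quantifier. -/
def Ren.bind (σ : S.Srt) (i : ℕ) : Ren S := fun τ j =>
  if τ = σ then (if j = i then 0 else j + 1) else j

def Term.rename (ρ : Ren S) : {σ : S.Srt} → Term S σ → Term S σ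
  | _, .var σ i => .var σ (ρ σ i)
  | _, .app f ts => .app f (fun j => (ts j).rename ρ)

def Term.shift (σ : S.Srt) {τ : S.Srt} (t : Term S τ) : Term S τ := t.rename (Ren.shift σ)

def Term.subst (s : Sub S) : {σ : S.Srt} → Term S σ → Term S σ
  | _, .var σ i => s σ i
  | _, .app f ts => .app f (fun j => (ts j).subst s)

/-- The action of a substitution below a quantifier over `σ`. -/
def Sub.up (σ : S.Srt) (s : Sub S) : Sub S := fun τ i =>
  if τ = σ then (match i with
    | 0 => .var τ 0
    | j + 1 => (s τ j).shift σ)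
  else (s τ i).shift σ

/-- Substitution of `t` for the variable of a removed quantifier over `σ`. -/
def Sub.inst (σ : S.Srt) (t : Term S σ) : Sub S := fun τ i =>
  if h : τ = σ then (match i with
    | 0 => h ▸ t
    | j + 1 => .var τ j)
  else .var τ i

/-- Substitution of `t` for the variable `0` of sort `σ`, other variables being kept. -/
def Sub.single (σ : S.Srt) (t : Term S σ) : Sub S := fun τ i =>
  if h : τ = σ then (match i with
    | 0 => h ▸ t
    | j + 1 => .var τ (j + 1))
  else .var τ i

namespace Formula

def rename : Ren S → Formula S → Formula S
  | _, falsum => falsum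
  | ρ, rel r ts => rel r (fun j => (ts j).rename ρ)
  | ρ, and φ ψ => and (φ.rename ρ) (ψ.rename ρ)
  | ρ, or φ ψ => or (φ.rename ρ) (ψ.rename ρ)
  | ρ, imp φ ψ => imp (φ.rename ρ) (ψ.rename ρ)
  | ρ, all σ φ => all σ (φ.rename (ρ.up σ))
  | ρ, ex σ φ => ex σ (φ.rename (ρ.up σ))

def shift (σ : S.Srt) (φ : Formula S) : Formula S := φ.rename (Ren.shift σ)

/-- Shift of the variables of sort `σ`, except the variable `0`. -/
def shiftAbove (σ : S.Srt) (φ : Formula S) : Formula S := φ.rename ((Ren.shift σ).up σ)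

def subst : Sub S → Formula S → Formula S
  | _, falsum => falsum
  | s, rel r ts => rel r (fun j => (ts j).subst s)
  | s, and φ ψ => and (φ.subst s) (ψ.subst s)
  | s, or φ ψ => or (φ.subst s) (ψ.subst s)
  | s, imp φ ψ => imp (φ.subst s) (ψ.subst s)
  | s, all σ φ => all σ (φ.subst (s.up σ))
  | s, ex σ φ => ex σ (φ.subst (s.up σ))

/-- For a formula `φ` below a quantifier over `σ`: the result of substituting `t` for the
quantified variable. -/
def inst {σ : S.Srt} (φ : Formula S) (t : Term S σ) : Formula S := φ.subst (Sub.inst σ t)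

end Formula

/-- The variable `i` of sort `τ` occurs in the term. -/
def Term.Occurs (τ : S.Srt) (i : ℕ) : {σ : S.Srt} → Term S σ → Prop
  | _, .var σ j => τ = σ ∧ i = j
  | _, .app _ ts => ∃ j, (ts j).Occurs τ i

/-- The variable `i` of sort `τ` is a parameter of (occurs free in) the formula. -/
def Formula.Free (τ : S.Srt) : ℕ → Formula S → Prop
  | _, .falsum => False
  | i, .rel _ ts => ∃ j, (ts j).Occurs τ i
  | i, .and φ ψ => φ.Free τ i ∨ ψ.Free τ i
  | i, .or φ ψ => φ.Free τ i ∨ ψ.Free τ i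
  | i, .imp φ ψ => φ.Free τ i ∨ ψ.Free τ i
  | i, .all σ φ => φ.Free τ (Ren.shift σ τ i)
  | i, .ex σ φ => φ.Free τ (Ren.shift σ τ i)

/-- `∀ x φ`, where `x` is the free variable `i` of sort `σ`. -/
def Formula.allVar (σ : S.Srt) (i : ℕ) (φ : Formula S) : Formula S :=
  .all σ (φ.rename (Ren.bind σ i))

/-- Variables as pairs (sort, index). -/
abbrev Var (S : Sig) : Type := (_ : S.Srt) × ℕ

/-- `∀ x₁ … ∀ xₙ φ` for a list `x₁, …, xₙ` of free variables. -/
def Formula.allVars (l : List (Var S)) (φ : Formula S) : Formula S :=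
  l.foldr (fun v ψ => ψ.allVar v.1 v.2) φ

/-- `χ` is a closure of `φ`: it is `φ` with universal quantifiers over all its parameters (and
over nothing else), in some order. -/
def Formula.IsClosure (φ χ : Formula S) : Prop :=
  ∃ l : List (Var S), l.Nodup ∧ (∀ v : Var S, v ∈ l ↔ φ.Free v.1 v.2) ∧ χ = φ.allVars l

def Term.SortsIn (A : Set S.Srt) : {σ : S.Srt} → Term S σ → Prop
  | _, .var σ _ => σ ∈ A
  | _, .app (σ := σ) _ ts => σ ∈ A ∧ ∀ j, (ts j).SortsIn A

/-- All terms and all quantified variables in the formula have sorts in `A`. -/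
def Formula.SortsIn (A : Set S.Srt) : Formula S → Prop
  | .falsum => True
  | .rel _ ts => ∀ j, (ts j).SortsIn A
  | .and φ ψ => φ.SortsIn A ∧ ψ.SortsIn A
  | .or φ ψ => φ.SortsIn A ∧ ψ.SortsIn A
  | .imp φ ψ => φ.SortsIn A ∧ ψ.SortsIn A
  | .all σ φ => σ ∈ A ∧ φ.SortsIn A
  | .ex σ φ => σ ∈ A ∧ φ.SortsIn A

/-- All quantifiers in the formula are over sorts in `A`. -/
def Formula.QuantifiersIn (A : Set S.Srt) : Formula S → Prop
  | .falsum => True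
  | .rel _ _ => True
  | .and φ ψ => φ.QuantifiersIn A ∧ ψ.QuantifiersIn A
  | .or φ ψ => φ.QuantifiersIn A ∧ ψ.QuantifiersIn A
  | .imp φ ψ => φ.QuantifiersIn A ∧ ψ.QuantifiersIn A
  | .all σ φ => σ ∈ A ∧ φ.QuantifiersIn A
  | .ex σ φ => σ ∈ A ∧ φ.QuantifiersIn A

/-- All relation symbols in the formula have the property `P`. -/
def Formula.RelsIn (P : {l : List S.Srt} → S.Rel l → Prop) : Formula S → Prop
  | .falsum => True
  | .rel r _ => P r
  | .and φ ψ => φ.RelsIn P ∧ ψ.RelsIn P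
  | .or φ ψ => φ.RelsIn P ∧ ψ.RelsIn P
  | .imp φ ψ => φ.RelsIn P ∧ ψ.RelsIn P
  | .all _ φ => φ.RelsIn P
  | .ex _ φ => φ.RelsIn P

end Substitution

/-- The axioms of classical predicate logic. -/
inductive LogicalAxiom {S : Sig} : Formula S → Prop
  | weaken (φ ψ : Formula S) : LogicalAxiom (φ ➝ ψ ➝ φ)
  | distrib (φ ψ χ : Formula S) : LogicalAxiom ((φ ➝ ψ ➝ χ) ➝ (φ ➝ ψ) ➝ φ ➝ χ)
  | andIntro (φ ψ : Formula S) : LogicalAxiom (φ ➝ ψ ➝ φ ⋏ ψ)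
  | andLeft (φ ψ : Formula S) : LogicalAxiom (φ ⋏ ψ ➝ φ)
  | andRight (φ ψ : Formula S) : LogicalAxiom (φ ⋏ ψ ➝ ψ)
  | orLeft (φ ψ : Formula S) : LogicalAxiom (φ ➝ φ ⋎ ψ)
  | orRight (φ ψ : Formula S) : LogicalAxiom (ψ ➝ φ ⋎ ψ)
  | orElim (φ ψ χ : Formula S) : LogicalAxiom ((φ ➝ χ) ➝ (ψ ➝ χ) ➝ φ ⋎ ψ ➝ χ)
  | exFalso (φ : Formula S) : LogicalAxiom (Formula.falsum ➝ φ)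
  | doubleNeg (φ : Formula S) : LogicalAxiom (φ.neg.neg ➝ φ)
  | allElim (σ : S.Srt) (φ : Formula S) (t : Term S σ) : LogicalAxiom (.all σ φ ➝ φ.inst t)
  | exIntro (σ : S.Srt) (φ : Formula S) (t : Term S σ) : LogicalAxiom (φ.inst t ➝ .ex σ φ)

/-- A first-order theory with classical logic: the sorts of its language, its non-logical axioms
and its non-logical rules (premises, conclusion).  Only those axioms and instances of rules belong
to the theory that lie in its language. -/
structure Theory (S : Sig) where
  sorts : Set S.Srt
  ax : Set (Formula S)
  rules : Set (List (Formula S) × Formula S)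

/-- Derivability in a theory with classical predicate logic.  Every formula of a derivation belongs
to the language of the theory. -/
inductive Theory.Provable {S : Sig} (T : Theory S) : Formula S → Prop
  | logical {φ : Formula S} (h : LogicalAxiom φ) (hL : φ.SortsIn T.sorts) : T.Provable φ
  | ax {φ : Formula S} (h : φ ∈ T.ax) (hL : φ.SortsIn T.sorts) : T.Provable φ
  | rule {ps : List (Formula S)} {φ : Formula S} (h : (ps, φ) ∈ T.rules)
      (hp : ∀ p ∈ ps, T.Provable p) (hL : φ.SortsIn T.sorts) : T.Provable φ
  | mp {φ ψ : Formula S} (h₁ : T.Provable (φ ➝ ψ)) (h₂ : T.Provable φ) : T.Provable ψ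
  | allIntro {σ : S.Srt} {χ φ : Formula S} (h : T.Provable (χ.shift σ ➝ φ))
      (hL : σ ∈ T.sorts) : T.Provable (χ ➝ .all σ φ)
  | exElim {σ : S.Srt} {χ φ : Formula S} (h : T.Provable (φ ➝ χ.shift σ))
      (hL : σ ∈ T.sorts) : T.Provable (.ex σ φ ➝ χ)

/-! ## The arithmetic `SA` with sets of natural numbers of infinitely many sorts -/

/-- `num` is the sort of natural numbers, `set k` is the sort `k + 1` of sets. -/
inductive SASort : Type
  | num : SASort
  | set (k : ℕ) : SASort
  deriving DecidableEq

def SASort.index : SASort → ℕ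
  | num => 0
  | set k => k + 1

inductive SAFn : List SASort → SASort → Type
  | zero : SAFn [] .num
  | one : SAFn [] .num
  | add : SAFn [.num, .num] .num
  | mul : SAFn [.num, .num] .num

/-- `eq` is equality of numbers, `mem k` is membership of numbers in sets of sort `k + 1`. -/
inductive SARel : List SASort → Type
  | eq : SARel [.num, .num]
  | mem (k : ℕ) : SARel [.num, .set k]

abbrev SASig : Sig := ⟨SASort, inferInstance, SAFn, SARel⟩

abbrev SATerm : SASort → Type := Term SASig

abbrev SAFormula : Type := Formula SASig

namespace SA

def zero : SATerm .num := .app SAFn.zero Args.nil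

def one : SATerm .num := .app SAFn.one Args.nil

def add (t u : SATerm .num) : SATerm .num := .app SAFn.add (Args.cons t (Args.cons u Args.nil))

def mul (t u : SATerm .num) : SATerm .num := .app SAFn.mul (Args.cons t (Args.cons u Args.nil))

/-- The numerical variable `i`. -/
def nv (i : ℕ) : SATerm .num := .var (S := SASig) SASort.num i

/-- The variable `i` of sort `k + 1`. -/
def sv (k i : ℕ) : SATerm (.set k) := .var (S := SASig) (SASort.set k) i

def eq (t u : SATerm .num) : SAFormula := .rel SARel.eq (Args.cons t (Args.cons u Args.nil))

def mem {k : ℕ} (t : SATerm .num) (x : SATerm (.set k)) : SAFormula :=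
  .rel (SARel.mem k) (Args.cons t (Args.cons x Args.nil))

def all (σ : SASort) (φ : SAFormula) : SAFormula := Formula.all (S := SASig) σ φ

def ex (σ : SASort) (φ : SAFormula) : SAFormula := Formula.ex (S := SASig) σ φ

/-- No quantifiers over sets and no variables of sorts greater than `k`. -/
def Simple (k : ℕ) (φ : SAFormula) : Prop :=
  φ.SortsIn {σ : SASort | σ.index ≤ k} ∧ φ.QuantifiersIn {σ : SASort | σ = .num}

/-- `(n, m) ∈ y`, where `(n, m) = (n + m)(n + m + 1) / 2 + m` is Cantor's numbering of pairs:
`∃ p, p + p = (n + m)(n + m + 1) + (m + m) ∧ p ∈ y`. -/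
def pairMem {k : ℕ} (n m : SATerm .num) (y : SATerm (.set k)) : SAFormula :=
  let n' := n.shift SASort.num
  let m' := m.shift SASort.num
  ex .num
    (eq (add (nv 0) (nv 0)) (add (mul (add n' m') (add (add n' m') one)) (add m' m')) ⋏
      mem (nv 0) (y.shift SASort.num))

/-- `∃ z ∀ n (n ∈ z ≡ φ(n))`, with `z` of sort `k + 1`; `φ` has the variable `n = nv 0`. -/
def comprehension (k : ℕ) (φ : SAFormula) : SAFormula :=
  ex (.set k) (all .num (mem (nv 0) (sv k 0) ⟷ φ.shift (SASort.set k)))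

/-- `∀ n ∃! x φ(n, x) ⊃ ∃ y ∀ n ∃ x [φ(n, x) ∧ ∀ m (m ∈ x ≡ (n, m) ∈ y)]` with `x` of sort `k + 1`
and `y` of sort `k + 2`; `φ` has the variables `n = nv 0` and `x = sv k 0`, and
`∃! x φ(n, x)` is `∃ x [φ(n, x) ∧ ∀ z (φ(n, z) ⊃ ∀ m (m ∈ x ≡ m ∈ z))]`. -/
def choice (k : ℕ) (φ : SAFormula) : SAFormula :=
  all .num (ex (.set k) (φ ⋏
    all (.set k) (φ.shiftAbove (SASort.set k) ➝
      all .num (mem (nv 0) (sv k 1) ⟷ mem (nv 0) (sv k 0))))) ➝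
  ex (.set (k + 1)) (all .num (ex (.set k) (φ.shift (SASort.set (k + 1)) ⋏
    all .num (mem (nv 0) (sv k 0) ⟷ pairMem (nv 1) (nv 0) (sv (k + 1) 0)))))

/-- The non-logical axioms of `SA` and the equality axioms. -/
inductive Axiom : SAFormula → Prop
  | eqRefl (t : SATerm .num) : Axiom (eq t t)
  | eqSubst (t u : SATerm .num) (φ : SAFormula) : Axiom (eq t u ➝ φ.inst t ➝ φ.inst u)
  | succNeZero (n : SATerm .num) : Axiom (eq (add n one) zero).neg
  | succInj (n m : SATerm .num) : Axiom (eq (add n one) (add m one) ➝ eq n m)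
  | addZero (n : SATerm .num) : Axiom (eq (add n zero) n)
  | addSucc (n m : SATerm .num) : Axiom (eq (add n (add m one)) (add (add n m) one))
  | mulZero (n : SATerm .num) : Axiom (eq (mul n zero) zero)
  | mulSucc (n m : SATerm .num) : Axiom (eq (mul n (add m one)) (add (mul n m) n))
  | induction (φ : SAFormula) :
      Axiom (φ.inst zero ⋏
        all .num (φ ➝ φ.subst (Sub.single (S := SASig) SASort.num (add (nv 0) one))) ➝
        all .num φ)
  | comprehension (k : ℕ) (φ : SAFormula) (h : Simple (k + 1) φ) : Axiom (comprehension k φ)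
  | choice (k : ℕ) (φ : SAFormula) (h : Simple (k + 1) φ) : Axiom (choice k φ)

/-- The fragment `SA_s` of `SA`. -/
def theory (s : ℕ) : Theory SASig where
  sorts := {σ : SASort | σ.index ≤ s}
  ax := {φ | Axiom φ}
  rules := ∅

end SA

/-! ## The theory `BT` of operations and sets -/

/-- `num` is the type `ω` of numerical variables, `ty k` is the type `k`; variables of type `0`
are operation variables. -/
inductive BTSort : Type
  | num : BTSort
  | ty (k : ℕ) : BTSort
  deriving DecidableEq

/-- The types not greater than `k`; the type `ω` is smaller than any other type. -/
def BTSort.upTo (k : ℕ) : Set BTSort := {σ | σ = num ∨ ∃ j ≤ k, σ = ty j}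

/-- The constants of `BT`: the number `0`, the combinatorial constants and the comprehension
constants. -/
inductive BTFn : List BTSort → BTSort → Type
  | zero : BTFn [] .num
  | k : BTFn [] (.ty 0)
  | s : BTFn [] (.ty 0)
  | d : BTFn [] (.ty 0)
  | p : BTFn [] (.ty 0)
  | p₁ : BTFn [] (.ty 0)
  | p₂ : BTFn [] (.ty 0)
  | c (n : ℕ) : BTFn [] (.ty 0)

/-- `ap` is `Ap(f, x, y)`, `eqOp σ` is the predicate `=_{0σ}`, and `mem k` is `∈_k`. -/
inductive BTRel : List BTSort → Type
  | ap : BTRel [.ty 0, .ty 0, .ty 0]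
  | eqOp (σ : BTSort) : BTRel [.ty 0, σ]
  | mem (k : ℕ) : BTRel [.ty k, .ty (k + 1)]

abbrev BTSig : Sig := ⟨BTSort, inferInstance, BTFn, BTRel⟩

/-- Terms of `BT` are constants and variables. -/
abbrev BTTerm : BTSort → Type := Term BTSig

abbrev BTFormula : Type := Formula BTSig

/-- External terms: constants, variables, and applications. -/
inductive Ext : Type
  | of {σ : BTSort} (t : BTTerm σ) : Ext
  | app (t u : Ext) : Ext

infixl:70 " ⬝ " => Ext.app

namespace BT

def zero : BTTerm .num := .app BTFn.zero Args.nil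

/-- The numerical variable `i`. -/
def nv (i : ℕ) : BTTerm .num := .var (S := BTSig) BTSort.num i

/-- The variable `i` of type `k`. -/
def tv (k i : ℕ) : BTTerm (.ty k) := .var (S := BTSig) (BTSort.ty k) i

def ap (f x y : BTTerm (.ty 0)) : BTFormula :=
  .rel BTRel.ap (Args.cons f (Args.cons x (Args.cons y Args.nil)))

def eqOp {σ : BTSort} (x : BTTerm (.ty 0)) (y : BTTerm σ) : BTFormula :=
  .rel (BTRel.eqOp σ) (Args.cons x (Args.cons y Args.nil))

def mem {k : ℕ} (x : BTTerm (.ty k)) (y : BTTerm (.ty (k + 1))) : BTFormula :=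
  .rel (BTRel.mem k) (Args.cons x (Args.cons y Args.nil))

def all (σ : BTSort) (φ : BTFormula) : BTFormula := Formula.all (S := BTSig) σ φ

def ex (σ : BTSort) (φ : BTFormula) : BTFormula := Formula.ex (S := BTSig) σ φ

/-- A closed external term consisting of one operation constant. -/
def op (f : BTFn [] (.ty 0)) : Ext := .of (σ := .ty 0) (.app f Args.nil)

/-- Makes room for a new variable `0` of type `σ`. -/
def shift (σ : BTSort) : Ext → Ext
  | .of t => .of (t.shift (S := BTSig) σ)
  | t ⬝ u => shift σ t ⬝ shift σ u

/-- Auxiliary form of `simeq`: the formula `t' ≃ x`, where `t'` is `t` with its variables of type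
`0` shifted `d` times. -/
def simeqAux : Ext → ℕ → BTTerm (.ty 0) → BTFormula
  | .of t, d, x => eqOp x ((Term.shift (S := BTSig) (BTSort.ty 0))^[d] t)
  | t ⬝ u, d, x =>
      ex (.ty 0) (ex (.ty 0) (simeqAux t (d + 2) (tv 0 1) ⋏ simeqAux u (d + 2) (tv 0 0) ⋏
        ap (tv 0 1) (tv 0 0) ((Term.shift (S := BTSig) (BTSort.ty 0))^[2] x)))

/-- `t ≃ x` for `x` of type `0`: this is `x =_{0σ} t` if `t` is a constant or variable of type
`σ`, and `∃ y, z (t₁ ≃ y ∧ t₂ ≃ z ∧ Ap(y, z, x))` if `t` is `t₁ t₂`. -/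
def simeq (t : Ext) (x : BTTerm (.ty 0)) : BTFormula := simeqAux t 0 x

/-- `t ↓`, that is `∃ x (t ≃ x)`. -/
def defined (t : Ext) : BTFormula := ex (.ty 0) (simeq (shift (.ty 0) t) (tv 0 0))

/-- `t ≃ u`, that is `∃ x (t ≃ x ∧ u ≃ x)`. -/
def eqv (t u : Ext) : BTFormula :=
  ex (.ty 0) (simeq (shift (.ty 0) t) (tv 0 0) ⋏ simeq (shift (.ty 0) u) (tv 0 0))

/-- `t ≅ u`, that is `∀ x (t ≃ x ≡ u ≃ x)`. -/
def kleeneEq (t u : Ext) : BTFormula :=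
  all (.ty 0) (simeq (shift (.ty 0) t) (tv 0 0) ⟷ simeq (shift (.ty 0) u) (tv 0 0))

/-- `t ∈_k X`, that is `∃ Z (t ≃ Z ∧ Z ∈_k X)` with `Z` of type `k`. -/
def extMem {k : ℕ} (t : Ext) (x : BTTerm (.ty (k + 1))) : BTFormula :=
  ex (.ty k) (eqv (shift (.ty k) t) (.of (tv k 0)) ⋏
    mem (tv k 0) (x.shift (S := BTSig) (BTSort.ty k)))

def pair (t u : Ext) : Ext := op .p ⬝ t ⬝ u

/-- `f(⟨x₁, …, xₙ⟩)` for a list of variables, where `⟨x₁⟩ = x₁` and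
`⟨x₁, …, xₙ₊₁⟩ = p ⟨x₁, …, xₙ⟩ xₙ₊₁`; for the empty list this is `f`. -/
def applyTuple (f : Ext) : List (Var BTSig) → Ext
  | [] => f
  | v :: l => f ⬝ l.foldl (fun t w => pair t (.of (Term.var (S := BTSig) w.1 w.2)))
      (.of (Term.var (S := BTSig) v.1 v.2))

/-- The `n`-elementary formulas: only types `≤ n`, no quantifiers over the type `n`, and no
predicate symbol `=_{0n}`. -/
def Elementary (n : ℕ) (φ : BTFormula) : Prop :=
  φ.SortsIn (BTSort.upTo n) ∧ φ.QuantifiersIn {σ : BTSort | σ ≠ .ty n} ∧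
    φ.RelsIn (S := BTSig) (fun {l} (r : BTRel l) =>
      match r with
      | .eqOp σ => σ ≠ .ty n
      | _ => True)

/-- The expression `Z^k.X̃.φ`; the variable `Z^k` is bound in it and is the variable `0` of type
`k` in `body`. -/
structure Abstract where
  k : ℕ
  params : List (Var BTSig)
  body : BTFormula

/-- A Gödel numbering of the expressions `Z^k.X̃.φ`. -/
structure GodelNumbering where
  num : Abstract → ℕ
  injective : Function.Injective num

/-- `X̃` is a list of variables of types `≤ k + 1`, and `φ` is a `(k + 1)`-elementary formula with
all its parameters in the list `Z^k, X̃`. -/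
def Abstract.Admissible (e : Abstract) : Prop :=
  (∀ v ∈ e.params, v.1 ∈ BTSort.upTo (e.k + 1)) ∧ Elementary (e.k + 1) e.body ∧
    ∀ (σ : BTSort) (i : ℕ), (all (.ty e.k) e.body).Free σ i →
      (⟨σ, i⟩ : Var BTSig) ∈ e.params

/-- `∃ U^{k+1} [c_n(X̃) ≃ U ∧ ∀ Z^k (Z ∈_k U ≡ φ)]` with `n` the number of `Z^k.X̃.φ`. -/
def comprehension (G : GodelNumbering) (e : Abstract) : BTFormula :=
  ex (.ty (e.k + 1))
    (eqv (shift (.ty (e.k + 1)) (applyTuple (op (.c (G.num e))) e.params))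
        (.of (tv (e.k + 1) 0)) ⋏
      all (.ty e.k) (mem (tv e.k 0) (tv (e.k + 1) 0) ⟷
        e.body.shift (S := BTSig) (BTSort.ty (e.k + 1))))

/-- The equality, combinatorial and comprehension axioms of `BT`. -/
inductive Axiom (G : GodelNumbering) : BTFormula → Prop
  | eqRefl (x : BTTerm (.ty 0)) : Axiom G (eqOp x x)
  | eqTrans (k n : ℕ) (u v : BTTerm (.ty 0)) (x : BTTerm (.ty k)) (y : BTTerm (.ty n)) :
      Axiom G (eqOp u x ⋏ eqOp v x ⋏ eqOp u y ➝ eqOp v y)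
  | eqNum (u v : BTTerm (.ty 0)) (m : BTTerm .num) :
      Axiom G (eqOp u m ⋏ eqOp v m ➝ eqOp u v)
  | eqNumSubst (u v : BTTerm (.ty 0)) (m : BTTerm .num) :
      Axiom G (eqOp u m ⋏ eqOp u v ➝ eqOp v m)
  | apSubst (f g x u y v : BTTerm (.ty 0)) :
      Axiom G (ap f x y ⋏ eqOp f g ⋏ eqOp x u ⋏ eqOp y v ➝ ap g u v)
  | memSubst (k : ℕ) (x u : BTTerm (.ty k)) (y z : BTTerm (.ty (k + 1))) :
      Axiom G (mem x y ⋏ eqv (.of x) (.of u) ⋏ eqv (.of y) (.of z) ➝ mem u z)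
  | apFun (f x y z : BTTerm (.ty 0)) : Axiom G (ap f x y ⋏ ap f x z ➝ eqOp y z)
  | combK (x y : BTTerm (.ty 0)) : Axiom G (simeq (op .k ⬝ .of x ⬝ .of y) x)
  | combSDefined (x y : BTTerm (.ty 0)) : Axiom G (defined (op .s ⬝ .of x ⬝ .of y))
  | combS (x y z : BTTerm (.ty 0)) :
      Axiom G (kleeneEq (op .s ⬝ .of x ⬝ .of y ⬝ .of z) ((.of x ⬝ .of z) ⬝ (.of y ⬝ .of z)))
  | pairDefined (x y : BTTerm (.ty 0)) : Axiom G (defined (pair (.of x) (.of y)))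
  | pairNeZero (x y : BTTerm (.ty 0)) : Axiom G (eqv (pair (.of x) (.of y)) (.of zero)).neg
  | fstDefined (x : BTTerm (.ty 0)) : Axiom G (defined (op .p₁ ⬝ .of x))
  | sndDefined (x : BTTerm (.ty 0)) : Axiom G (defined (op .p₂ ⬝ .of x))
  | fstPair (x y : BTTerm (.ty 0)) : Axiom G (simeq (op .p₁ ⬝ pair (.of x) (.of y)) x)
  | sndPair (x y : BTTerm (.ty 0)) : Axiom G (simeq (op .p₂ ⬝ pair (.of x) (.of y)) y)
  | succNum (n : BTTerm .num) :
      Axiom G (ex .num (eqv (shift .num (pair (.of n) (.of zero))) (.of (nv 0))))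
  | pairSet (k : ℕ) (x : BTTerm (.ty 0)) (y : BTTerm (.ty k)) :
      Axiom G (ex (.ty k) (eqv (shift (.ty k) (pair (.of x) (.of y))) (.of (tv k 0))))
  | caseEq (x y : BTTerm (.ty 0)) (n m : BTTerm .num) :
      Axiom G (eqv (.of n) (.of m) ➝ simeq (op .d ⬝ .of x ⬝ .of y ⬝ .of n ⬝ .of m) x)
  | caseNe (x y : BTTerm (.ty 0)) (n m : BTTerm .num) :
      Axiom G ((eqv (.of n) (.of m)).neg ➝ simeq (op .d ⬝ .of x ⬝ .of y ⬝ .of n ⬝ .of m) y)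
  | numOp (n : BTTerm .num) :
      Axiom G (ex (.ty 0) (eqOp (tv 0 0) (n.shift (S := BTSig) (BTSort.ty 0))))
  | setOp (k : ℕ) (y : BTTerm (.ty k)) :
      Axiom G (ex (.ty 0) (eqOp (tv 0 0) (y.shift (S := BTSig) (BTSort.ty 0))))
  | comprehension (e : Abstract) (h : e.Admissible) : Axiom G (comprehension G e)

/-- The induction rule: from `φ[n/0]` and `φ ⊃ ∃ m (p n 0 ≃ m ∧ φ[n/m])` infer `φ`, where `n` is the
numerical variable `0`. -/
def inductionRule (φ : BTFormula) : List BTFormula × BTFormula :=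
  ([φ.inst zero,
    φ ➝ ex .num (eqv (pair (.of (nv 1)) (.of zero)) (.of (nv 0)) ⋏ φ.shiftAbove BTSort.num)],
   φ)

/-- The fragment `BT_s` of `BT`, with classical logic. -/
def theoryCl (G : GodelNumbering) (s : ℕ) : Theory BTSig where
  sorts := BTSort.upTo s
  ax := {φ | Axiom G φ}
  rules := Set.range inductionRule

/-! ### Arithmetical terms in `BT` -/

/-- The external term `λ x. t`, where `x` is the operation variable `i`. -/
def lam (i : ℕ) : Ext → Ext
  | t ⬝ u => op .s ⬝ lam i t ⬝ lam i u
  | .of (σ := .ty 0) (Term.var (S := BTSig) _ j) =>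
      if j = i then op .s ⬝ op .k ⬝ op .k else op .k ⬝ .of (tv 0 j)
  | .of t => op .k ⬝ .of t

def recStep : Ext :=
  let w : Ext := .of (tv 0 0)
  let a : Ext := .of (tv 0 1)
  let f : Ext := .of (tv 0 2)
  let y : Ext := .of (tv 0 3)
  lam 0 (lam 1 (lam 2 (lam 3
    (op .d ⬝ lam 4 a ⬝ lam 4 (f ⬝ (op .p₁ ⬝ y) ⬝ (w ⬝ w ⬝ a ⬝ f ⬝ (op .p₁ ⬝ y))) ⬝
      y ⬝ .of zero ⬝ .of zero))))

/-- The recursion operator: `recOp a f 0 ≅ a` and `recOp a f (n + 1) ≅ f n (recOp a f n)`. -/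
def recOp : Ext := recStep ⬝ recStep

/-- `λ x. λ y. recOp x (λ v. λ z. z + 1) y`. -/
def addOp : Ext :=
  lam 0 (lam 1 (recOp ⬝ .of (tv 0 0) ⬝ lam 2 (lam 3 (pair (.of (tv 0 3)) (.of zero))) ⬝
    .of (tv 0 1)))

/-- `λ x. λ y. recOp 0 (λ v. λ z. z + x) y`. -/
def mulOp : Ext :=
  lam 0 (lam 1 (recOp ⬝ .of zero ⬝ lam 2 (lam 3 (addOp ⬝ .of (tv 0 3) ⬝ .of (tv 0 0))) ⬝
    .of (tv 0 1)))

/-- The numeral `1`. -/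
def one : Ext := pair (.of zero) (.of zero)

/-! ### Iterated singletons -/

/-- The singleton of an object of type `k`: `{t} = c_n(t)`, where `n` is the number of
`Z^k.Y^k.(Z ≃ Y)`. -/
def singleton (G : GodelNumbering) (k : ℕ) (t : Ext) : Ext :=
  op (.c (G.num ⟨k, [⟨BTSort.ty k, 0⟩], eqv (.of (tv k 0)) (.of (tv k 1))⟩)) ⬝ t

/-- `{t}^0 = t` and `{t}^{k+1} = {{t}^k}`. -/
def iterSingleton (G : GodelNumbering) : ℕ → Ext → Ext
  | 0, t => t
  | k + 1, t => singleton G k (iterSingleton G k t)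

/-- `M_{k+1}(X)`, that is `(∀ Z^k ∈ X) ∃ n ({n}^k ≃ Z)`, for the variable `X = tv (k + 1) 0`. -/
def codesSet (G : GodelNumbering) (k : ℕ) : BTFormula :=
  all (.ty k) (mem (tv k 0) (tv (k + 1) 0) ➝
    ex .num (eqv (iterSingleton G k (.of (nv 0))) (.of (tv k 0))))

end BT

/-! ## The interpretation of `SA` in `BT` -/

/-- The types corresponding to the sorts of `SA`. -/
def SASort.toBT : SASort → BTSort
  | .num => .num
  | .set k => .ty (k + 1)

/-- The index of a set term, which is always a variable. -/
def SA.setIndex {k : ℕ} : SATerm (.set k) → ℕ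
  | .var _ i => i

/-- The arithmetical term of `BT` corresponding to a term of `SA`. -/
def SA.toExt : {σ : SASort} → SATerm σ → Ext
  | _, .var σ i => .of (Term.var (S := BTSig) σ.toBT i)
  | _, .app SAFn.zero _ => .of BT.zero
  | _, .app SAFn.one _ => BT.one
  | _, .app SAFn.add ts => BT.addOp ⬝ toExt (ts 0) ⬝ toExt (ts 1)
  | _, .app SAFn.mul ts => BT.mulOp ⬝ toExt (ts 0) ⬝ toExt (ts 1)

/-- The interpretation `φ*` of a formula `φ` of `SA`; the variable `i` of sort `k` is interpreted by
the variable `i` of type `k`. -/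
def SA.star (G : BT.GodelNumbering) : SAFormula → BTFormula
  | .falsum => .falsum
  | .rel SARel.eq ts => BT.eqv (toExt (ts 0)) (toExt (ts 1))
  | .rel (SARel.mem k) ts =>
      BT.extMem (BT.iterSingleton G k (toExt (ts 0))) (BT.tv (k + 1) (setIndex (k := k) (ts 1)))
  | .and φ ψ => .and (star G φ) (star G ψ)
  | .or φ ψ => .or (star G φ) (star G ψ)
  | .imp φ ψ => .imp (star G φ) (star G ψ)
  | .all .num φ => BT.all .num (star G φ)
  | .all (.set k) φ => BT.all (.ty (k + 1)) (BT.codesSet G k ➝ star G φ)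
  | .ex .num φ => BT.ex .num (star G φ)
  | .ex (.set k) φ => BT.ex (.ty (k + 1)) (BT.codesSet G k ⋏ star G φ)

/-! ## Arithmetical formulas -/

inductive PATerm : Type
  | var (i : ℕ) : PATerm
  | zero : PATerm
  | one : PATerm
  | add (t u : PATerm) : PATerm
  | mul (t u : PATerm) : PATerm

/-- Formulas of first-order arithmetic; the bound variables are de Bruijn indices. -/
inductive PAFormula : Type
  | falsum : PAFormula
  | eq (t u : PATerm) : PAFormula
  | and (φ ψ : PAFormula) : PAFormula
  | or (φ ψ : PAFormula) : PAFormula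
  | imp (φ ψ : PAFormula) : PAFormula
  | all (φ : PAFormula) : PAFormula
  | ex (φ : PAFormula) : PAFormula

def PATerm.toSA : PATerm → SATerm .num
  | var i => SA.nv i
  | zero => SA.zero
  | one => SA.one
  | add t u => SA.add t.toSA u.toSA
  | mul t u => SA.mul t.toSA u.toSA

/-- An arithmetical formula as a formula of `SA`. -/
def PAFormula.toSA : PAFormula → SAFormula
  | falsum => .falsum
  | eq t u => SA.eq t.toSA u.toSA
  | and φ ψ => .and φ.toSA ψ.toSA
  | or φ ψ => .or φ.toSA ψ.toSA
  | imp φ ψ => .imp φ.toSA ψ.toSA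
  | all φ => SA.all .num φ.toSA
  | ex φ => SA.ex .num φ.toSA

def PATerm.toBT : PATerm → Ext
  | var i => .of (BT.nv i)
  | zero => .of BT.zero
  | one => BT.one
  | add t u => BT.addOp ⬝ t.toBT ⬝ u.toBT
  | mul t u => BT.mulOp ⬝ t.toBT ⬝ u.toBT

/-- An arithmetical formula as a formula of `BT`. -/
def PAFormula.toBT : PAFormula → BTFormula
  | falsum => .falsum
  | eq t u => BT.eqv t.toBT u.toBT
  | and φ ψ => .and φ.toBT ψ.toBT
  | or φ ψ => .or φ.toBT ψ.toBT
  | imp φ ψ => .imp φ.toBT ψ.toBT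
  | all φ => BT.all .num φ.toBT
  | ex φ => BT.ex .num φ.toBT

end MSArith

/-!
An arithmetical formula is translated to itself: the translation changes neither the arithmetical
terms nor the numerical quantifiers (`PAFormula.star_toSA`), so the first part is the provability
of a formula `φ ≡ φ`.

The second part is proved semantically.  By the completeness theorem for many-sorted logic
(`Theory.provable_of_forall_models`) it is enough that the translation of the closure of a theorem
of `SA_s` holds in every model of `BT_s`.  The completeness theorem is proved with variables as
witnesses in the manner of Henkin; equality is not a logical symbol of the calculus, and the
structure of terms serves as a model.

In a model of `BT_s` the operations modulo `=_{00}` form a partial combinatory algebra with pairing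
and definition by cases on numbers (`BTModel.opAlg`).  Every object of any type `≤ s` is equal to an
operation, so that all objects may be regarded as elements of this algebra, and an external term has
at most one value in it.  Abstraction and the recursion operator behave as expected there
(`OpAlg.ev_lam`, `OpAlg.exists_recOp`), hence the terms for `+` and `·` satisfy their recursion
equations.  The induction rule of `BT` gives the induction axioms in models: it is applied to the
implication from the premises of an instance of induction to its conclusion (`BTModel.induction`).
Therefore addition and multiplication are total on numbers.

The model of `BT_s` determines a structure `BTModel.sa` for the language of `SA_s`.  Its sets of
sort `k` are the objects of type `k` all of whose elements have the form `{n}^{k-1}`, and `n` is a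
member of such a set if `{n}^{k-1}` is an element of it.  The translation is made so that `φ*` holds
in the model if and only if `φ` holds in this structure (`BTModel.sat_star`).  It remains to verify
the axioms of `SA_s` (`BTModel.sa_models`).

* The Peano axioms and induction carry over from the model by the facts above; they make the numbers
  a commutative semiring, in which Cantor's numbering of pairs is total and injective.
* For comprehension, the set `{{n}^{k-1} : φ(n)}` is formed by comprehension in `BT`.  It has the
  required members, since iterated singletons are injective (`BTModel.sa_comprehension`).  The
  formula `φ` may contain quantifiers over sets of sorts less than `k`, because their translations
  are still `k`-elementary.
* Choice is reduced to this stronger form of comprehension: the set `y` of all `(n, m)` such that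
  `m ∈ x` for some `x` with `φ(n, x)` is defined with a quantifier over sets of the sort preceding
  that of `y`, and extensional uniqueness of `x` yields that the sections of `y` are as required
  (`BTModel.sat_choice`).
-/

namespace MSArith

/-! ### Semantics of many-sorted logic -/

/-- A structure for a signature, with a distinguished element in each sort, so that valuations
exist. -/
structure Str (S : Sig) where
  D : S.Srt → Type
  pt : ∀ σ, D σ
  fn : {l : List S.Srt} → {σ : S.Srt} → S.Fn l σ → ((j : Fin l.length) → D (l.get j)) → D σ
  rel : {l : List S.Srt} → S.Rel l → ((j : Fin l.length) → D (l.get j)) → Prop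

/-- Families indexed by variables; for `D = M.D` these are the valuations in `M`, for
`D = Term S` the substitutions. -/
abbrev Val {S : Sig} (D : S.Srt → Type) : Type := (σ : S.Srt) → ℕ → D σ

section Semantics

variable {S : Sig}

/-- The valuation below a quantifier over `σ`: the new variable gets the value `d`. -/
def Val.cons {D : S.Srt → Type} (v : Val D) (σ : S.Srt) (d : D σ) : Val D := fun τ i =>
  if h : τ = σ then (match i with
    | 0 => h ▸ d
    | j + 1 => v τ j)
  else v τ i

section

variable {D : S.Srt → Type} (v : Val D) (σ τ : S.Srt) (d : D σ)

@[simp] theorem Val.cons_zero : v.cons σ d σ 0 = d := by simp [Val.cons]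

@[simp] theorem Val.cons_succ (i : ℕ) : v.cons σ d σ (i + 1) = v σ i := by simp [Val.cons]

@[simp] theorem Val.cons_ne {τ : S.Srt} (h : τ ≠ σ) (i : ℕ) : v.cons σ d τ i = v τ i := by
  simp [Val.cons, h]

@[simp] theorem Val.cons_shift (i : ℕ) : v.cons σ d τ (Ren.shift σ τ i) = v τ i := by
  by_cases h : τ = σ <;> simp [Val.cons, Ren.shift, h]

end

theorem Val.cons_comm {D : S.Srt → Type} (v : Val D) {σ τ : S.Srt} (h : σ ≠ τ) (a : D σ)
    (b : D τ) : (v.cons σ a).cons τ b = (v.cons τ b).cons σ a := by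
  funext ρ i
  by_cases h1 : ρ = σ
  · subst h1
    rw [Val.cons_ne _ _ _ h]
    cases i
    · rw [Val.cons_zero, Val.cons_zero]
    · rw [Val.cons_succ, Val.cons_succ, Val.cons_ne _ _ _ h]
  · rw [Val.cons_ne (v.cons τ b) σ a h1]
    by_cases h2 : ρ = τ
    · subst h2
      cases i
      · rw [Val.cons_zero, Val.cons_zero]
      · rw [Val.cons_succ, Val.cons_succ, Val.cons_ne _ _ _ h1]
    · rw [Val.cons_ne _ _ _ h2, Val.cons_ne _ _ _ h2, Val.cons_ne _ _ _ h1]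

@[simp] theorem Ren.up_zero (ρ : Ren S) (σ : S.Srt) : ρ.up σ σ 0 = 0 := by simp [Ren.up]

@[simp] theorem Ren.up_shift (ρ : Ren S) (σ τ : S.Srt) (i : ℕ) :
    ρ.up σ τ (Ren.shift σ τ i) = Ren.shift σ τ (ρ τ i) := by
  by_cases h : τ = σ <;> simp [Ren.up, Ren.shift, h]

/-- Every variable below a quantifier is the quantified one or comes from outside. -/
theorem var_cases (σ τ : S.Srt) (i : ℕ) : (τ = σ ∧ i = 0) ∨ ∃ j, i = Ren.shift σ τ j := by
  by_cases h : τ = σ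
  · cases i with
    | zero => exact .inl ⟨h, rfl⟩
    | succ i => exact .inr ⟨i, by simp [Ren.shift, h]⟩
  · exact .inr ⟨i, by simp [Ren.shift, h]⟩

theorem shift_injective (σ τ : S.Srt) : Function.Injective (Ren.shift σ τ) := by
  intro i j
  by_cases h : τ = σ <;> simp [Ren.shift, h]

theorem shift_self (σ : S.Srt) (i : ℕ) : Ren.shift σ σ i = i + 1 := by simp [Ren.shift]

@[simp] theorem shift_self_ne_zero (σ : S.Srt) (i : ℕ) : Ren.shift σ σ i ≠ 0 := by
  simp [Ren.shift]

/-- Two valuations agree if they agree on the quantified variable and on the outer ones. -/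
theorem Val.ext_cons {D : S.Srt → Type} {σ : S.Srt} {v w : Val D} (h0 : v σ 0 = w σ 0)
    (h : ∀ τ i, v τ (Ren.shift σ τ i) = w τ (Ren.shift σ τ i)) : v = w := by
  funext τ i
  rcases var_cases σ τ i with ⟨rfl, rfl⟩ | ⟨j, rfl⟩
  exacts [h0, h τ j]

theorem Val.cons_up {D : S.Srt → Type} (v : Val D) (ρ : Ren S) (σ : S.Srt) (d : D σ) :
    (fun τ i => v.cons σ d τ (ρ.up σ τ i)) = Val.cons (fun τ i => v τ (ρ τ i)) σ d :=
  Val.ext_cons (σ := σ) (by simp) (by simp)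

/-- The value of a term under a valuation. -/
def Term.val (M : Str S) (v : Val M.D) : {σ : S.Srt} → Term S σ → M.D σ
  | _, .var σ i => v σ i
  | _, .app f ts => M.fn f (fun j => (ts j).val M v)

/-- Satisfaction of a formula under a valuation. -/
def Formula.Sat (M : Str S) : Formula S → Val M.D → Prop
  | .falsum, _ => False
  | .rel r ts, v => M.rel r (fun j => (ts j).val M v)
  | .and φ ψ, v => φ.Sat M v ∧ ψ.Sat M v
  | .or φ ψ, v => φ.Sat M v ∨ ψ.Sat M v
  | .imp φ ψ, v => φ.Sat M v → ψ.Sat M v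
  | .all σ φ, v => ∀ d, φ.Sat M (v.cons σ d)
  | .ex σ φ, v => ∃ d, φ.Sat M (v.cons σ d)

variable {M : Str S}

@[simp] theorem Formula.sat_neg {φ : Formula S} {v : Val M.D} : φ.neg.Sat M v ↔ ¬ φ.Sat M v :=
  Iff.rfl

@[simp] theorem Formula.sat_iff {φ ψ : Formula S} {v : Val M.D} :
    (φ ⟷ ψ).Sat M v ↔ (φ.Sat M v ↔ ψ.Sat M v) :=
  iff_iff_implies_and_implies.symm

theorem Term.val_rename (ρ : Ren S) (v : Val M.D) {σ : S.Srt} (t : Term S σ) :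
    (t.rename ρ).val M v = t.val M (fun τ i => v τ (ρ τ i)) := by
  induction t with
  | var => rfl
  | app f ts ih => simp only [Term.rename, Term.val, ih]

theorem Formula.sat_rename (φ : Formula S) (ρ : Ren S) (v : Val M.D) :
    (φ.rename ρ).Sat M v ↔ φ.Sat M (fun τ i => v τ (ρ τ i)) := by
  induction φ generalizing ρ v with
  | falsum => rfl
  | rel r ts => simp only [Formula.rename, Formula.Sat, Term.val_rename]
  | and φ ψ h1 h2 => simp only [Formula.rename, Formula.Sat, h1, h2]
  | or φ ψ h1 h2 => simp only [Formula.rename, Formula.Sat, h1, h2]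
  | imp φ ψ h1 h2 => simp only [Formula.rename, Formula.Sat, h1, h2]
  | all σ φ h => simp only [Formula.rename, Formula.Sat, h, Val.cons_up]
  | ex σ φ h => simp only [Formula.rename, Formula.Sat, h, Val.cons_up]

@[simp] theorem Term.val_shift (v : Val M.D) (σ : S.Srt) (d : M.D σ) {τ : S.Srt} (t : Term S τ) :
    (t.shift σ).val M (v.cons σ d) = t.val M v := by
  simp [Term.shift, Term.val_rename]

@[simp] theorem Formula.sat_shift (φ : Formula S) (v : Val M.D) (σ : S.Srt) (d : M.D σ) :
    (φ.shift σ).Sat M (v.cons σ d) ↔ φ.Sat M v := by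
  simp [Formula.shift, Formula.sat_rename]

@[simp] theorem Formula.sat_shiftAbove (φ : Formula S) (v : Val M.D) (σ : S.Srt) (d e : M.D σ) :
    (φ.shiftAbove σ).Sat M ((v.cons σ d).cons σ e) ↔ φ.Sat M (v.cons σ e) := by
  simp [Formula.shiftAbove, Formula.sat_rename, Val.cons_up]

theorem Sub.up_zero (s : Sub S) (σ : S.Srt) : s.up σ σ 0 = .var σ 0 := by simp [Sub.up]

theorem Sub.up_shift (s : Sub S) (σ τ : S.Srt) (i : ℕ) :
    s.up σ τ (Ren.shift σ τ i) = (s τ i).shift σ := by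
  by_cases h : τ = σ <;> simp [Sub.up, Ren.shift, h]

theorem Term.val_subst (s : Sub S) (v : Val M.D) {σ : S.Srt} (t : Term S σ) :
    (t.subst s).val M v = t.val M (fun τ i => (s τ i).val M v) := by
  induction t with
  | var => rfl
  | app f ts ih => simp only [Term.subst, Term.val, ih]

theorem Val.cons_sub_up (s : Sub S) (v : Val M.D) (σ : S.Srt) (d : M.D σ) :
    (fun τ i => (s.up σ τ i).val M (v.cons σ d)) =
      Val.cons (fun τ i => (s τ i).val M v) σ d :=
  Val.ext_cons (σ := σ) (by simp [Sub.up_zero, Term.val]) (by simp [Sub.up_shift])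

theorem Formula.sat_subst (φ : Formula S) (s : Sub S) (v : Val M.D) :
    (φ.subst s).Sat M v ↔ φ.Sat M (fun τ i => (s τ i).val M v) := by
  induction φ generalizing s v with
  | falsum => rfl
  | rel r ts => simp only [Formula.subst, Formula.Sat, Term.val_subst]
  | and φ ψ h1 h2 => simp only [Formula.subst, Formula.Sat, h1, h2]
  | or φ ψ h1 h2 => simp only [Formula.subst, Formula.Sat, h1, h2]
  | imp φ ψ h1 h2 => simp only [Formula.subst, Formula.Sat, h1, h2]
  | all σ φ h => simp only [Formula.subst, Formula.Sat, h, Val.cons_sub_up]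
  | ex σ φ h => simp only [Formula.subst, Formula.Sat, h, Val.cons_sub_up]

theorem Sub.inst_zero (σ : S.Srt) (t : Term S σ) : Sub.inst σ t σ 0 = t := by simp [Sub.inst]

theorem Sub.inst_shift (σ : S.Srt) (t : Term S σ) (τ : S.Srt) (i : ℕ) :
    Sub.inst σ t τ (Ren.shift σ τ i) = .var τ i := by
  by_cases h : τ = σ <;> simp [Sub.inst, Ren.shift, h]

@[simp] theorem Formula.sat_inst {σ : S.Srt} (φ : Formula S) (t : Term S σ) (v : Val M.D) :
    (φ.inst t).Sat M v ↔ φ.Sat M (v.cons σ (t.val M v)) := by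
  have : (fun τ i => (Sub.inst σ t τ i).val M v) = v.cons σ (t.val M v) :=
    Val.ext_cons (σ := σ) (by simp [Sub.inst_zero]) (by simp [Sub.inst_shift, Term.val])
  rw [Formula.inst, Formula.sat_subst, this]

theorem Formula.sat_single {σ : S.Srt} (φ : Formula S) (t : Term S σ) (v : Val M.D) (d : M.D σ) :
    (φ.subst (Sub.single σ t)).Sat M (v.cons σ d) ↔
      φ.Sat M (v.cons σ (t.val M (v.cons σ d))) := by
  have : (fun τ i => (Sub.single σ t τ i).val M (v.cons σ d)) =
      v.cons σ (t.val M (v.cons σ d)) := by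
    refine Val.ext_cons (σ := σ) (by simp [Sub.single]) fun τ i => ?_
    have : Sub.single σ t τ (Ren.shift σ τ i) = .var τ (Ren.shift σ τ i) := by
      by_cases h : τ = σ <;> simp [Sub.single, Ren.shift, h]
    simp [this, Term.val]
  rw [Formula.sat_subst, this]

/-! ### Parameters and sorts of formulas -/

theorem Term.val_congr {v w : Val M.D} {σ : S.Srt} (t : Term S σ)
    (h : ∀ τ i, t.Occurs τ i → v τ i = w τ i) : t.val M v = t.val M w := by
  induction t with
  | var σ i => exact h σ i ⟨rfl, rfl⟩
  | app f ts ih =>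
    simp only [Term.val]
    congr 1
    funext j
    exact ih j fun τ i hi => h τ i ⟨j, hi⟩

theorem Val.cons_congr {D : S.Srt → Type} {v w : Val D} {P : S.Srt → ℕ → Prop} {σ : S.Srt} (d : D σ)
    (h : ∀ τ i, P τ (Ren.shift σ τ i) → v τ i = w τ i) (τ : S.Srt) (i : ℕ) (hi : P τ i) :
    v.cons σ d τ i = w.cons σ d τ i := by
  rcases var_cases σ τ i with ⟨rfl, rfl⟩ | ⟨j, rfl⟩
  · simp
  · simpa using h τ j hi

theorem Formula.sat_congr (φ : Formula S) {v w : Val M.D}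
    (h : ∀ τ i, φ.Free τ i → v τ i = w τ i) : φ.Sat M v ↔ φ.Sat M w := by
  induction φ generalizing v w with
  | falsum => rfl
  | rel r ts =>
    simp only [Formula.Sat]
    rw [show (fun j => (ts j).val M v) = fun j => (ts j).val M w from
      funext fun j => Term.val_congr _ fun τ i hi => h τ i ⟨j, hi⟩]
  | and φ ψ h1 h2 =>
    exact and_congr (h1 fun τ i hi => h τ i (.inl hi)) (h2 fun τ i hi => h τ i (.inr hi))
  | or φ ψ h1 h2 =>
    exact or_congr (h1 fun τ i hi => h τ i (.inl hi)) (h2 fun τ i hi => h τ i (.inr hi))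
  | imp φ ψ h1 h2 =>
    exact imp_congr (h1 fun τ i hi => h τ i (.inl hi)) (h2 fun τ i hi => h τ i (.inr hi))
  | all σ φ ih => exact forall_congr' fun d => ih (Val.cons_congr d h)
  | ex σ φ ih => exact exists_congr fun d => ih (Val.cons_congr d h)

theorem Term.occurs_rename (ρ : Ren S) {σ : S.Srt} (t : Term S σ) (τ : S.Srt) (i : ℕ) :
    (t.rename ρ).Occurs τ i ↔ ∃ j, t.Occurs τ j ∧ ρ τ j = i := by
  induction t with
  | var σ k =>
    simp only [Term.rename, Term.Occurs]
    constructor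
    · rintro ⟨rfl, rfl⟩
      exact ⟨k, ⟨rfl, rfl⟩, rfl⟩
    · rintro ⟨j, ⟨rfl, rfl⟩, rfl⟩
      exact ⟨rfl, rfl⟩
  | app f ts ih =>
    simp only [Term.rename, Term.Occurs, ih]
    constructor
    · rintro ⟨a, j, h⟩
      exact ⟨j, ⟨a, h.1⟩, h.2⟩
    · rintro ⟨j, ⟨a, h⟩, h2⟩
      exact ⟨a, j, h, h2⟩

theorem Ren.exists_up (ρ : Ren S) (σ τ : S.Srt) (P : ℕ → Prop) (i : ℕ) :
    (∃ j, P j ∧ ρ.up σ τ j = Ren.shift σ τ i) ↔ ∃ j, P (Ren.shift σ τ j) ∧ ρ τ j = i := by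
  constructor
  · rintro ⟨j, hj, h⟩
    rcases var_cases σ τ j with ⟨rfl, rfl⟩ | ⟨k, rfl⟩
    · exact absurd h.symm (by simp)
    · exact ⟨k, hj, shift_injective σ τ (by simpa using h)⟩
  · rintro ⟨j, hj, rfl⟩
    exact ⟨_, hj, by simp⟩

theorem Formula.free_rename (ρ : Ren S) (φ : Formula S) (τ : S.Srt) (i : ℕ) :
    (φ.rename ρ).Free τ i ↔ ∃ j, φ.Free τ j ∧ ρ τ j = i := by
  induction φ generalizing ρ i with
  | falsum => simp [Formula.rename, Formula.Free]
  | rel r ts =>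
    simp only [Formula.rename, Formula.Free, Term.occurs_rename]
    constructor
    · rintro ⟨a, j, h⟩
      exact ⟨j, ⟨a, h.1⟩, h.2⟩
    · rintro ⟨j, ⟨a, h⟩, h2⟩
      exact ⟨a, j, h, h2⟩
  | and φ ψ h1 h2 => simp only [Formula.rename, Formula.Free, h1, h2, or_and_right, exists_or]
  | or φ ψ h1 h2 => simp only [Formula.rename, Formula.Free, h1, h2, or_and_right, exists_or]
  | imp φ ψ h1 h2 => simp only [Formula.rename, Formula.Free, h1, h2, or_and_right, exists_or]
  | all σ φ h => simp only [Formula.rename, Formula.Free, h, Ren.exists_up]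
  | ex σ φ h => simp only [Formula.rename, Formula.Free, h, Ren.exists_up]

theorem Term.exists_bound {σ : S.Srt} (t : Term S σ) :
    ∃ l : List (Var S), ∀ τ i, t.Occurs τ i → (⟨τ, i⟩ : Var S) ∈ l := by
  induction t with
  | var σ i => exact ⟨[⟨σ, i⟩], by rintro τ j ⟨rfl, rfl⟩; simp⟩
  | app f ts ih =>
    choose l hl using ih
    exact ⟨(List.ofFn l).flatten, fun τ i ⟨j, hj⟩ => List.mem_flatten.2
      ⟨l j, List.mem_ofFn.2 ⟨j, rfl⟩, hl j τ i hj⟩⟩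

theorem exists_bound_unshift (σ : S.Srt) (l : List (Var S)) :
    ∃ l' : List (Var S), ∀ τ i, (⟨τ, Ren.shift σ τ i⟩ : Var S) ∈ l → (⟨τ, i⟩ : Var S) ∈ l' := by
  refine ⟨l ++ l.map fun v => ⟨v.1, v.2 - 1⟩, fun τ i h => ?_⟩
  by_cases hσ : τ = σ
  · refine List.mem_append_right _ (List.mem_map.2 ⟨_, h, ?_⟩)
    simp [Ren.shift, hσ]
  · refine List.mem_append_left _ ?_
    simpa [Ren.shift, hσ] using h

/-- A formula has finitely many parameters. -/
theorem Formula.exists_bound (φ : Formula S) :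
    ∃ l : List (Var S), ∀ τ i, φ.Free τ i → (⟨τ, i⟩ : Var S) ∈ l := by
  have bin : ∀ {l₁ l₂ : List (Var S)} {P Q : S.Srt → ℕ → Prop},
      (∀ τ i, P τ i → (⟨τ, i⟩ : Var S) ∈ l₁) → (∀ τ i, Q τ i → (⟨τ, i⟩ : Var S) ∈ l₂) →
      ∃ l : List (Var S), ∀ τ i, (P τ i ∨ Q τ i) → (⟨τ, i⟩ : Var S) ∈ l :=
    fun {l₁ l₂ P Q} h1 h2 => ⟨l₁ ++ l₂, fun τ i h => List.mem_append.2 (h.imp (h1 τ i) (h2 τ i))⟩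
  induction φ with
  | falsum => exact ⟨[], fun _ _ h => h.elim⟩
  | rel r ts =>
    choose l hl using fun j => (ts j).exists_bound
    exact ⟨(List.ofFn l).flatten, fun τ i ⟨j, hj⟩ => List.mem_flatten.2
      ⟨l j, List.mem_ofFn.2 ⟨j, rfl⟩, hl j τ i hj⟩⟩
  | and φ ψ h1 h2 => exact bin h1.choose_spec h2.choose_spec
  | or φ ψ h1 h2 => exact bin h1.choose_spec h2.choose_spec
  | imp φ ψ h1 h2 => exact bin h1.choose_spec h2.choose_spec
  | all σ φ h =>
    obtain ⟨l, hl⟩ := h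
    obtain ⟨l', hl'⟩ := exists_bound_unshift σ l
    exact ⟨l', fun τ i hi => hl' τ i (hl _ _ hi)⟩
  | ex σ φ h =>
    obtain ⟨l, hl⟩ := h
    obtain ⟨l', hl'⟩ := exists_bound_unshift σ l
    exact ⟨l', fun τ i hi => hl' τ i (hl _ _ hi)⟩

theorem Formula.exists_index_bound (φ : Formula S) : ∃ n, ∀ τ i, φ.Free τ i → i < n := by
  obtain ⟨l, hl⟩ := φ.exists_bound
  refine ⟨(l.map fun v => v.2 + 1).sum, fun τ i hi => ?_⟩
  exact Nat.lt_of_succ_le (List.le_sum_of_mem (List.mem_map.2 ⟨_, hl τ i hi, rfl⟩))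

variable {A : Set S.Srt}

theorem Term.SortsIn.mem {σ : S.Srt} {t : Term S σ} (h : t.SortsIn A) : σ ∈ A := by
  cases t with
  | var => exact h
  | app => exact h.1

theorem Term.SortsIn.of_occurs {σ : S.Srt} {t : Term S σ} (h : t.SortsIn A) {τ : S.Srt} {i : ℕ}
    (hi : t.Occurs τ i) : τ ∈ A := by
  induction t with
  | var σ j => obtain ⟨rfl, -⟩ := hi; exact h
  | app f ts ih => obtain ⟨j, hj⟩ := hi; exact ih j (h.2 j) hj

theorem Formula.SortsIn.of_free {φ : Formula S} (h : φ.SortsIn A) {τ : S.Srt} {i : ℕ}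
    (hi : φ.Free τ i) : τ ∈ A := by
  induction φ generalizing i with
  | falsum => exact hi.elim
  | rel r ts => obtain ⟨j, hj⟩ := hi; exact (h j).of_occurs hj
  | and φ ψ h1 h2 => exact hi.elim (h1 h.1) (h2 h.2)
  | or φ ψ h1 h2 => exact hi.elim (h1 h.1) (h2 h.2)
  | imp φ ψ h1 h2 => exact hi.elim (h1 h.1) (h2 h.2)
  | all σ φ ih => exact ih h.2 hi
  | ex σ φ ih => exact ih h.2 hi

theorem Term.SortsIn.mono {A' : Set S.Srt} (hA : A ⊆ A') {σ : S.Srt} {t : Term S σ}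
    (h : t.SortsIn A) : t.SortsIn A' := by
  induction t with
  | var => exact hA h
  | app f ts ih => exact ⟨hA h.1, fun j => ih j (h.2 j)⟩

theorem Formula.SortsIn.mono {A' : Set S.Srt} (hA : A ⊆ A') {φ : Formula S} (h : φ.SortsIn A) :
    φ.SortsIn A' := by
  induction φ with
  | falsum => trivial
  | rel r ts => exact fun j => (h j).mono hA
  | and φ ψ h1 h2 => exact ⟨h1 h.1, h2 h.2⟩
  | or φ ψ h1 h2 => exact ⟨h1 h.1, h2 h.2⟩
  | imp φ ψ h1 h2 => exact ⟨h1 h.1, h2 h.2⟩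
  | all σ φ ih => exact ⟨hA h.1, ih h.2⟩
  | ex σ φ ih => exact ⟨hA h.1, ih h.2⟩

theorem Formula.QuantifiersIn.mono {A' : Set S.Srt} (hA : A ⊆ A') {φ : Formula S}
    (h : φ.QuantifiersIn A) : φ.QuantifiersIn A' := by
  induction φ with
  | falsum => trivial
  | rel r ts => trivial
  | and φ ψ h1 h2 => exact ⟨h1 h.1, h2 h.2⟩
  | or φ ψ h1 h2 => exact ⟨h1 h.1, h2 h.2⟩
  | imp φ ψ h1 h2 => exact ⟨h1 h.1, h2 h.2⟩
  | all σ φ ih => exact ⟨hA h.1, ih h.2⟩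
  | ex σ φ ih => exact ⟨hA h.1, ih h.2⟩

@[simp] theorem Term.sortsIn_rename (ρ : Ren S) {σ : S.Srt} (t : Term S σ) :
    (t.rename ρ).SortsIn A ↔ t.SortsIn A := by
  induction t with
  | var => rfl
  | app f ts ih => simp only [Term.rename, Term.SortsIn, ih]

@[simp] theorem Formula.sortsIn_rename (ρ : Ren S) (φ : Formula S) :
    (φ.rename ρ).SortsIn A ↔ φ.SortsIn A := by
  induction φ generalizing ρ <;> simp_all [Formula.rename, Formula.SortsIn]

@[simp] theorem Formula.sortsIn_shift (σ : S.Srt) (φ : Formula S) :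
    (φ.shift σ).SortsIn A ↔ φ.SortsIn A := φ.sortsIn_rename _

@[simp] theorem Formula.quantifiersIn_rename (ρ : Ren S) (φ : Formula S) :
    (φ.rename ρ).QuantifiersIn A ↔ φ.QuantifiersIn A := by
  induction φ generalizing ρ <;> simp_all [Formula.rename, Formula.QuantifiersIn]

@[simp] theorem Formula.relsIn_rename (P : {l : List S.Srt} → S.Rel l → Prop) (ρ : Ren S)
    (φ : Formula S) : (φ.rename ρ).RelsIn P ↔ φ.RelsIn P := by
  induction φ generalizing ρ <;> simp_all [Formula.rename, Formula.RelsIn]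

theorem Term.SortsIn.subst {s : Sub S} {σ : S.Srt} {t : Term S σ} (h : t.SortsIn A)
    (hs : ∀ τ ∈ A, ∀ i, (s τ i).SortsIn A) : (t.subst s).SortsIn A := by
  induction t with
  | var σ i => exact hs σ h i
  | app f ts ih => exact ⟨h.1, fun j => ih j (h.2 j)⟩

theorem Formula.SortsIn.subst {s : Sub S} {φ : Formula S} (h : φ.SortsIn A)
    (hs : ∀ τ ∈ A, ∀ i, (s τ i).SortsIn A) : (φ.subst s).SortsIn A := by
  have up : ∀ (σ : S.Srt) (s : Sub S), (∀ τ ∈ A, ∀ i, (s τ i).SortsIn A) →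
      ∀ τ ∈ A, ∀ i, (s.up σ τ i).SortsIn A := by
    intro σ s hs τ hτ i
    rcases var_cases σ τ i with ⟨rfl, rfl⟩ | ⟨j, rfl⟩
    · rw [Sub.up_zero]; exact hτ
    · rw [Sub.up_shift]; exact (Term.sortsIn_rename _ _).2 (hs τ hτ j)
  induction φ generalizing s with
  | falsum => trivial
  | rel r ts => exact fun j => (h j).subst hs
  | and φ ψ h1 h2 => exact ⟨h1 h.1 hs, h2 h.2 hs⟩
  | or φ ψ h1 h2 => exact ⟨h1 h.1 hs, h2 h.2 hs⟩
  | imp φ ψ h1 h2 => exact ⟨h1 h.1 hs, h2 h.2 hs⟩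
  | all σ φ ih => exact ⟨h.1, ih h.2 (up σ s hs)⟩
  | ex σ φ ih => exact ⟨h.1, ih h.2 (up σ s hs)⟩

theorem Formula.SortsIn.inst {σ : S.Srt} {φ : Formula S} (h : φ.SortsIn A) {t : Term S σ}
    (ht : t.SortsIn A) : (φ.inst t).SortsIn A := by
  refine h.subst fun τ hτ i => ?_
  rcases var_cases σ τ i with ⟨rfl, rfl⟩ | ⟨j, rfl⟩
  · rwa [Sub.inst_zero]
  · rw [Sub.inst_shift]; exact hτ

/-! ### Composition of substitutions -/

theorem Term.subst_congr {s s' : Sub S} {σ : S.Srt} (t : Term S σ)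
    (h : ∀ τ i, t.Occurs τ i → s τ i = s' τ i) : t.subst s = t.subst s' := by
  induction t with
  | var σ i => exact h σ i ⟨rfl, rfl⟩
  | app f ts ih =>
    simp only [Term.subst]
    congr 1
    funext j
    exact ih j fun τ i hi => h τ i ⟨j, hi⟩

theorem Sub.up_congr {s s' : Sub S} {P : S.Srt → ℕ → Prop} {σ : S.Srt}
    (h : ∀ τ i, P τ (Ren.shift σ τ i) → s τ i = s' τ i) (τ : S.Srt) (i : ℕ) (hi : P τ i) :
    s.up σ τ i = s'.up σ τ i := by
  rcases var_cases σ τ i with ⟨rfl, rfl⟩ | ⟨j, rfl⟩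
  · rw [Sub.up_zero, Sub.up_zero]
  · rw [Sub.up_shift, Sub.up_shift, h τ j hi]

theorem Formula.subst_congr {s s' : Sub S} (φ : Formula S)
    (h : ∀ τ i, φ.Free τ i → s τ i = s' τ i) : φ.subst s = φ.subst s' := by
  induction φ generalizing s s' with
  | falsum => rfl
  | rel r ts =>
    simp only [Formula.subst]
    congr 1
    funext j
    exact Term.subst_congr _ fun τ i hi => h τ i ⟨j, hi⟩
  | and φ ψ h1 h2 =>
    exact congrArg₂ Formula.and (h1 fun τ i hi => h τ i (.inl hi))
      (h2 fun τ i hi => h τ i (.inr hi))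
  | or φ ψ h1 h2 =>
    exact congrArg₂ Formula.or (h1 fun τ i hi => h τ i (.inl hi)) (h2 fun τ i hi => h τ i (.inr hi))
  | imp φ ψ h1 h2 =>
    exact congrArg₂ Formula.imp (h1 fun τ i hi => h τ i (.inl hi))
      (h2 fun τ i hi => h τ i (.inr hi))
  | all σ φ ih => exact congrArg (Formula.all σ) (ih (Sub.up_congr h))
  | ex σ φ ih => exact congrArg (Formula.ex σ) (ih (Sub.up_congr h))

theorem Term.rename_eq_subst (ρ : Ren S) {σ : S.Srt} (t : Term S σ) :
    t.rename ρ = t.subst (fun τ i => .var τ (ρ τ i)) := by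
  induction t with
  | var => rfl
  | app f ts ih => simp only [Term.rename, Term.subst, ih]

theorem Formula.rename_eq_subst (ρ : Ren S) (φ : Formula S) :
    φ.rename ρ = φ.subst (fun τ i => .var τ (ρ τ i)) := by
  have up : ∀ (σ : S.Srt) (ρ : Ren S),
      (fun τ i => Term.var τ (ρ.up σ τ i)) = Sub.up σ fun τ i => .var τ (ρ τ i) := fun σ ρ =>
    Val.ext_cons (D := Term S) (σ := σ) (by simp [Sub.up_zero])
      (by simp [Sub.up_shift, Term.shift, Term.rename])
  induction φ generalizing ρ with
  | falsum => rfl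
  | rel r ts => simp only [Formula.rename, Formula.subst, Term.rename_eq_subst]
  | and φ ψ h1 h2 => simp only [Formula.rename, Formula.subst, h1, h2]
  | or φ ψ h1 h2 => simp only [Formula.rename, Formula.subst, h1, h2]
  | imp φ ψ h1 h2 => simp only [Formula.rename, Formula.subst, h1, h2]
  | all σ φ ih => simp only [Formula.rename, Formula.subst, ih, up]
  | ex σ φ ih => simp only [Formula.rename, Formula.subst, ih, up]

theorem Term.subst_subst (s s' : Sub S) {σ : S.Srt} (t : Term S σ) :
    (t.subst s).subst s' = t.subst (fun τ i => (s τ i).subst s') := by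
  induction t with
  | var => rfl
  | app f ts ih => simp only [Term.subst, ih]

theorem Sub.up_comp (s s' : Sub S) (σ : S.Srt) :
    (fun τ i => (s.up σ τ i).subst (s'.up σ)) = Sub.up σ fun τ i => (s τ i).subst s' := by
  refine Val.ext_cons (D := Term S) (σ := σ) (by simp [Sub.up_zero, Term.subst]) fun τ i => ?_
  simp only [Sub.up_shift, Term.shift, Term.rename_eq_subst, Term.subst_subst, Term.subst]

theorem Formula.subst_subst (s s' : Sub S) (φ : Formula S) :
    (φ.subst s).subst s' = φ.subst (fun τ i => (s τ i).subst s') := by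
  induction φ generalizing s s' with
  | falsum => rfl
  | rel r ts => simp only [Formula.subst, Term.subst_subst]
  | and φ ψ h1 h2 => simp only [Formula.subst, h1, h2]
  | or φ ψ h1 h2 => simp only [Formula.subst, h1, h2]
  | imp φ ψ h1 h2 => simp only [Formula.subst, h1, h2]
  | all σ φ ih => simp only [Formula.subst, ih, Sub.up_comp]
  | ex σ φ ih => simp only [Formula.subst, ih, Sub.up_comp]

theorem Term.subst_var {σ : S.Srt} (t : Term S σ) : t.subst Term.var = t := by
  induction t with
  | var => rfl
  | app f ts ih => simp only [Term.subst, ih]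

theorem Formula.subst_var (φ : Formula S) : φ.subst Term.var = φ := by
  have up : ∀ σ : S.Srt, Sub.up σ (Term.var (S := S)) = Term.var := fun σ =>
    Val.ext_cons (D := Term S) (σ := σ) (by simp [Sub.up_zero])
      (by simp [Sub.up_shift, Term.shift, Term.rename])
  induction φ with
  | falsum => rfl
  | rel r ts => simp only [Formula.subst, Term.subst_var]
  | and φ ψ h1 h2 => simp only [Formula.subst, h1, h2]
  | or φ ψ h1 h2 => simp only [Formula.subst, h1, h2]
  | imp φ ψ h1 h2 => simp only [Formula.subst, h1, h2]
  | all σ φ ih => simp only [Formula.subst, ih, up]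
  | ex σ φ ih => simp only [Formula.subst, ih, up]

theorem Formula.subst_up_inst (φ : Formula S) (s : Sub S) (σ : S.Srt) (t : Term S σ) :
    (φ.subst (s.up σ)).inst t = φ.subst (Val.cons (D := Term S) s σ t) := by
  rw [Formula.inst, Formula.subst_subst]
  congr 1
  refine Val.ext_cons (D := Term S) (σ := σ) ?_ fun τ i => ?_
  · rw [Sub.up_zero, Val.cons_zero]; exact Sub.inst_zero σ t
  · simp only [Val.cons_shift, Sub.up_shift, Term.shift, Term.rename_eq_subst, Term.subst_subst,
      Term.subst, Sub.inst_shift, Term.subst_var]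

end Semantics

/-! ### Derived rules of the calculus -/

section Calculus

variable {S : Sig} {T : Theory S} {φ ψ χ θ : Formula S}

namespace Theory.Provable

theorem sortsIn (h : T.Provable φ) : φ.SortsIn T.sorts := by
  induction h with
  | logical _ hL => exact hL
  | ax _ hL => exact hL
  | rule _ _ hL => exact hL
  | mp _ _ h _ => exact h.2
  | allIntro _ hL h => exact ⟨(Formula.sortsIn_shift _ _).1 h.1, hL, h.2⟩
  | exElim _ hL h => exact ⟨⟨hL, h.1⟩, (Formula.sortsIn_shift _ _).1 h.2⟩

theorem const (h : T.Provable ψ) (hχ : χ.SortsIn T.sorts) : T.Provable (χ ➝ ψ) :=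
  mp (logical (.weaken ψ χ) ⟨h.sortsIn, hχ, h.sortsIn⟩) h

/-- Modus ponens under a hypothesis. -/
theorem mpUnder (h₁ : T.Provable (χ ➝ ψ ➝ θ)) (h₂ : T.Provable (χ ➝ ψ)) :
    T.Provable (χ ➝ θ) :=
  mp (mp (logical (.distrib χ ψ θ) ⟨h₁.sortsIn, h₂.sortsIn, h₁.sortsIn.1, h₁.sortsIn.2.2⟩) h₁) h₂

theorem refl (hφ : φ.SortsIn T.sorts) : T.Provable (φ ➝ φ) :=
  mpUnder (logical (.weaken φ (φ ➝ φ)) ⟨hφ, ⟨hφ, hφ⟩, hφ⟩) (logical (.weaken φ φ) ⟨hφ, hφ, hφ⟩)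

theorem trans (h₁ : T.Provable (χ ➝ ψ)) (h₂ : T.Provable (ψ ➝ θ)) : T.Provable (χ ➝ θ) :=
  mpUnder (h₂.const h₁.sortsIn.1) h₁

theorem flip (h : T.Provable (χ ➝ ψ ➝ θ)) : T.Provable (ψ ➝ χ ➝ θ) := by
  have s := h.sortsIn
  have h₁ : T.Provable ((χ ➝ ψ) ➝ χ ➝ θ) := mp (logical (.distrib χ ψ θ)
    ⟨s, ⟨s.1, s.2.1⟩, s.1, s.2.2⟩) h
  exact trans (logical (.weaken ψ χ) ⟨s.2.1, s.1, s.2.1⟩) h₁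

theorem curry (h : T.Provable (χ ⋏ ψ ➝ θ)) : T.Provable (χ ➝ ψ ➝ θ) := by
  have s := h.sortsIn
  have h₁ : T.Provable (χ ➝ (ψ ➝ χ ⋏ ψ) ➝ ψ ➝ θ) := const
    (mp (logical (.distrib ψ (χ ⋏ ψ) θ) ⟨⟨s.1.2, s⟩, ⟨s.1.2, s.1⟩, s.1.2, s.2⟩)
      (h.const s.1.2)) s.1.1
  exact mpUnder h₁ (logical (.andIntro χ ψ) ⟨s.1.1, s.1.2, s.1⟩)

theorem generalize (h : T.Provable φ) {σ : S.Srt} (hσ : σ ∈ T.sorts) :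
    T.Provable (.all σ φ) :=
  mp (allIntro (χ := .imp .falsum .falsum) (h.const ⟨trivial, trivial⟩) hσ)
    (refl (φ := .falsum) trivial)

theorem inst (h : T.Provable φ) {σ : S.Srt} {t : Term S σ} (ht : t.SortsIn T.sorts) :
    T.Provable (φ.inst t) :=
  mp (logical (.allElim σ φ t) ⟨⟨ht.mem, h.sortsIn⟩, h.sortsIn.inst ht⟩) (h.generalize ht.mem)

/-- Provability is closed under renamings of the variables of one sort that are, from some index
`n` on, the downward shift by `n`: generalize `n` times and instantiate. -/
theorem renameInitial (n : ℕ) (ρ : ℕ → ℕ) {σ : S.Srt} (hσ : σ ∈ T.sorts) (h : T.Provable φ) :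
    T.Provable (φ.subst fun τ i =>
      .var τ (if τ = σ then (if i < n then ρ i else i - n) else i)) := by
  induction n generalizing ρ φ with
  | zero =>
    have : (fun τ i => .var τ (if τ = σ then (if i < 0 then ρ i else i - 0) else i)) =
      Term.var (S := S) := by simp
    rwa [this, Formula.subst_var]
  | succ n ih =>
    have := ih (fun i => ρ (i + 1)) (h.inst (t := .var σ (ρ 0 + n)) hσ)
    rw [Formula.inst, Formula.subst_subst] at this
    convert this using 2
    refine Val.ext_cons (D := Term S) (σ := σ) ?_ fun τ i => ?_
    · rw [Sub.inst_zero]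
      simp [Term.subst]
    · rw [Sub.inst_shift]
      by_cases hτ : τ = σ <;> simp [Term.subst, Ren.shift, hτ]

/-- The rule for `∃` with a parameter in place of the quantified variable. -/
theorem exElimVar {σ : S.Srt} {i : ℕ} (hσ : σ ∈ T.sorts) (hχ : ¬ χ.Free σ i)
    (hφ : ¬ φ.Free σ (i + 1)) (h : T.Provable (φ.inst (.var σ i) ➝ χ)) :
    T.Provable (.ex σ φ ➝ χ) := by
  refine exElim ?_ hσ
  obtain ⟨a, ha⟩ := χ.exists_index_bound
  obtain ⟨b, hb⟩ := φ.exists_index_bound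
  have := h.renameInitial (a + b + i + 1) (fun j => if j = i then 0 else j + 1) hσ
  simp only [Formula.subst, Formula.inst, Formula.subst_subst] at this
  convert this using 2
  · rw [Formula.subst_congr (s' := Term.var), Formula.subst_var]
    intro τ j hj
    have hjb := hb τ j hj
    rcases var_cases σ τ j with ⟨rfl, rfl⟩ | ⟨j, rfl⟩
    · rw [Sub.inst_zero]
      have : i < a + b + i + 1 := by omega
      simp [Term.subst, this]
    · rw [Sub.inst_shift]
      by_cases hτ : τ = σ
      · subst hτ
        have hne : j ≠ i := by
          rintro rfl
          exact hφ (by simpa [Ren.shift] using hj)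
        have : j < a + b + i + 1 := by
          rw [shift_self] at hjb
          omega
        simp [Term.subst, Ren.shift, hne, this]
      · simp [Term.subst, Ren.shift, hτ]
  · rw [Formula.shift, Formula.rename_eq_subst]
    refine Formula.subst_congr _ fun τ j hj => ?_
    have hja := ha τ j hj
    by_cases hτ : τ = σ
    · subst hτ
      have hne : j ≠ i := by
        rintro rfl
        exact hχ hj
      have : j < a + b + i + 1 := by omega
      simp [Ren.shift, hne, this]
    · simp [Ren.shift, hτ]

end Theory.Provable

/-! ### Completeness -/

/-- A complete consistent set of formulas of the language of `T` which contains the theorems of `T`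
and is closed under modus ponens, with variables as witnesses of existential formulas. -/
structure HenkinSet (T : Theory S) (Γ : Set (Formula S)) : Prop where
  theorems : ∀ {φ}, T.Provable φ → φ ∈ Γ
  mp : ∀ {φ ψ}, (φ ➝ ψ) ∈ Γ → φ ∈ Γ → ψ ∈ Γ
  complete : ∀ {φ : Formula S}, φ.SortsIn T.sorts → φ ∉ Γ → φ.neg ∈ Γ
  consistent : Formula.falsum ∉ Γ
  witness : ∀ {σ φ}, Formula.ex σ φ ∈ Γ → ∃ t, φ.inst (σ := σ) t ∈ Γ

/-- The formula lies in the language of `T` and is consistent with `T`. -/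
def Theory.Con (T : Theory S) (χ : Formula S) : Prop :=
  χ.SortsIn T.sorts ∧ ¬ T.Provable (χ ➝ .falsum)

theorem Theory.Con.decide (h : T.Con χ) (hψ : ψ.SortsIn T.sorts) :
    T.Con (χ ⋏ ψ) ∨ T.Con (χ ⋏ ψ.neg) := by
  by_contra! hn
  have h₁ : T.Provable (χ ⋏ ψ ➝ .falsum) := by
    by_contra hc
    exact hn.1 ⟨⟨h.1, hψ⟩, hc⟩
  have h₂ : T.Provable (χ ⋏ ψ.neg ➝ .falsum) := by
    by_contra hc
    exact hn.2 ⟨⟨h.1, hψ, trivial⟩, hc⟩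
  exact h.2 (h₂.curry.mpUnder h₁.curry)

theorem Theory.provable_and_left (hχ : χ.SortsIn T.sorts) (hψ : ψ.SortsIn T.sorts) :
    T.Provable (χ ⋏ ψ ➝ χ) := .logical (.andLeft χ ψ) ⟨⟨hχ, hψ⟩, hχ⟩

theorem Theory.provable_and_right (hχ : χ.SortsIn T.sorts) (hψ : ψ.SortsIn T.sorts) :
    T.Provable (χ ⋏ ψ ➝ ψ) := .logical (.andRight χ ψ) ⟨⟨hχ, hψ⟩, hψ⟩

/-- A consistent existential formula is consistent with an instance at a new variable. -/
theorem Theory.Con.witness {σ : S.Srt} (h : T.Con (χ ⋏ .ex σ φ)) :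
    ∃ i, T.Con ((χ ⋏ .ex σ φ) ⋏ φ.inst (.var σ i)) := by
  obtain ⟨⟨h1, h2, h3⟩, hcon⟩ := h
  obtain ⟨a, ha⟩ := (χ ⋏ .ex σ φ).exists_index_bound
  obtain ⟨b, hb⟩ := φ.exists_index_bound
  refine ⟨a + b, ⟨⟨h1, h2, h3⟩, h3.inst h2⟩, fun hc => hcon ?_⟩
  have := Theory.Provable.exElimVar (i := a + b) h2
    (fun hf => by
      rcases hf with hf | hf
      · have := ha _ _ hf; omega
      · exact hf) (fun hf => by have := hb _ _ hf; omega) hc.curry.flip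
  exact this.flip.mpUnder (T.provable_and_right h1 ⟨h2, h3⟩)

/-- A consistent formula has a consistent strengthening that decides `ψ`, and has a variable as a
witness if it implies an existential `ψ`. -/
theorem Theory.Con.step (h : T.Con χ) (ψ : Formula S) :
    ∃ χ', T.Con χ' ∧ T.Provable (χ' ➝ χ) ∧ (ψ.SortsIn T.sorts →
      T.Provable (χ' ➝ ψ.neg) ∨ (T.Provable (χ' ➝ ψ) ∧
        ∀ σ θ, ψ = .ex σ θ → ∃ i, T.Provable (χ' ➝ θ.inst (.var σ i)))) := by
  by_cases hψ : ψ.SortsIn T.sorts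
  swap
  · exact ⟨χ, h, .refl h.1, fun hc => absurd hc hψ⟩
  rcases h.decide hψ with hd | hd
  · by_cases hex : ∃ σ θ, ψ = .ex σ θ
    · obtain ⟨σ, θ, rfl⟩ := hex
      obtain ⟨i, hi⟩ := hd.witness
      have hl := T.provable_and_left hi.1.1 hi.1.2
      refine ⟨_, hi, hl.trans (T.provable_and_left h.1 hψ), fun _ => .inr
        ⟨hl.trans (T.provable_and_right h.1 hψ), fun σ' θ' he => ?_⟩⟩
      cases he
      exact ⟨i, T.provable_and_right hi.1.1 hi.1.2⟩
    · exact ⟨_, hd, T.provable_and_left h.1 hψ, fun _ => .inr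
        ⟨T.provable_and_right h.1 hψ, fun σ θ he => absurd ⟨σ, θ, he⟩ hex⟩⟩
  · exact ⟨_, hd, T.provable_and_left h.1 ⟨hψ, trivial⟩, fun _ => .inl
      (T.provable_and_right h.1 ⟨hψ, trivial⟩)⟩

/-- A formula that is not provable is left out by some Henkin set: the formulas are decided one
after the other, each existential formula that is accepted getting a new variable as a witness. -/
theorem exists_henkinSet [Countable (Formula S)] (hφ : φ.SortsIn T.sorts) (h : ¬ T.Provable φ) :
    ∃ Γ, HenkinSet T Γ ∧ φ ∉ Γ := by
  have : Nonempty (Formula S) := ⟨φ⟩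
  obtain ⟨e, he⟩ := exists_surjective_nat (Formula S)
  choose next hcon himp hdec using fun (χ : {χ // T.Con χ}) ψ => χ.2.step ψ
  have h0 : T.Con φ.neg := ⟨⟨hφ, trivial⟩, fun hc => h (.mp (.logical (.doubleNeg φ)
    ⟨⟨⟨hφ, trivial⟩, trivial⟩, hφ⟩) hc)⟩
  let c : ℕ → {χ // T.Con χ} := fun n =>
    n.rec ⟨φ.neg, h0⟩ fun n χ => ⟨next χ (e n), hcon χ (e n)⟩
  have hmono : ∀ m n, m ≤ n → T.Provable ((c n).1 ➝ (c m).1) := by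
    intro m n hmn
    induction hmn with
    | refl => exact .refl (c m).2.1
    | step _ ih => exact (himp (c _) (e _)).trans ih
  let Γ : Set (Formula S) := {ψ | ∃ n, T.Provable ((c n).1 ➝ ψ)}
  have hmp : ∀ {ψ θ}, (ψ ➝ θ) ∈ Γ → ψ ∈ Γ → θ ∈ Γ := by
    rintro ψ θ ⟨m, hm⟩ ⟨n, hn⟩
    exact ⟨max m n, ((hmono m _ (le_max_left m n)).trans hm).mpUnder
      ((hmono n _ (le_max_right m n)).trans hn)⟩
  have hfalsum : Formula.falsum ∉ Γ := fun ⟨n, hn⟩ => (c n).2.2 hn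
  refine ⟨Γ, ⟨fun {ψ} hψ => ⟨0, hψ.const (c 0).2.1⟩, hmp, fun {ψ} hψ hn => ?_, hfalsum,
    fun {σ θ} hex => ?_⟩, fun hm => hfalsum (hmp ⟨0, .refl h0.1⟩ hm)⟩
  · obtain ⟨n, rfl⟩ := he ψ
    rcases hdec (c n) (e n) hψ with hd | hd
    · exact ⟨n + 1, hd⟩
    · exact absurd ⟨n + 1, hd.1⟩ hn
  · obtain ⟨n, hn⟩ := he (.ex σ θ)
    have hs : (e n).SortsIn T.sorts := by
      obtain ⟨m, hm⟩ := hex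
      rw [hn]
      exact hm.sortsIn.2
    rcases hdec (c n) (e n) hs with hd | hd
    · have hd : (e n).neg ∈ Γ := ⟨n + 1, hd⟩
      rw [hn] at hd
      exact absurd (hmp hd hex) hfalsum
    · obtain ⟨i, hi⟩ := hd.2 σ θ hn
      exact ⟨_, n + 1, hi⟩

namespace HenkinSet

variable {Γ : Set (Formula S)} (H : HenkinSet T Γ)
include H

theorem imp_iff (hφ : φ.SortsIn T.sorts) (hψ : ψ.SortsIn T.sorts) :
    (φ ➝ ψ) ∈ Γ ↔ (φ ∈ Γ → ψ ∈ Γ) := by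
  refine ⟨H.mp, fun h => ?_⟩
  by_cases h' : φ ∈ Γ
  · exact H.mp (H.theorems (.logical (.weaken ψ φ) ⟨hψ, hφ, hψ⟩)) (h h')
  · have h₁ : T.Provable (φ.neg ➝ φ ➝ ψ) :=
      Theory.Provable.mpUnder (ψ := φ ➝ .falsum)
        (.const (.mp (.logical (.distrib φ .falsum ψ)
          ⟨⟨hφ, trivial, hψ⟩, ⟨hφ, trivial⟩, hφ, hψ⟩)
          (.const (.logical (.exFalso ψ) ⟨trivial, hψ⟩) hφ)) ⟨hφ, trivial⟩)
        (.refl ⟨hφ, trivial⟩)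
    exact H.mp (H.theorems h₁) (H.complete hφ h')

theorem and_iff (hφ : φ.SortsIn T.sorts) (hψ : ψ.SortsIn T.sorts) :
    φ ⋏ ψ ∈ Γ ↔ φ ∈ Γ ∧ ψ ∈ Γ :=
  ⟨fun h => ⟨H.mp (H.theorems (T.provable_and_left hφ hψ)) h,
    H.mp (H.theorems (T.provable_and_right hφ hψ)) h⟩,
    fun h => H.mp (H.mp (H.theorems (.logical (.andIntro φ ψ) ⟨hφ, hψ, hφ, hψ⟩)) h.1) h.2⟩

theorem or_iff (hφ : φ.SortsIn T.sorts) (hψ : ψ.SortsIn T.sorts) :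
    φ ⋎ ψ ∈ Γ ↔ φ ∈ Γ ∨ ψ ∈ Γ := by
  constructor
  · intro h
    by_contra! hn
    have h₁ := (H.imp_iff (ψ := .falsum) hφ trivial).2 fun h' => absurd h' hn.1
    have h₂ := (H.imp_iff (ψ := .falsum) hψ trivial).2 fun h' => absurd h' hn.2
    exact H.consistent (H.mp (H.mp (H.mp (H.theorems (.logical (.orElim φ ψ .falsum)
      ⟨⟨hφ, trivial⟩, ⟨hψ, trivial⟩, ⟨hφ, hψ⟩, trivial⟩)) h₁) h₂) h)
  · rintro (h | h)
    · exact H.mp (H.theorems (.logical (.orLeft φ ψ) ⟨hφ, hφ, hψ⟩)) h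
    · exact H.mp (H.theorems (.logical (.orRight φ ψ) ⟨hψ, hφ, hψ⟩)) h

theorem ex_iff {σ : S.Srt} (hS : ∀ t : Term S σ, t.SortsIn T.sorts)
    (hφ : φ.SortsIn T.sorts) : .ex σ φ ∈ Γ ↔ ∃ t : Term S σ, φ.inst t ∈ Γ :=
  ⟨H.witness, fun ⟨t, ht⟩ => H.mp (H.theorems (.logical (.exIntro σ φ t)
    ⟨hφ.inst (hS t), (hS t).mem, hφ⟩)) ht⟩

theorem all_iff {σ : S.Srt} (hS : ∀ t : Term S σ, t.SortsIn T.sorts)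
    (hφ : φ.SortsIn T.sorts) : .all σ φ ∈ Γ ↔ ∀ t : Term S σ, φ.inst t ∈ Γ := by
  have hσ : σ ∈ T.sorts := hS (.var σ 0)
  constructor
  · exact fun h t => H.mp (H.theorems (.logical (.allElim σ φ t) ⟨⟨hσ, hφ⟩, hφ.inst (hS t)⟩)) h
  · intro h
    by_contra hn
    have hs : (Formula.ex σ φ.neg).SortsIn T.sorts := ⟨hσ, hφ, trivial⟩
    -- `¬ ∃ ¬ φ ➝ ∀ φ` is provable, so that `∃ ¬ φ` lies in the set and has a witness
    have hback : (φ.neg.rename ((Ren.shift σ).up σ)).inst (.var σ 0) = φ.neg := by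
      rw [Formula.inst, Formula.rename_eq_subst, Formula.subst_subst]
      convert Formula.subst_var φ.neg using 2
      refine Val.ext_cons (D := Term S) (σ := σ) ?_ fun τ i => ?_
      · rw [Ren.up_zero]; exact Sub.inst_zero _ _
      · rw [Ren.up_shift]; exact Sub.inst_shift _ _ _ _
    have h₁ : T.Provable (φ.neg ➝ (Formula.ex σ φ.neg).shift σ) := by
      have := Theory.Provable.logical (T := T)
        (.exIntro σ (φ.neg.rename ((Ren.shift σ).up σ)) (.var σ 0))
      rw [hback] at this
      exact this ⟨⟨hφ, trivial⟩, hσ, (Formula.sortsIn_rename _ φ.neg).2 ⟨hφ, trivial⟩⟩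
    have h₂ : T.Provable ((Formula.ex σ φ.neg).neg.shift σ ➝ φ.neg.neg) :=
      Theory.Provable.flip (Theory.Provable.trans h₁ (Theory.Provable.flip (.refl
        ⟨(Formula.sortsIn_shift σ (Formula.ex σ φ.neg)).2 hs, trivial⟩)))
    have h₃ : T.Provable ((Formula.ex σ φ.neg).neg ➝ .all σ φ) :=
      .allIntro (h₂.trans (.logical (.doubleNeg φ) ⟨⟨⟨hφ, trivial⟩, trivial⟩, hφ⟩)) hσ
    have h₄ : Formula.ex σ φ.neg ∈ Γ := by
      by_contra hc
      exact hn (H.mp (H.theorems h₃) (H.complete hs hc))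
    obtain ⟨t, ht⟩ := H.witness h₄
    exact H.consistent (H.mp ht (h t))

end HenkinSet

/-- The structure of terms determined by a set of formulas.  Equality is not a logical symbol, so
that no quotient is needed. -/
def termModel (Γ : Set (Formula S)) : Str S where
  D := Term S
  pt σ := .var σ 0
  fn f ts := .app f ts
  rel r ts := .rel r ts ∈ Γ

theorem termModel_val (Γ : Set (Formula S)) (s : Sub S) {σ : S.Srt} (t : Term S σ) :
    t.val (termModel Γ) s = t.subst s := by
  induction t with
  | var => rfl
  | app f ts ih => simp only [Term.val, Term.subst, ih]; rfl

/-- Truth in the term structure is membership in the Henkin set; the valuations are the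
substitutions. -/
theorem termModel_sat {Γ : Set (Formula S)} (H : HenkinSet T Γ)
    (hS : ∀ σ ∈ T.sorts, ∀ t : Term S σ, t.SortsIn T.sorts) (hφ : φ.SortsIn T.sorts) (s : Sub S) :
    φ.Sat (termModel Γ) s ↔ φ.subst s ∈ Γ := by
  have hsub : ∀ {φ : Formula S} (s : Sub S), φ.SortsIn T.sorts → (φ.subst s).SortsIn T.sorts :=
    fun s h => h.subst fun τ hτ i => hS τ hτ _
  induction φ generalizing s with
  | falsum => exact ⟨False.elim, fun h => H.consistent h⟩
  | rel r ts => simp only [Formula.Sat, Formula.subst, termModel_val]; rfl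
  | and φ ψ h1 h2 =>
    exact (and_congr (h1 hφ.1 s) (h2 hφ.2 s)).trans (H.and_iff (hsub s hφ.1) (hsub s hφ.2)).symm
  | or φ ψ h1 h2 =>
    exact (or_congr (h1 hφ.1 s) (h2 hφ.2 s)).trans (H.or_iff (hsub s hφ.1) (hsub s hφ.2)).symm
  | imp φ ψ h1 h2 =>
    exact (imp_congr (h1 hφ.1 s) (h2 hφ.2 s)).trans (H.imp_iff (hsub s hφ.1) (hsub s hφ.2)).symm
  | all σ φ ih =>
    refine Iff.trans ?_ (H.all_iff (hS σ hφ.1) (hsub _ hφ.2)).symm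
    exact forall_congr' fun t => (ih hφ.2 _).trans
      (Iff.of_eq (congrArg (· ∈ Γ) (Formula.subst_up_inst φ s σ t).symm))
  | ex σ φ ih =>
    refine Iff.trans ?_ (H.ex_iff (hS σ hφ.1) (hsub _ hφ.2)).symm
    exact exists_congr fun t => (ih hφ.2 _).trans
      (Iff.of_eq (congrArg (· ∈ Γ) (Formula.subst_up_inst φ s σ t).symm))

/-- All theorems of `T` hold in the structure, under all valuations.  This includes the values of
variables of sorts that do not belong to the language of `T`. -/
def Str.Models (M : Str S) (T : Theory S) : Prop :=
  ∀ φ, T.Provable φ → ∀ v, φ.Sat M v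

/-- The term structure of a Henkin set is a model: under the identity all theorems hold since they
belong to the set, and a theorem holds under any other valuation since its universal closure is a
theorem. -/
theorem termModel_models {Γ : Set (Formula S)} (H : HenkinSet T Γ)
    (hS : ∀ σ ∈ T.sorts, ∀ t : Term S σ, t.SortsIn T.sorts) : (termModel Γ).Models T := by
  intro φ hφ w
  -- the valuations under which all theorems hold are closed under changes of finitely many values
  let good : Set (Val (termModel Γ).D) := {v | ∀ ψ, T.Provable ψ → ψ.Sat _ v}
  have hid : (Term.var : Sub S) ∈ good := fun ψ hψ => by
    refine (termModel_sat H hS hψ.sortsIn _).2 ?_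
    rw [Formula.subst_var]
    exact H.theorems hψ
  have hcons : ∀ v ∈ good, ∀ σ ∈ T.sorts, ∀ d, v.cons σ d ∈ good := fun v hv σ hσ d ψ hψ =>
    hv _ (hψ.generalize hσ) d
  have hsort : ∀ σ ∈ T.sorts, ∀ v ∈ good, ∀ n (w : ℕ → (termModel Γ).D σ), ∃ v' ∈ good,
      (∀ i < n, v' σ i = w i) ∧ ∀ τ, τ ≠ σ → v' τ = v τ := by
    intro σ hσ v hv n
    induction n with
    | zero => exact fun w => ⟨v, hv, by simp⟩
    | succ n ih =>
      intro w
      obtain ⟨v', hv', h1, h2⟩ := ih fun i => w (i + 1)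
      refine ⟨v'.cons σ (w 0), hcons v' hv' σ hσ _, fun i hi => ?_, fun τ hτ => ?_⟩
      · cases i with
        | zero => simp
        | succ i => rw [Val.cons_succ]; exact h1 i (by omega)
      · rw [← h2 τ hτ]
        funext i
        exact Val.cons_ne _ _ _ hτ i
  obtain ⟨l, hl⟩ := φ.exists_bound
  obtain ⟨n, hn⟩ := φ.exists_index_bound
  have hlist : ∀ l : List S.Srt, (∀ σ ∈ l, σ ∈ T.sorts) →
      ∃ v ∈ good, ∀ σ ∈ l, ∀ i < n, v σ i = w σ i := by
    intro l hl
    induction l with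
    | nil => exact ⟨_, hid, by simp⟩
    | cons σ l ih =>
      obtain ⟨v, hv, h⟩ := ih fun τ hτ => hl τ (List.mem_cons_of_mem _ hτ)
      obtain ⟨v', hv', h1, h2⟩ := hsort σ (hl σ List.mem_cons_self) v hv n (w σ)
      refine ⟨v', hv', fun τ hτ i hi => ?_⟩
      by_cases hσ : τ = σ
      · subst hσ; exact h1 i hi
      · rw [h2 τ hσ]
        exact h τ ((List.mem_cons.1 hτ).resolve_left hσ) i hi
  classical
  obtain ⟨v, hv, h⟩ := hlist ((l.map Sigma.fst).filter (· ∈ T.sorts))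
    fun σ hσ => by simpa using (List.mem_filter.1 hσ).2
  refine (φ.sat_congr fun τ i hi => h τ (List.mem_filter.2 ⟨List.mem_map.2 ⟨_, hl τ i hi, rfl⟩, ?_⟩)
    i (hn τ i hi)).1 (hv φ hφ)
  simpa using hφ.sortsIn.of_free hi

/-- The completeness theorem.  By `hS` the language contains all terms of its sorts. -/
theorem Theory.provable_of_forall_models [Countable (Formula S)]
    (hS : ∀ σ ∈ T.sorts, ∀ t : Term S σ, t.SortsIn T.sorts) (hφ : φ.SortsIn T.sorts)
    (h : ∀ M : Str S, M.Models T → ∀ v, φ.Sat M v) : T.Provable φ := by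
  by_contra hn
  obtain ⟨Γ, H, hΓ⟩ := exists_henkinSet hφ hn
  have := (termModel_sat H hS hφ Term.var).1 (h _ (termModel_models H hS) _)
  rw [Formula.subst_var] at this
  exact hΓ this

/-! ### Soundness -/

theorem LogicalAxiom.sat (M : Str S) (h : LogicalAxiom φ) (v : Val M.D) : φ.Sat M v := by
  cases h with
  | weaken => exact fun h _ => h
  | distrib => exact fun h h' x => h x (h' x)
  | andIntro => exact fun h h' => ⟨h, h'⟩
  | andLeft => exact fun h => h.1
  | andRight => exact fun h => h.2
  | orLeft => exact fun h => .inl h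
  | orRight => exact fun h => .inr h
  | orElim => exact fun h h' x => x.elim h h'
  | exFalso => exact fun h => h.elim
  | doubleNeg => exact fun h => not_not.1 h
  | allElim σ φ t => exact fun h => (Formula.sat_inst φ t v).2 (h _)
  | exIntro σ φ t => exact fun h => ⟨_, (Formula.sat_inst φ t v).1 h⟩

/-- A structure that satisfies the axioms of a theory without rules is a model of it. -/
theorem Str.models_of_axioms {M : Str S} (hr : T.rules = ∅)
    (hax : ∀ φ ∈ T.ax, φ.SortsIn T.sorts → ∀ v, φ.Sat M v) : M.Models T := by
  intro φ h
  induction h with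
  | logical h _ => exact h.sat M
  | ax h hL => exact hax _ h hL
  | rule h => rw [hr] at h; exact h.elim
  | mp _ _ h₁ h₂ => exact fun v => h₁ v (h₂ v)
  | allIntro _ _ ih => exact fun v h d => ih (v.cons _ d) ((Formula.sat_shift _ _ _ _).2 h)
  | exElim _ _ ih => exact fun v ⟨d, h⟩ => (Formula.sat_shift _ _ _ _).1 (ih (v.cons _ d) h)

end Calculus

/-! ### Partial combinatory algebras with numbers -/

/-- Partial application and the values of the constants of `BT`.  `App f x y` says that `f` applied
to `x` has the value `y`. -/
structure OpStr where
  Ob : Type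
  App : Ob → Ob → Ob → Prop
  cst : {l : List BTSort} → {σ : BTSort} → BTFn l σ → Ob

/-- The operations of a model of `BT` up to equality: a partial combinatory algebra with pairing
and definition by cases on the set `N` of numbers. -/
structure OpAlg extends OpStr where
  N : Set Ob
  pr : Ob → Ob → Ob
  app_fun : ∀ {f x y z}, App f x y → App f x z → y = z
  combK : ∀ x y, ∃ z, App (cst .k) x z ∧ App z y x
  combS : ∀ x y, ∃ z w, App (cst .s) x z ∧ App z y w ∧
    ∀ u r, App w u r ↔ ∃ a b, App x u a ∧ App y u b ∧ App a b r
  app_pr : ∀ x y, ∃ z, App (cst .p) x z ∧ App z y (pr x y)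
  app_fst : ∀ x y, App (cst .p₁) (pr x y) x
  pr_ne_zero : ∀ x y, pr x y ≠ cst .zero
  zero_mem : cst .zero ∈ N
  succ_mem : ∀ n ∈ N, pr n (cst .zero) ∈ N
  app_d : ∀ x y, ∀ n ∈ N, ∀ m ∈ N, ∃ a b c r, App (cst .d) x a ∧ App a y b ∧ App b n c ∧
    App c m r ∧ (n = m → r = x) ∧ (n ≠ m → r = y)

namespace OpStr

variable (P : OpStr)

/-- Values of the variables of all types; every object is represented by an operation. -/
abbrev Env : Type := Val (S := BTSig) fun _ => P.Ob

/-- The value of a term. -/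
def tm (e : P.Env) : {σ : BTSort} → BTTerm σ → P.Ob
  | _, .var σ i => e σ i
  | _, .app f _ => P.cst f

/-- The external term has the value `a`. -/
def Ev (e : P.Env) : Ext → P.Ob → Prop
  | .of t, a => P.tm e t = a
  | t ⬝ u, a => ∃ b c, Ev e t b ∧ Ev e u c ∧ P.App b c a

@[simp] theorem tm_tv (e : P.Env) (k i : ℕ) : P.tm e (BT.tv k i) = e (.ty k) i := rfl

@[simp] theorem tm_nv (e : P.Env) (i : ℕ) : P.tm e (BT.nv i) = e .num i := rfl

@[simp] theorem tm_zero (e : P.Env) : P.tm e BT.zero = P.cst .zero := rfl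

@[simp] theorem ev_of (e : P.Env) {σ : BTSort} (t : BTTerm σ) (a : P.Ob) :
    P.Ev e (.of t) a ↔ P.tm e t = a := Iff.rfl

@[simp] theorem ev_op (e : P.Env) (f : BTFn [] (.ty 0)) (a : P.Ob) :
    P.Ev e (BT.op f) a ↔ P.cst f = a := Iff.rfl

@[simp] theorem ev_app (e : P.Env) (t u : Ext) (a : P.Ob) :
    P.Ev e (t ⬝ u) a ↔ ∃ b c, P.Ev e t b ∧ P.Ev e u c ∧ P.App b c a := Iff.rfl

variable {P} {e : P.Env} {t u : Ext} {a b c r : P.Ob}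

theorem Ev.app (h : P.App b c a) (ht : P.Ev e t b) (hu : P.Ev e u c) : P.Ev e (t ⬝ u) a :=
  ⟨b, c, ht, hu, h⟩

/-- The terms of `BT` are variables and constants. -/
theorem _root_.MSArith.BT.term_cases {σ : BTSort} (t : BTTerm σ) :
    (∃ i, t = Term.var (S := BTSig) σ i) ∨
      ∃ f : BTFn [] σ, t = Term.app (S := BTSig) (l := []) f Args.nil :=
  match σ, t with
  | _, .var σ i => .inl ⟨i, rfl⟩
  | _, .app (l := l) f ts => by
    have hl : l = [] := by cases f <;> rfl
    subst hl
    exact .inr ⟨f, congrArg _ (funext fun j => j.elim0)⟩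

/-- The environment with the operation variable `i` set to `a`. -/
def upd (e : P.Env) (i : ℕ) (a : P.Ob) : P.Env := fun σ j =>
  if σ = .ty 0 ∧ j = i then a else e σ j

/-- The variable occurs in the external term. -/
def _root_.MSArith.Ext.HasVar (σ : BTSort) (i : ℕ) : Ext → Prop
  | .of t => t.Occurs (S := BTSig) σ i
  | .app t u => t.HasVar σ i ∨ u.HasVar σ i

theorem tm_congr {e e' : P.Env} {σ : BTSort} (t : BTTerm σ)
    (h : ∀ τ i, t.Occurs (S := BTSig) τ i → e τ i = e' τ i) : P.tm e t = P.tm e' t := by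
  rcases BT.term_cases t with ⟨i, rfl⟩ | ⟨f, rfl⟩
  · exact h σ i ⟨rfl, rfl⟩
  · rfl

theorem ev_congr {e e' : P.Env} {t : Ext} (h : ∀ σ i, t.HasVar σ i → e σ i = e' σ i) :
    P.Ev e t a ↔ P.Ev e' t a := by
  induction t generalizing a with
  | of t => simp only [Ev, tm_congr t h]
  | app t u iht ihu =>
    simp only [Ev, iht fun σ i hi => h σ i (.inl hi), ihu fun σ i hi => h σ i (.inr hi)]

theorem tm_shift (e : P.Env) (σ : BTSort) (a : P.Ob) {τ : BTSort} (t : BTTerm τ) :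
    P.tm (Val.cons e σ a) (t.shift (S := BTSig) σ) = P.tm e t := by
  rcases BT.term_cases t with ⟨i, rfl⟩ | ⟨f, rfl⟩
  · exact Val.cons_shift (S := BTSig) (D := fun _ => P.Ob) e σ τ a i
  · rfl

@[simp] theorem ev_shift (e : P.Env) (σ : BTSort) (a : P.Ob) (t : Ext) :
    P.Ev (Val.cons e σ a) (BT.shift σ t) r ↔ P.Ev e t r := by
  induction t generalizing r with
  | of t => simp only [BT.shift, Ev, tm_shift]
  | app t u iht ihu => simp only [BT.shift, Ev, iht, ihu]

end OpStr

namespace OpAlg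

open OpStr

variable {P : OpAlg} {e : P.Env} {t u : Ext} {a b c r : P.Ob}

theorem _root_.MSArith.OpStr.Ev.unique (h : P.Ev e t a) (h' : P.Ev e t b) : a = b := by
  induction t generalizing a b with
  | of t => exact h.symm.trans h'
  | app t u iht ihu =>
    obtain ⟨f, x, hf, hx, h⟩ := h
    obtain ⟨g, y, hg, hy, h'⟩ := h'
    obtain rfl := iht hf hg
    obtain rfl := ihu hx hy
    exact P.app_fun h h'

theorem ev_iff (h : P.Ev e t a) : P.Ev e t b ↔ b = a :=
  ⟨fun h' => h'.unique h, fun h' => h' ▸ h⟩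

theorem _root_.MSArith.OpStr.Ev.pair (ht : P.Ev e t a) (hu : P.Ev e u b) :
    P.Ev e (BT.pair t u) (P.pr a b) := by
  obtain ⟨z, h1, h2⟩ := P.app_pr a b
  exact Ev.app h2 (Ev.app h1 rfl ht) hu

theorem app_k (x y : P.Ob) : ∃ z, P.App (P.cst .k) x z ∧ ∀ y r, P.App z y r ↔ r = x := by
  obtain ⟨z, hz, -⟩ := P.combK x y
  refine ⟨z, hz, fun y r => ?_⟩
  obtain ⟨z', hz', h⟩ := P.combK x y
  obtain rfl := P.app_fun hz hz'
  exact ⟨fun h' => P.app_fun h' h, fun h' => h' ▸ h⟩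

theorem ev_k_of {σ : BTSort} (t : BTTerm σ) :
    ∃ f, P.Ev e (BT.op .k ⬝ .of t) f ∧ ∀ x r, P.App f x r ↔ r = P.tm e t := by
  obtain ⟨z, hz, h⟩ := app_k (P.tm e t) (P.tm e t)
  exact ⟨z, Ev.app hz rfl rfl, h⟩

/-- Abstraction: `λ x. t` is always defined, and its application to `x` is `t`. -/
theorem ev_lam (e : P.Env) (i : ℕ) (t : Ext) :
    ∃ f, P.Ev e (BT.lam i t) f ∧ ∀ x r, P.App f x r ↔ P.Ev (upd e i x) t r := by
  induction t with
  | of t =>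
    rcases BT.term_cases t with ⟨j, rfl⟩ | ⟨f, rfl⟩
    · rename_i σ
      by_cases hσ : σ = .ty 0
      · subst hσ
        by_cases hj : j = i
        · subst hj
          obtain ⟨z, w, hz, hw, h⟩ := P.combS (P.cst .k) (P.cst .k)
          refine ⟨w, ?_, fun x r => ?_⟩
          · simp only [BT.lam, if_true]
            exact Ev.app hw (Ev.app hz rfl rfl) rfl
          · rw [h]
            obtain ⟨y, hy, hyx⟩ := app_k x x
            constructor
            · rintro ⟨a, b, ha, hb, hr⟩
              obtain rfl := P.app_fun ha hy
              rw [(hyx _ _).1 hr]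
              simp [Ev, tm, upd]
            · intro hr
              have hr : x = r := by simpa [Ev, tm, upd] using hr
              exact ⟨y, y, hy, hy, (hyx _ _).2 hr.symm⟩
        · obtain ⟨f, hf, h⟩ := ev_k_of (P := P) (e := e) (BT.tv 0 j)
          refine ⟨f, ?_, fun x r => ?_⟩
          · simpa only [BT.lam, if_neg hj] using hf
          · rw [h, eq_comm]
            simp [Ev, tm, upd, hj, BT.tv]
      · obtain ⟨f, hf, h⟩ := ev_k_of (P := P) (e := e) (Term.var (S := BTSig) σ j)
        have hl : BT.lam i (.of (Term.var (S := BTSig) σ j)) =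
            BT.op .k ⬝ .of (Term.var (S := BTSig) σ j) := by
          rcases σ with _ | _ | k
          · rfl
          · exact absurd rfl hσ
          · rfl
        refine ⟨f, hl ▸ hf, fun x r => ?_⟩
        rw [h, eq_comm]
        simp [Ev, tm, upd, hσ]
    · obtain ⟨g, hg, h⟩ := ev_k_of (P := P) (e := e) (Term.app (S := BTSig) (l := []) f Args.nil)
      have hl : BT.lam i (.of (Term.app (S := BTSig) (l := []) f Args.nil)) =
          BT.op .k ⬝ .of (Term.app (S := BTSig) (l := []) f Args.nil) := by
        cases f <;> rfl
      exact ⟨g, hl ▸ hg, fun x r => (h x r).trans eq_comm⟩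
  | app t u iht ihu =>
    obtain ⟨f, hf, hft⟩ := iht
    obtain ⟨g, hg, hgu⟩ := ihu
    obtain ⟨z, w, hz, hw, h⟩ := P.combS f g
    refine ⟨w, Ev.app hw (Ev.app hz rfl hf) hg, fun x r => ?_⟩
    simp only [h, hft, hgu, Ev]

theorem hasVar_lam (σ : BTSort) (i j : ℕ) (t : Ext) :
    (BT.lam i t).HasVar σ j ↔ t.HasVar σ j ∧ ¬ (σ = .ty 0 ∧ j = i) := by
  induction t with
  | of t =>
    rcases BT.term_cases t with ⟨k, rfl⟩ | ⟨f, rfl⟩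
    · rename_i τ
      rcases τ with _ | _ | τ
      · simp [BT.lam, Ext.HasVar, BT.op, Term.Occurs]
        rintro rfl rfl
        simp
      · by_cases hk : k = i
        · simp [BT.lam, Ext.HasVar, BT.op, Term.Occurs, hk]
        · simp [BT.lam, Ext.HasVar, BT.op, Term.Occurs, hk, BT.tv]
          rintro rfl rfl
          simpa using hk
      · simp [BT.lam, Ext.HasVar, BT.op, Term.Occurs]
        rintro rfl rfl
        simp
    · cases f <;> simp [BT.lam, Ext.HasVar, BT.op, Term.Occurs]
  | app t u iht ihu =>
    simp [BT.lam, Ext.HasVar, BT.op, Term.Occurs, iht, ihu, or_and_right]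

theorem ev_upd {i : ℕ} {x : P.Ob} (h : ¬ t.HasVar (.ty 0) i) : P.Ev (upd e i x) t a ↔ P.Ev e t a :=
  ev_congr fun σ j hj => if_neg (by rintro ⟨rfl, rfl⟩; exact h hj)

/-- `f x y` has the value `r`. -/
def App₂ (P : OpAlg) (f x y r : P.Ob) : Prop := ∃ g, P.App f x g ∧ P.App g y r

theorem App₂.unique {f x y r r' : P.Ob} (h : P.App₂ f x y r) (h' : P.App₂ f x y r') : r = r' := by
  obtain ⟨g, h1, h2⟩ := h
  obtain ⟨g', h1', h2'⟩ := h'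
  obtain rfl := P.app_fun h1 h1'
  exact P.app_fun h2 h2'

theorem _root_.MSArith.OpStr.Ev.app₂ {f x y : P.Ob} {t u v : Ext} (h : P.App₂ f x y r)
    (ht : P.Ev e t f)
    (hu : P.Ev e u x) (hv : P.Ev e v y) : P.Ev e (t ⬝ u ⬝ v) r :=
  let ⟨_, h1, h2⟩ := h
  Ev.app h2 (Ev.app h1 ht hu) hv

theorem ev_lam₂ (e : P.Env) (i j : ℕ) (t : Ext) :
    ∃ f, P.Ev e (BT.lam i (BT.lam j t)) f ∧
      ∀ x y r, P.App₂ f x y r ↔ P.Ev (upd (upd e i x) j y) t r := by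
  obtain ⟨f, hf, h⟩ := ev_lam e i (BT.lam j t)
  refine ⟨f, hf, fun x y r => ?_⟩
  obtain ⟨g, hg, h'⟩ := ev_lam (upd e i x) j t
  rw [← h']
  constructor
  · rintro ⟨g', h1, h2⟩
    rwa [hg.unique ((h _ _).1 h1)]
  · exact fun h2 => ⟨g, (h _ _).2 hg, h2⟩

theorem recOp_closed (σ : BTSort) (i : ℕ) : ¬ BT.recOp.HasVar σ i := by
  simp only [BT.recOp, BT.recStep, hasVar_lam, Ext.HasVar, BT.op, BT.zero, Term.Occurs, BT.tv]
  grind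

/-- The value of the recursion operator: `R a f 0 = a` and `R a f (n + 1) = f n (R a f n)`.  The
branches of the definition by cases are protected by a dummy abstraction, so that only the branch
that is taken has to have a value. -/
theorem exists_recOp (P : OpAlg) : ∃ R, (∀ e, P.Ev e BT.recOp R) ∧ ∀ a f, ∃ g, P.App₂ R a f g ∧
    P.App g (P.cst .zero) a ∧ ∀ n ∈ P.N, ∀ r r', P.App g n r → P.App₂ f n r r' →
      P.App g (P.pr n (P.cst .zero)) r' := by
  let e : P.Env := fun _ _ => P.cst .zero
  let x : ℕ → Ext := fun i => .of (BT.tv 0 i)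
  let step : Ext := x 2 ⬝ (BT.op .p₁ ⬝ x 3) ⬝ (x 0 ⬝ x 0 ⬝ x 1 ⬝ x 2 ⬝ (BT.op .p₁ ⬝ x 3))
  let body : Ext := BT.op .d ⬝ BT.lam 4 (x 1) ⬝ BT.lam 4 step ⬝ x 3 ⬝ .of BT.zero ⬝ .of BT.zero
  obtain ⟨W, hW, h0⟩ := ev_lam e 0 (BT.lam 1 (BT.lam 2 (BT.lam 3 body)))
  obtain ⟨R, hR, h1⟩ := ev_lam₂ (upd e 0 W) 1 2 (BT.lam 3 body)
  have hWR : P.App W W R := (h0 W R).2 hR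
  refine ⟨R, fun e' => (ev_congr fun σ i hi => absurd hi (recOp_closed σ i)).1
    (Ev.app hWR hW hW), fun a f => ?_⟩
  let e' : P.Env := upd (upd (upd e 0 W) 1 a) 2 f
  obtain ⟨g, hg, h2⟩ := ev_lam e' 3 body
  have hRg : P.App₂ R a f g := (h1 a f g).2 hg
  refine ⟨g, hRg, ?_, fun n hn r r' hr hr' => ?_⟩
  all_goals rw [h2]
  · let e₀ := upd e' 3 (P.cst .zero)
    obtain ⟨A, hA, hA'⟩ := ev_lam e₀ 4 (x 1)
    obtain ⟨B, hB, -⟩ := ev_lam e₀ 4 step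
    obtain ⟨i, j, k, l, hi, hj, hk, hl, hl', -⟩ := P.app_d A B _ P.zero_mem _ P.zero_mem
    obtain rfl := hl' rfl
    exact Ev.app ((hA' (P.cst .zero) a).2 rfl)
      (Ev.app hl (Ev.app hk (Ev.app hj (Ev.app hi rfl hA) hB) rfl) rfl) rfl
  · let n' := P.pr n (P.cst .zero)
    let e₀ := upd e' 3 n'
    obtain ⟨A, hA, -⟩ := ev_lam e₀ 4 (x 1)
    obtain ⟨B, hB, hB'⟩ := ev_lam e₀ 4 step
    obtain ⟨i, j, k, l, hi, hj, hk, hl, -, hl'⟩ := P.app_d A B n' (P.succ_mem n hn) _ P.zero_mem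
    obtain rfl := hl' (P.pr_ne_zero _ _)
    have hp : P.Ev (upd e₀ 4 (P.cst .zero)) (BT.op .p₁ ⬝ x 3) n :=
      Ev.app (P.app_fst n (P.cst .zero)) rfl rfl
    refine Ev.app ((hB' (P.cst .zero) r').2 ?_)
      (Ev.app hl (Ev.app hk (Ev.app hj (Ev.app hi rfl hA) hB) rfl) rfl) rfl
    exact Ev.app₂ hr' rfl hp (Ev.app hr (Ev.app₂ hRg (Ev.app hWR rfl rfl) rfl rfl) hp)

/-- Definition by recursion on the second argument with the first one as a parameter.  In the
abstractions the operation variables `0` and `1` stand for the two arguments. -/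
theorem ev_recursion {t s : Ext} (ht : ¬ t.HasVar (.ty 0) 1) (hs : ¬ s.HasVar (.ty 0) 1)
    (e : P.Env) :
    ∃ F, P.Ev e (BT.lam 0 (BT.lam 1 (BT.recOp ⬝ t ⬝ s ⬝ .of (BT.tv 0 1)))) F ∧
      ∀ x a f, P.Ev (upd e 0 x) t a → P.Ev (upd e 0 x) s f →
        P.App₂ F x (P.cst .zero) a ∧ ∀ n ∈ P.N, ∀ r r', P.App₂ F x n r → P.App₂ f n r r' →
          P.App₂ F x (P.pr n (P.cst .zero)) r' := by
  obtain ⟨F, hF, h⟩ := ev_lam₂ e 0 1 (BT.recOp ⬝ t ⬝ s ⬝ .of (BT.tv 0 1))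
  obtain ⟨R, hR, hR'⟩ := P.exists_recOp
  refine ⟨F, hF, fun x a f ha hf => ?_⟩
  obtain ⟨g, hg, h0, hsucc⟩ := hR' a f
  have hev : ∀ y, P.Ev (upd (upd e 0 x) 1 y) (BT.recOp ⬝ t ⬝ s) g := fun y =>
    Ev.app₂ hg (hR _) ((ev_upd ht).2 ha) ((ev_upd hs).2 hf)
  have hFg : ∀ y r, P.App₂ F x y r ↔ P.App g y r := fun y r => by
    rw [h]
    refine ⟨?_, fun hr => Ev.app hr (hev y) rfl⟩
    rintro ⟨g', y', hg', rfl, hr⟩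
    rwa [← hg'.unique (hev y)]
  simp only [hFg]
  exact ⟨h0, hsucc⟩

theorem addOp_closed (σ : BTSort) (i : ℕ) : ¬ BT.addOp.HasVar σ i := by
  simp only [BT.addOp, recOp_closed, hasVar_lam, Ext.HasVar, BT.pair, BT.op, BT.zero,
    Term.Occurs, BT.tv]
  grind

theorem mulOp_closed (σ : BTSort) (i : ℕ) : ¬ BT.mulOp.HasVar σ i := by
  simp only [BT.mulOp, recOp_closed, addOp_closed, hasVar_lam, Ext.HasVar, BT.zero,
    Term.Occurs, BT.tv]
  grind

/-- The recursion equations of addition. -/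
theorem exists_addOp (P : OpAlg) : ∃ A, (∀ e, P.Ev e BT.addOp A) ∧ ∀ x,
    P.App₂ A x (P.cst .zero) x ∧ ∀ n ∈ P.N, ∀ r, P.App₂ A x n r →
      P.App₂ A x (P.pr n (P.cst .zero)) (P.pr r (P.cst .zero)) := by
  let e : P.Env := fun _ _ => P.cst .zero
  have hs : ¬ (BT.lam 2 (BT.lam 3 (BT.pair (.of (BT.tv 0 3)) (.of BT.zero)))).HasVar (.ty 0) 1 := by
    simp [hasVar_lam, Ext.HasVar, BT.pair, BT.op, BT.zero, Term.Occurs, BT.tv]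
  obtain ⟨A, hA, h⟩ := ev_recursion (t := .of (BT.tv 0 0))
    (by simp [Ext.HasVar, Term.Occurs, BT.tv]) hs e
  refine ⟨A, fun e' => (ev_congr fun σ i hi => absurd hi (addOp_closed σ i)).1 hA, fun x => ?_⟩
  obtain ⟨f, hf, hf'⟩ := ev_lam₂ (upd e 0 x) 2 3 (BT.pair (.of (BT.tv 0 3)) (.of BT.zero))
  obtain ⟨h1, h2⟩ := h x x f rfl hf
  exact ⟨h1, fun n hn r hr => h2 n hn r _ hr ((hf' _ _ _).2 (Ev.pair rfl rfl))⟩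

/-- The recursion equations of multiplication. -/
theorem exists_mulOp (P : OpAlg) : ∃ M, (∀ e, P.Ev e BT.mulOp M) ∧
    ∀ A, (∀ e, P.Ev e BT.addOp A) → ∀ x,
    P.App₂ M x (P.cst .zero) (P.cst .zero) ∧ ∀ n ∈ P.N, ∀ r r', P.App₂ M x n r →
      P.App₂ A r x r' → P.App₂ M x (P.pr n (P.cst .zero)) r' := by
  let e : P.Env := fun _ _ => P.cst .zero
  have hs : ¬ (BT.lam 2 (BT.lam 3 (BT.addOp ⬝ .of (BT.tv 0 3) ⬝ .of (BT.tv 0 0)))).HasVar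
      (.ty 0) 1 := by
    simp [hasVar_lam, Ext.HasVar, addOp_closed, Term.Occurs, BT.tv]
  obtain ⟨M, hM, h⟩ := ev_recursion (t := .of BT.zero)
    (by simp [Ext.HasVar, Term.Occurs, BT.zero]) hs e
  refine ⟨M, fun e' => (ev_congr fun σ i hi => absurd hi (mulOp_closed σ i)).1 hM,
    fun A hA x => ?_⟩
  obtain ⟨f, hf, hf'⟩ := ev_lam₂ (upd e 0 x) 2 3 (BT.addOp ⬝ .of (BT.tv 0 3) ⬝ .of (BT.tv 0 0))
  obtain ⟨h1, h2⟩ := h x _ f rfl hf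
  exact ⟨h1, fun n hn r r' hr hr' => h2 n hn r _ hr ((hf' _ _ _).2 (Ev.app₂ hr' (hA _) rfl rfl))⟩

end OpAlg

/-! ### The language of `BT` -/

theorem BT.sortsIn_term {A : Set BTSort} {σ : BTSort} (t : BTTerm σ) :
    t.SortsIn (S := BTSig) A ↔ σ ∈ A := by
  rcases BT.term_cases t with ⟨i, rfl⟩ | ⟨f, rfl⟩
  · rfl
  · exact ⟨fun h => h.1, fun h => ⟨h, fun j => j.elim0⟩⟩

/-- A code of terms, injective on the terms of any given sort. -/
def BT.termCode {σ : BTSort} : BTTerm σ → ℕ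
  | .var _ i => 2 * i
  | .app f _ => 2 * (match f with
    | .zero => 0 | .k => 1 | .s => 2 | .d => 3 | .p => 4 | .p₁ => 5 | .p₂ => 6 | .c n => n + 7) + 1

theorem BT.termCode_injective {σ : BTSort} : Function.Injective (BT.termCode (σ := σ)) := by
  intro t u h
  rcases BT.term_cases t with ⟨i, rfl⟩ | ⟨f, rfl⟩ <;>
    rcases BT.term_cases u with ⟨j, rfl⟩ | ⟨g, rfl⟩
  · simp only [termCode] at h
    congr 1
    omega
  · simp only [termCode] at h
    omega
  · simp only [termCode] at h
    omega
  · cases f <;> cases g <;> simp [termCode] at h ⊢ <;> omega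

def BTSort.code : BTSort → ℕ
  | .num => 0
  | .ty k => k + 1

theorem BTSort.code_injective : Function.Injective BTSort.code := by
  rintro (_ | i) (_ | j) h <;> simp_all [code]

/-- An injective code of formulas. -/
def BT.formulaCode : BTFormula → ℕ
  | .falsum => Nat.pair 0 0
  | .rel .ap ts => Nat.pair 1 (Nat.pair (termCode (ts 0))
      (Nat.pair (termCode (ts 1)) (termCode (ts 2))))
  | .rel (.eqOp σ) ts => Nat.pair 2 (Nat.pair σ.code (Nat.pair (termCode (ts 0)) (termCode (ts 1))))
  | .rel (.mem k) ts => Nat.pair 3 (Nat.pair k (Nat.pair (termCode (ts 0)) (termCode (ts 1))))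
  | .and φ ψ => Nat.pair 4 (Nat.pair (formulaCode φ) (formulaCode ψ))
  | .or φ ψ => Nat.pair 5 (Nat.pair (formulaCode φ) (formulaCode ψ))
  | .imp φ ψ => Nat.pair 6 (Nat.pair (formulaCode φ) (formulaCode ψ))
  | .all σ φ => Nat.pair 7 (Nat.pair (BTSort.code σ) (formulaCode φ))
  | .ex σ φ => Nat.pair 8 (Nat.pair (BTSort.code σ) (formulaCode φ))

theorem BT.formulaCode_injective : Function.Injective BT.formulaCode := by
  intro φ
  induction φ with
  | falsum =>
    intro ψ h
    cases ψ with
    | rel r ts => cases r <;> simp [formulaCode] at h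
    | falsum => rfl
    | _ => simp [formulaCode] at h
  | rel r ts =>
    intro ψ h
    cases ψ with
    | rel r' ts' =>
      cases r <;> cases r' <;> simp [formulaCode] at h
      · congr 1
        funext j
        fin_cases j
        exacts [termCode_injective h.1, termCode_injective h.2.1, termCode_injective h.2.2]
      · obtain ⟨h1, h2, h3⟩ := h
        obtain rfl := BTSort.code_injective h1
        congr 1
        funext j
        fin_cases j
        exacts [termCode_injective h2, termCode_injective h3]
      · obtain ⟨rfl, h2, h3⟩ := h
        congr 1
        funext j
        fin_cases j
        exacts [termCode_injective h2, termCode_injective h3]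
    | _ => cases r <;> simp [formulaCode] at h
  | and φ₁ φ₂ h1 h2 | or φ₁ φ₂ h1 h2 | imp φ₁ φ₂ h1 h2 =>
    intro ψ h
    cases ψ with
    | rel r ts => cases r <;> simp [formulaCode] at h
    | _ =>
      simp [formulaCode] at h <;> rw [h1 h.1, h2 h.2]
  | all σ φ ih | ex σ φ ih =>
    intro ψ h
    cases ψ with
    | rel r ts => cases r <;> simp [formulaCode] at h
    | _ =>
      simp [formulaCode] at h <;> rw [BTSort.code_injective h.1, ih h.2]

instance : Countable BTFormula := BT.formulaCode_injective.countable

instance : Countable (Formula BTSig) := inferInstanceAs (Countable BTFormula)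

/-! ### Sorts, quantifiers and equality symbols in formulas of `BT` -/

/-- All sorts in the formula are in `A`, all sorts of quantified variables and of arguments of
equality symbols are in `E`. -/
def BT.Fits (A E : Set BTSort) (φ : BTFormula) : Prop :=
  φ.SortsIn A ∧ φ.QuantifiersIn E ∧ φ.RelsIn (S := BTSig) (fun {l} (r : BTRel l) =>
      match r with
      | .eqOp σ => σ ∈ E
      | _ => True)

/-- The `n`-elementary formulas are a special case. -/
theorem BT.Fits.elementary {n : ℕ} {φ : BTFormula} (h : Fits (BTSort.upTo n) {σ | σ ≠ .ty n} φ) :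
    Elementary n φ := h

/-- All variables and constants in the external term have sorts in `A`. -/
def Ext.Leaves (A : Set BTSort) : Ext → Prop
  | .of (σ := σ) _ => σ ∈ A
  | .app t u => t.Leaves A ∧ u.Leaves A

@[simp] theorem Ext.leaves_shift {A : Set BTSort} {σ : BTSort} {t : Ext} :
    (BT.shift σ t).Leaves A ↔ t.Leaves A := by
  induction t with
  | of => rfl
  | app t u iht ihu => exact and_congr iht ihu

theorem Ext.Leaves.shift {A : Set BTSort} {σ : BTSort} {t : Ext} (h : t.Leaves A) :
    (BT.shift σ t).Leaves A := Ext.leaves_shift.2 h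

theorem Ext.leaves_univ (t : Ext) : t.Leaves Set.univ := by
  induction t with
  | of => trivial
  | app t u iht ihu => exact ⟨iht, ihu⟩

namespace BT

variable {A E : Set BTSort} {φ ψ : BTFormula} {σ : BTSort} {t u : Ext}

theorem Fits.and (h : Fits A E φ) (h' : Fits A E ψ) : Fits A E (φ ⋏ ψ) :=
  ⟨⟨h.1, h'.1⟩, ⟨h.2.1, h'.2.1⟩, h.2.2, h'.2.2⟩

theorem Fits.or (h : Fits A E φ) (h' : Fits A E ψ) : Fits A E (φ ⋎ ψ) :=
  ⟨⟨h.1, h'.1⟩, ⟨h.2.1, h'.2.1⟩, h.2.2, h'.2.2⟩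

theorem Fits.imp (h : Fits A E φ) (h' : Fits A E ψ) : Fits A E (φ ➝ ψ) :=
  ⟨⟨h.1, h'.1⟩, ⟨h.2.1, h'.2.1⟩, h.2.2, h'.2.2⟩

theorem fits_falsum : Fits A E .falsum := ⟨trivial, trivial, trivial⟩

theorem Fits.neg (h : Fits A E φ) : Fits A E φ.neg := h.imp fits_falsum

theorem Fits.iff (h : Fits A E φ) (h' : Fits A E ψ) : Fits A E (φ ⟷ ψ) :=
  (h.imp h').and (h'.imp h)

theorem Fits.all (hA : σ ∈ A) (hE : σ ∈ E) (h : Fits A E φ) : Fits A E (BT.all σ φ) :=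
  ⟨⟨hA, h.1⟩, ⟨hE, h.2.1⟩, h.2.2⟩

theorem Fits.ex (hA : σ ∈ A) (hE : σ ∈ E) (h : Fits A E φ) : Fits A E (BT.ex σ φ) :=
  ⟨⟨hA, h.1⟩, ⟨hE, h.2.1⟩, h.2.2⟩

theorem Fits.rename (h : Fits A E φ) (ρ : Ren BTSig) : Fits A E (φ.rename ρ) :=
  ⟨(Formula.sortsIn_rename _ _).2 h.1, (Formula.quantifiersIn_rename _ _).2 h.2.1,
    (Formula.relsIn_rename _ _ _).2 h.2.2⟩

theorem sortsIn_args {l : List BTSort} (ts : Args BTSig l) (hl : ∀ σ ∈ l, σ ∈ A) :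
    ∀ j, (ts j).SortsIn A := fun j => (sortsIn_term _).2 (hl _ (List.get_mem l j))

theorem fits_eqOp {x : BTTerm (.ty 0)} {y : BTTerm σ} (h0 : .ty 0 ∈ A) (hA : σ ∈ A) (hE : σ ∈ E) :
    Fits A E (eqOp x y) := ⟨sortsIn_args _ (by simp [h0, hA]), trivial, hE⟩

theorem fits_ap {x y z : BTTerm (.ty 0)} (h0 : .ty 0 ∈ A) : Fits A E (ap x y z) :=
  ⟨sortsIn_args _ (by simp [h0]), trivial, trivial⟩

theorem fits_mem {k : ℕ} {x : BTTerm (.ty k)} {y : BTTerm (.ty (k + 1))} (h : .ty k ∈ A)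
    (h' : .ty (k + 1) ∈ A) : Fits A E (mem x y) :=
  ⟨sortsIn_args _ (by simp [h, h']), trivial, trivial⟩

theorem fits_simeq {x : BTTerm (.ty 0)} (h0 : .ty 0 ∈ A) (h0' : .ty 0 ∈ E) (hA : t.Leaves A)
    (hE : t.Leaves E) : Fits A E (simeq t x) := by
  suffices ∀ d x, Fits A E (simeqAux t d x) from this 0 x
  induction t with
  | of t => exact fun d x => fits_eqOp h0 hA hE
  | app t u iht ihu => exact fun d x => .ex h0 h0' (.ex h0 h0' (.and (iht hA.1 hE.1 _ _)
      (.and (ihu hA.2 hE.2 _ _) (fits_ap h0))))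

theorem fits_eqv (h0 : .ty 0 ∈ A) (h0' : .ty 0 ∈ E) (htA : t.Leaves A) (htE : t.Leaves E)
    (huA : u.Leaves A) (huE : u.Leaves E) : Fits A E (eqv t u) :=
  .ex h0 h0' (.and (fits_simeq h0 h0' htA.shift htE.shift) (fits_simeq h0 h0' huA.shift huE.shift))

theorem fits_defined (h0 : .ty 0 ∈ A) (h0' : .ty 0 ∈ E) (htA : t.Leaves A) (htE : t.Leaves E) :
    Fits A E (defined t) :=
  .ex h0 h0' (fits_simeq h0 h0' htA.shift htE.shift)

theorem fits_kleeneEq (h0 : .ty 0 ∈ A) (h0' : .ty 0 ∈ E) (htA : t.Leaves A) (htE : t.Leaves E)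
    (huA : u.Leaves A) (huE : u.Leaves E) : Fits A E (kleeneEq t u) :=
  .all h0 h0' (.iff (fits_simeq h0 h0' htA.shift htE.shift)
    (fits_simeq h0 h0' huA.shift huE.shift))

theorem fits_extMem {k : ℕ} {x : BTTerm (.ty (k + 1))} (h0 : .ty 0 ∈ A) (h0' : .ty 0 ∈ E)
    (hA : .ty k ∈ A) (hE : .ty k ∈ E) (hA' : .ty (k + 1) ∈ A)
    (htA : t.Leaves A) (htE : t.Leaves E) : Fits A E (extMem t x) :=
  .ex hA hE (.and (fits_eqv h0 h0' htA.shift htE.shift hA hE) (fits_mem hA hA'))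

end BT

/-! ### Models of `BT` -/

/-- A tuple of elements with a new first component. -/
def tupleCons {S : Sig} {D : S.Srt → Type} {σ : S.Srt} {l : List S.Srt} (a : D σ)
    (as : (j : Fin l.length) → D (l.get j)) : (j : Fin (σ :: l).length) → D ((σ :: l).get j) :=
  Fin.cons (α := fun j : Fin (l.length + 1) => D ((σ :: l).get j)) a as

theorem val_argsCons {S : Sig} (M : Str S) (v : Val M.D) {σ : S.Srt} {l : List S.Srt}
    (t : Term S σ) (ts : Args S l) :
    (fun j => (Args.cons t ts j).val M v) = tupleCons (t.val M v) (fun j => (ts j).val M v) := by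
  funext j
  refine Fin.cases ?_ (fun j => ?_) j <;> rfl

theorem val_argsNil {S : Sig} (M : Str S) (v : Val M.D) :
    (fun j => ((Args.nil : Args S []) j).val M v) = fun j => j.elim0 :=
  funext fun j => j.elim0

/-- The valuation `v` changed at one variable. -/
def Val.set {S : Sig} {D : S.Srt → Type} (v : Val D) (σ : S.Srt) (i : ℕ) (d : D σ) : Val D :=
  fun τ j => if h : τ = σ ∧ j = i then h.1 ▸ d else v τ j

@[simp] theorem Val.set_same {S : Sig} {D : S.Srt → Type} (v : Val D) (σ : S.Srt) (i : ℕ)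
    (d : D σ) : v.set σ i d σ i = d := by simp [Val.set]

@[simp] theorem Val.set_of_ne {S : Sig} {D : S.Srt → Type} (v : Val D) (σ τ : S.Srt) {i j : ℕ}
    (d : D σ) (h : j ≠ i) : v.set σ i d τ j = v τ j := by simp [Val.set, h]

namespace BTModel

variable (M : Str BTSig)

/-- The objects of type `σ`. -/
abbrev Dom (σ : BTSort) : Type := M.D σ

/-- The interpretation of the predicate `=_{0σ}`. -/
def EqOp {σ : BTSort} (x : Dom M (.ty 0)) (y : Dom M σ) : Prop :=
  M.rel (BTRel.eqOp σ) (tupleCons (S := BTSig) x (tupleCons (S := BTSig) y fun j => j.elim0))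

/-- The interpretation of the predicate `Ap`. -/
def Ap (f x y : Dom M (.ty 0)) : Prop :=
  M.rel BTRel.ap (tupleCons (S := BTSig) f (tupleCons (S := BTSig) x
    (tupleCons (S := BTSig) y fun j => j.elim0)))

/-- The interpretation of the predicate `∈_k`. -/
def Mem {k : ℕ} (x : Dom M (.ty k)) (y : Dom M (.ty (k + 1))) : Prop :=
  M.rel (BTRel.mem k) (tupleCons (S := BTSig) x (tupleCons (S := BTSig) y fun j => j.elim0))

variable {M}

theorem sat_eqOp {σ : BTSort} (x : BTTerm (.ty 0)) (y : BTTerm σ) (v : Val M.D) :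
    (BT.eqOp x y).Sat M v ↔ EqOp M (x.val M v) (y.val M v) := by
  exact Iff.of_eq (congrArg (M.rel (BTRel.eqOp σ)) ((val_argsCons M v x _).trans
    (congrArg _ ((val_argsCons M v y _).trans (congrArg _ (val_argsNil M v))))))

theorem sat_ap (f x y : BTTerm (.ty 0)) (v : Val M.D) :
    (BT.ap f x y).Sat M v ↔ Ap M (f.val M v) (x.val M v) (y.val M v) := by
  exact Iff.of_eq (congrArg (M.rel BTRel.ap) ((val_argsCons M v f _).trans
    (congrArg _ ((val_argsCons M v x _).trans
      (congrArg _ ((val_argsCons M v y _).trans (congrArg _ (val_argsNil M v))))))))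

theorem sat_mem {k : ℕ} (x : BTTerm (.ty k)) (y : BTTerm (.ty (k + 1))) (v : Val M.D) :
    (BT.mem x y).Sat M v ↔ Mem M (x.val M v) (y.val M v) := by
  exact Iff.of_eq (congrArg (M.rel (BTRel.mem k)) ((val_argsCons M v x _).trans
    (congrArg _ ((val_argsCons M v y _).trans (congrArg _ (val_argsNil M v))))))

end BTModel

/-- Models of all theorems of `BT_s`. -/
structure BTModel (G : BT.GodelNumbering) (s : ℕ) where
  str : Str BTSig
  models : str.Models (BT.theoryCl G s)

theorem BTSort.num_mem_upTo (s : ℕ) : BTSort.num ∈ BTSort.upTo s := .inl rfl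

theorem BTSort.ty_mem_upTo {k s : ℕ} (h : k ≤ s) : BTSort.ty k ∈ BTSort.upTo s := .inr ⟨k, h, rfl⟩

theorem BTSort.ty_zero_mem_upTo (s : ℕ) : BTSort.ty 0 ∈ BTSort.upTo s :=
  BTSort.ty_mem_upTo (Nat.zero_le s)

namespace BTModel

variable {G : BT.GodelNumbering} {s : ℕ} (B : BTModel G s)

/-- The objects of type `σ`. -/
abbrev D (σ : BTSort) : Type := B.str.D σ

/-- Valuations in the model. -/
abbrev V : Type := Val B.str.D

theorem of_ax {φ : BTFormula} (h : BT.Axiom G φ) (hs : BT.Fits (BTSort.upTo s) Set.univ φ)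
    (v : B.V) : φ.Sat B.str v := B.models φ (.ax h hs.1) v

/-- Some valuation. -/
def base : B.V := fun σ _ => B.str.pt σ

theorem eqOp_trans {k n : ℕ} (hk : k ≤ s) (hn : n ≤ s) {u v : B.D (.ty 0)} {x : B.D (.ty k)}
    {y : B.D (.ty n)} (h₁ : EqOp B.str u x) (h₂ : EqOp B.str v x) (h₃ : EqOp B.str u y) :
    EqOp B.str v y := by
  have h0 := BTSort.ty_zero_mem_upTo s
  have hk := BTSort.ty_mem_upTo hk
  have hn := BTSort.ty_mem_upTo hn
  have := B.of_ax (.eqTrans k n (BT.tv 0 0) (BT.tv 0 1) (BT.tv k 2) (BT.tv n 3))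
    (.imp (.and (BT.fits_eqOp h0 hk trivial) (.and (BT.fits_eqOp h0 hk trivial)
      (BT.fits_eqOp h0 hn trivial))) (BT.fits_eqOp h0 hn trivial))
    ((((B.base.set (.ty 0) 0 u).set (.ty 0) 1 v).set (.ty k) 2 x).set (.ty n) 3 y)
  simp only [Formula.Sat, sat_eqOp, BT.tv, Term.val] at this
  simp at this
  exact this h₁ h₂ h₃

theorem eqOp_refl (x : B.D (.ty 0)) : EqOp B.str x x := by
  have h0 := BTSort.ty_zero_mem_upTo s
  have := B.of_ax (.eqRefl (BT.tv 0 0)) (BT.fits_eqOp h0 h0 trivial) (B.base.set (.ty 0) 0 x)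
  simpa [sat_eqOp, BT.tv, Term.val] using this

theorem eqOp_num {u v : B.D (.ty 0)} {m : B.D .num} (h₁ : EqOp B.str u m) (h₂ : EqOp B.str v m) :
    EqOp B.str u v := by
  have h0 := BTSort.ty_zero_mem_upTo s
  have hω := BTSort.num_mem_upTo s
  have := B.of_ax (.eqNum (BT.tv 0 0) (BT.tv 0 1) (BT.nv 2))
    (.imp (.and (BT.fits_eqOp h0 hω trivial) (BT.fits_eqOp h0 hω trivial))
      (BT.fits_eqOp h0 h0 trivial))
    (((B.base.set (.ty 0) 0 u).set (.ty 0) 1 v).set .num 2 m)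
  simp only [Formula.Sat, sat_eqOp, BT.tv, BT.nv, Term.val] at this
  simp at this
  exact this h₁ h₂

theorem eqOp_num_subst {u v : B.D (.ty 0)} {m : B.D .num} (h₁ : EqOp B.str u m)
    (h₂ : EqOp B.str u v) : EqOp B.str v m := by
  have h0 := BTSort.ty_zero_mem_upTo s
  have hω := BTSort.num_mem_upTo s
  have := B.of_ax (.eqNumSubst (BT.tv 0 0) (BT.tv 0 1) (BT.nv 2))
    (.imp (.and (BT.fits_eqOp h0 hω trivial) (BT.fits_eqOp h0 h0 trivial))
      (BT.fits_eqOp h0 hω trivial))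
    (((B.base.set (.ty 0) 0 u).set (.ty 0) 1 v).set .num 2 m)
  simp only [Formula.Sat, sat_eqOp, BT.tv, BT.nv, Term.val] at this
  simp at this
  exact this h₁ h₂

theorem exists_eqOp {σ : BTSort} (hσ : σ ∈ BTSort.upTo s) (d : B.D σ) : ∃ u, EqOp B.str u d := by
  have h0 := BTSort.ty_zero_mem_upTo s
  rcases hσ with rfl | ⟨k, hk, rfl⟩
  · have := B.of_ax (.numOp (BT.nv 0)) (.ex h0 trivial (BT.fits_eqOp h0 (.inl rfl) trivial))
      (B.base.set .num 0 d)
    obtain ⟨u, hu⟩ := this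
    rw [sat_eqOp] at hu
    exact ⟨u, by simpa [BT.tv, BT.nv, Term.val, Term.val_shift] using hu⟩
  · have := B.of_ax (.setOp k (BT.tv k 1))
      (.ex h0 trivial (BT.fits_eqOp h0 (.inr ⟨k, hk, rfl⟩) trivial)) (B.base.set (.ty k) 1 d)
    obtain ⟨u, hu⟩ := this
    rw [sat_eqOp] at hu
    exact ⟨u, by simpa [BT.tv, BT.nv, Term.val, Term.val_shift] using hu⟩

/-- Equality of operations. -/
instance setoid : Setoid (B.D (.ty 0)) where
  r := EqOp B.str
  iseqv :=
    have z := Nat.zero_le s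
    ⟨B.eqOp_refl, fun {x y} h => B.eqOp_trans z z h (B.eqOp_refl y) (B.eqOp_refl x),
      fun {_ y _} h h' => B.eqOp_trans z z (B.eqOp_refl y) h h'⟩

/-- The operations up to equality. -/
abbrev Ob : Type := Quotient B.setoid

open Classical in
/-- The operation equal to a given object, up to equality of operations.  Such an operation exists
for the types `≤ s`; for the other types the value is arbitrary. -/
noncomputable def cls {σ : BTSort} (d : B.D σ) : B.Ob :=
  if h : ∃ u, EqOp B.str u d then ⟦h.choose⟧ else ⟦B.str.pt (.ty 0)⟧

theorem eqOp_iff {σ : BTSort} (hσ : σ ∈ BTSort.upTo s) (u : B.D (.ty 0)) (d : B.D σ) :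
    EqOp B.str u d ↔ ⟦u⟧ = B.cls d := by
  have h := B.exists_eqOp hσ d
  rw [cls, dif_pos h, Quotient.eq]
  have hc := h.choose_spec
  change _ ↔ EqOp B.str _ _
  have z := Nat.zero_le s
  rcases hσ with rfl | ⟨k, hk, rfl⟩
  · exact ⟨fun h' => B.eqOp_num h' hc, fun h' => B.eqOp_num_subst hc (B.setoid.symm' h')⟩
  · exact ⟨fun h' => B.eqOp_trans hk z hc h' (B.eqOp_refl _),
      fun h' => B.eqOp_trans z hk (B.eqOp_refl _) h' hc⟩

theorem cls_op (x : B.D (.ty 0)) : B.cls x = ⟦x⟧ :=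
  ((B.eqOp_iff (BTSort.ty_zero_mem_upTo s) x x).1 (B.eqOp_refl x)).symm

theorem forall_ob {p : B.Ob → Prop} : (∀ a, p a) ↔ ∀ x : B.D (.ty 0), p (B.cls x) := by
  simp only [cls_op]
  exact Quotient.forall

theorem exists_ob {p : B.Ob → Prop} : (∃ a, p a) ↔ ∃ x : B.D (.ty 0), p (B.cls x) := by
  simp only [cls_op]
  exact Quotient.exists

/-- Application of operations up to equality. -/
def App (a b c : B.Ob) : Prop :=
  ∃ f x y : B.D (.ty 0), B.cls f = a ∧ B.cls x = b ∧ B.cls y = c ∧ Ap B.str f x y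

/-- Values of the constants; all function symbols of `BT` are constants, and the tuple of arguments
is empty. -/
noncomputable def const {l : List BTSort} {σ : BTSort} (f : BTFn l σ) : B.Ob :=
  B.cls (B.str.fn f fun _ => B.str.pt _)

/-- The applicative structure of the operations up to equality. -/
noncomputable abbrev opStr : OpStr where
  Ob := B.Ob
  App := B.App
  cst := B.const

theorem ap_iff (f x y : B.D (.ty 0)) :
    Ap B.str f x y ↔ B.App (B.cls f) (B.cls x) (B.cls y) := by
  refine ⟨fun h => ⟨f, x, y, rfl, rfl, rfl, h⟩, ?_⟩
  rintro ⟨g, u, v, hg, hu, hv, h⟩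
  have h0 := BTSort.ty_zero_mem_upTo s
  have e : BT.Fits (BTSort.upTo s) Set.univ (BT.eqOp (BT.tv 0 0) (BT.tv 0 0)) :=
    BT.fits_eqOp h0 h0 trivial
  have := B.of_ax (.apSubst (BT.tv 0 0) (BT.tv 0 1) (BT.tv 0 2) (BT.tv 0 3) (BT.tv 0 4)
    (BT.tv 0 5)) (.imp (.and (BT.fits_ap h0) (.and (BT.fits_eqOp h0 h0 trivial)
      (.and (BT.fits_eqOp h0 h0 trivial) (BT.fits_eqOp h0 h0 trivial)))) (BT.fits_ap h0))
    ((((((B.base.set (.ty 0) 0 g).set (.ty 0) 1 f).set (.ty 0) 2 u).set (.ty 0) 3 x).set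
      (.ty 0) 4 v).set (.ty 0) 5 y)
  simp only [Formula.Sat, sat_eqOp, sat_ap, BT.tv, Term.val, B.eqOp_iff h0, ← cls_op] at this
  simp at this
  exact this h hg hu hv

/-- The values of variables up to equality. -/
noncomputable abbrev env (v : B.V) : B.opStr.Env := fun σ i => B.cls (v σ i)

theorem env_cons (v : B.V) (σ : BTSort) (d : B.D σ) :
    B.env (v.cons σ d) = Val.cons (B.env v) σ (B.cls d) :=
  Val.ext_cons (S := BTSig) (D := fun _ => B.Ob) (σ := σ) (by simp [env]) (by simp [env])

theorem tm_env (v : B.V) {σ : BTSort} (t : BTTerm σ) :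
    B.opStr.tm (B.env v) t = B.cls (t.val B.str v) := by
  rcases BT.term_cases t with ⟨i, rfl⟩ | ⟨f, rfl⟩
  · rfl
  · simp only [OpStr.tm, Term.val, const]
    congr 2
    exact funext fun j => j.elim0

theorem val_iterate_shift (σ : BTSort) {τ : BTSort} (d : ℕ) (t : BTTerm τ) (v : B.V) :
    Term.val B.str v ((Term.shift (S := BTSig) σ)^[d] t) =
      t.val B.str ((fun w τ i => w τ (Ren.shift (S := BTSig) σ τ i))^[d] v) := by
  induction d generalizing v with
  | zero => rfl
  | succ d ih =>
    rw [Function.iterate_succ_apply', Function.iterate_succ_apply, ← ih]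
    exact Term.val_rename _ _ _

theorem sat_simeqAux {t : Ext} (ht : t.Leaves (BTSort.upTo s)) (d : ℕ) (x : BTTerm (.ty 0))
    (v : B.V) : (BT.simeqAux t d x).Sat B.str v ↔
      B.opStr.Ev (B.env ((fun w τ i => w τ (Ren.shift (S := BTSig) (.ty 0) τ i))^[d] v)) t
        (B.cls (x.val B.str v)) := by
  induction t generalizing d x v with
  | of t =>
    rw [BT.simeqAux, sat_eqOp, val_iterate_shift, B.eqOp_iff ht, OpStr.Ev, tm_env, cls_op, eq_comm]
  | app t u iht ihu =>
    have hdrop : ∀ y z : B.D (.ty 0),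
        (fun (w : B.V) τ i => w τ (Ren.shift (S := BTSig) (.ty 0) τ i))^[d + 2]
          ((v.cons (.ty 0) y).cons (.ty 0) z) =
        (fun w τ i => w τ (Ren.shift (S := BTSig) (.ty 0) τ i))^[d] v := by
      intro y z
      simp only [Function.iterate_succ_apply, Val.cons_shift]
    simp only [BT.simeqAux, BT.ex, Formula.Sat, iht ht.1, ihu ht.2, sat_ap, ap_iff, hdrop,
      OpStr.Ev, exists_ob]
    refine exists_congr fun y => exists_congr fun z => ?_
    have h1 : Term.val B.str ((v.cons (.ty 0) y).cons (.ty 0) z) (BT.tv 0 1) = y := by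
      simp [BT.tv, Term.val]
    have h2 : Term.val B.str ((v.cons (.ty 0) y).cons (.ty 0) z) (BT.tv 0 0) = z := by
      simp [BT.tv, Term.val]
    rw [h1, h2, val_iterate_shift]
    simp only [Function.iterate_succ_apply, Function.iterate_zero, id, Val.cons_shift]

/-- External terms are interpreted by their values in the applicative structure. -/
theorem sat_simeq {t : Ext} (ht : t.Leaves (BTSort.upTo s)) (x : BTTerm (.ty 0)) (v : B.V) :
    (BT.simeq t x).Sat B.str v ↔ B.opStr.Ev (B.env v) t (B.opStr.tm (B.env v) x) := by
  rw [tm_env]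
  exact B.sat_simeqAux ht 0 x v

theorem sat_simeq_shift {t : Ext} (ht : t.Leaves (BTSort.upTo s)) (v : B.V) (x : B.D (.ty 0)) :
    (BT.simeq (BT.shift (.ty 0) t) (BT.tv 0 0)).Sat B.str (v.cons (.ty 0) x) ↔
      B.opStr.Ev (B.env v) t (B.cls x) := by
  rw [sat_simeq _ ht.shift, env_cons, OpStr.ev_shift]
  simp [BT.tv, OpStr.tm]

theorem sat_defined {t : Ext} (ht : t.Leaves (BTSort.upTo s)) (v : B.V) :
    (BT.defined t).Sat B.str v ↔ ∃ a, B.opStr.Ev (B.env v) t a := by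
  rw [exists_ob]
  exact exists_congr fun x => B.sat_simeq_shift ht v x

theorem sat_eqv {t u : Ext} (ht : t.Leaves (BTSort.upTo s)) (hu : u.Leaves (BTSort.upTo s))
    (v : B.V) : (BT.eqv t u).Sat B.str v ↔
      ∃ a, B.opStr.Ev (B.env v) t a ∧ B.opStr.Ev (B.env v) u a := by
  rw [exists_ob]
  exact exists_congr fun x => and_congr (B.sat_simeq_shift ht v x) (B.sat_simeq_shift hu v x)

theorem sat_eqv_of {t : Ext} (ht : t.Leaves (BTSort.upTo s)) {σ : BTSort}
    (hσ : σ ∈ BTSort.upTo s) (x : BTTerm σ)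
    (v : B.V) : (BT.eqv t (.of x)).Sat B.str v ↔
      B.opStr.Ev (B.env v) t (B.opStr.tm (B.env v) x) := by
  rw [sat_eqv _ ht (show (Ext.of x).Leaves _ from hσ)]
  simp [OpStr.Ev]

theorem sat_kleeneEq {t u : Ext} (ht : t.Leaves (BTSort.upTo s)) (hu : u.Leaves (BTSort.upTo s))
    (v : B.V) : (BT.kleeneEq t u).Sat B.str v ↔
      ∀ a, B.opStr.Ev (B.env v) t a ↔ B.opStr.Ev (B.env v) u a := by
  rw [forall_ob]
  exact forall_congr' fun x => Formula.sat_iff.trans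
    (iff_congr (B.sat_simeq_shift ht v x) (B.sat_simeq_shift hu v x))

end BTModel

namespace BTModel

variable {G : BT.GodelNumbering} {s : ℕ} (B : BTModel G s)

/-- The numbers among the operations. -/
def Num : Set B.Ob := Set.range (B.cls (σ := .num))

theorem zero_mem_num : B.const BTFn.zero ∈ B.Num := ⟨_, (B.tm_env B.base BT.zero).symm⟩

theorem app_fun {f x y z : B.Ob} (h₁ : B.App f x y) (h₂ : B.App f x z) : y = z := by
  revert h₁ h₂
  revert z y x f
  simp only [forall_ob, ← ap_iff]
  intro f x y z h₁ h₂
  have h0 := BTSort.ty_zero_mem_upTo s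
  have := B.of_ax (.apFun (BT.tv 0 0) (BT.tv 0 1) (BT.tv 0 2) (BT.tv 0 3))
    (.imp (.and (BT.fits_ap h0) (BT.fits_ap h0)) (BT.fits_eqOp h0 h0 trivial))
    ((((B.base.set (.ty 0) 0 f).set (.ty 0) 1 x).set (.ty 0) 2 y).set (.ty 0) 3 z)
  simp only [Formula.Sat, sat_eqOp, sat_ap, BT.tv, Term.val, B.eqOp_iff h0, ← cls_op] at this
  simp at this
  exact this h₁ h₂

/-- Three operation variables and two numerical ones can be given any values. -/
theorem exists_val (x y z : B.Ob) {n m : B.Ob} (hn : n ∈ B.Num) (hm : m ∈ B.Num) :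
    ∃ v : B.V, B.env v (.ty 0) 0 = x ∧ B.env v (.ty 0) 1 = y ∧ B.env v (.ty 0) 2 = z ∧
      B.env v .num 0 = n ∧ B.env v .num 1 = m := by
  obtain ⟨n, rfl⟩ := hn
  obtain ⟨m, rfl⟩ := hm
  revert x y z
  simp only [forall_ob]
  intro x y z
  refine ⟨(((((Val.cons (Val.cons B.base .num m) .num n).cons (.ty 0) z).cons (.ty 0) y).cons
    (.ty 0) x)), ?_⟩
  exact ⟨rfl, rfl, rfl, rfl, rfl⟩

theorem combK (x y : B.Ob) : ∃ z, B.App (B.const BTFn.k) x z ∧ B.App z y x := by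
  obtain ⟨v, hx, hy, -⟩ := B.exists_val x y y B.zero_mem_num B.zero_mem_num
  have h0 := BTSort.ty_zero_mem_upTo s
  have hl : (BT.op .k ⬝ .of (BT.tv 0 0) ⬝ .of (BT.tv 0 1)).Leaves (BTSort.upTo s) :=
    ⟨⟨h0, h0⟩, h0⟩
  have := B.of_ax (.combK (BT.tv 0 0) (BT.tv 0 1))
    (BT.fits_simeq h0 trivial hl (Ext.leaves_univ _)) v
  rw [sat_simeq _ hl] at this
  simpa [hx, hy] using this

theorem combS (x y : B.Ob) : ∃ z w, B.App (B.const BTFn.s) x z ∧ B.App z y w ∧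
    ∀ u r, B.App w u r ↔ ∃ a b, B.App x u a ∧ B.App y u b ∧ B.App a b r := by
  have h0 := BTSort.ty_zero_mem_upTo s
  have hl : (BT.op .s ⬝ .of (BT.tv 0 0) ⬝ .of (BT.tv 0 1)).Leaves (BTSort.upTo s) :=
    ⟨⟨h0, h0⟩, h0⟩
  have hr : (((Ext.of (BT.tv 0 0)) ⬝ .of (BT.tv 0 2)) ⬝ (.of (BT.tv 0 1) ⬝ .of (BT.tv 0 2))).Leaves
    (BTSort.upTo s) := ⟨⟨h0, h0⟩, h0, h0⟩
  obtain ⟨w, z, hz, hw⟩ : ∃ w z, B.App (B.const BTFn.s) x z ∧ B.App z y w := by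
    obtain ⟨v, hx, hy, -⟩ := B.exists_val x y y B.zero_mem_num B.zero_mem_num
    have h₁ := B.of_ax (.combSDefined (BT.tv 0 0) (BT.tv 0 1))
      (BT.fits_defined h0 trivial hl (Ext.leaves_univ _)) v
    rw [sat_defined _ hl] at h₁
    simpa [hx, hy] using h₁
  refine ⟨z, w, hz, hw, fun u r => ?_⟩
  obtain ⟨v, hx, hy, hu, -⟩ := B.exists_val x y u B.zero_mem_num B.zero_mem_num
  have hl' : (BT.op .s ⬝ .of (BT.tv 0 0) ⬝ .of (BT.tv 0 1) ⬝ .of (BT.tv 0 2)).Leaves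
    (BTSort.upTo s) := ⟨hl, h0⟩
  have h₂ := B.of_ax (.combS (BT.tv 0 0) (BT.tv 0 1) (BT.tv 0 2))
    (BT.fits_kleeneEq h0 trivial hl' (Ext.leaves_univ _) hr (Ext.leaves_univ _)) v
  rw [sat_kleeneEq _ hl' hr] at h₂
  have h₂ := h₂ r
  simp only [OpStr.ev_app, OpStr.ev_op, OpStr.ev_of, OpStr.tm_tv, hx, hy, hu] at h₂
  constructor
  · intro h
    obtain ⟨a, b, ⟨_, _, rfl, rfl, ha⟩, ⟨_, _, rfl, rfl, hb⟩, h⟩ := h₂.1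
      ⟨w, u, ⟨z, y, ⟨_, x, rfl, rfl, hz⟩, rfl, hw⟩, rfl, h⟩
    exact ⟨a, b, ha, hb, h⟩
  · rintro ⟨a, b, ha, hb, h⟩
    obtain ⟨_, _, ⟨_, _, ⟨_, _, rfl, rfl, hz'⟩, rfl, hw'⟩, rfl, h⟩ := h₂.2
      ⟨a, b, ⟨_, _, rfl, rfl, ha⟩, ⟨_, _, rfl, rfl, hb⟩, h⟩
    obtain rfl := B.app_fun hz hz'
    obtain rfl := B.app_fun hw hw'
    exact h

theorem exists_pair (x y : B.Ob) : ∃ w, (∃ z, B.App (B.const BTFn.p) x z ∧ B.App z y w) ∧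
    B.App (B.const BTFn.p₁) w x ∧ w ≠ B.const BTFn.zero := by
  obtain ⟨v, hx, hy, -⟩ := B.exists_val x y y B.zero_mem_num B.zero_mem_num
  have h0 := BTSort.ty_zero_mem_upTo s
  have hω := BTSort.num_mem_upTo s
  have hl : (BT.pair (.of (BT.tv 0 0)) (.of (BT.tv 0 1))).Leaves (BTSort.upTo s) :=
    ⟨⟨h0, h0⟩, h0⟩
  have h₁ := B.of_ax (.pairDefined (BT.tv 0 0) (BT.tv 0 1))
    (BT.fits_defined h0 trivial hl (Ext.leaves_univ _)) v
  rw [sat_defined _ hl] at h₁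
  obtain ⟨w, hw⟩ := h₁
  have hl' : (BT.op .p₁ ⬝ BT.pair (.of (BT.tv 0 0)) (.of (BT.tv 0 1))).Leaves (BTSort.upTo s) :=
    ⟨h0, hl⟩
  have h₂ := B.of_ax (.fstPair (BT.tv 0 0) (BT.tv 0 1))
      (BT.fits_simeq h0 trivial hl' (Ext.leaves_univ _)) v
  have h₃ := B.of_ax (.pairNeZero (BT.tv 0 0) (BT.tv 0 1))
      (.neg (BT.fits_eqv h0 trivial hl (Ext.leaves_univ _) hω (Ext.leaves_univ _))) v
  rw [sat_simeq _ hl'] at h₂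
  rw [Formula.sat_neg, sat_eqv_of _ hl hω, OpStr.tm_zero] at h₃
  obtain ⟨_, w', rfl, ⟨_, _, ⟨_, _, rfl, rfl, hz'⟩, rfl, hw'⟩, h₂⟩ := h₂
  obtain ⟨_, _, ⟨_, _, rfl, rfl, hz⟩, rfl, hw₁⟩ := id hw
  simp only [OpStr.tm_tv, hx, hy] at hz hw₁ hz' hw' h₂
  obtain rfl := B.app_fun hz hz'
  obtain rfl := B.app_fun hw₁ hw'
  exact ⟨w, ⟨_, hz, hw'⟩, h₂, fun h => h₃ (by rwa [h] at hw)⟩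

theorem app_d (x y n : B.Ob) (hn : n ∈ B.Num) (m : B.Ob) (hm : m ∈ B.Num) : ∃ a b c r,
    B.App (B.const BTFn.d) x a ∧ B.App a y b ∧ B.App b n c ∧ B.App c m r ∧
      (n = m → r = x) ∧ (n ≠ m → r = y) := by
  obtain ⟨v, hx, hy, -, hvn, hvm⟩ := B.exists_val x y y hn hm
  have h0 := BTSort.ty_zero_mem_upTo s
  have hω := BTSort.num_mem_upTo s
  have hl : (BT.op .d ⬝ .of (BT.tv 0 0) ⬝ .of (BT.tv 0 1) ⬝ .of (BT.nv 0) ⬝ .of (BT.nv 1)).Leaves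
    (BTSort.upTo s) := ⟨⟨⟨⟨h0, h0⟩, h0⟩, hω⟩, hω⟩
  have hfe : BT.Fits (BTSort.upTo s) Set.univ (BT.eqv (.of (BT.nv 0)) (.of (BT.nv 1))) :=
    BT.fits_eqv h0 trivial hω trivial hω trivial
  have hfs : ∀ i, BT.Fits (BTSort.upTo s) Set.univ (BT.simeq _ (BT.tv 0 i)) := fun i =>
    BT.fits_simeq h0 trivial hl (Ext.leaves_univ _)
  have h₁ := B.of_ax (.caseEq (BT.tv 0 0) (BT.tv 0 1) (BT.nv 0) (BT.nv 1))
    (.imp hfe (hfs 0)) v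
  have h₂ := B.of_ax (.caseNe (BT.tv 0 0) (BT.tv 0 1) (BT.nv 0) (BT.nv 1))
    (.imp hfe.neg (hfs 1)) v
  simp only [Formula.Sat, Formula.sat_neg,
    sat_eqv_of _ (show (Ext.of (BT.nv 0)).Leaves (BTSort.upTo s) from hω) hω, sat_simeq _ hl,
    OpStr.ev_app, OpStr.ev_op, OpStr.ev_of, OpStr.tm_tv, OpStr.tm_nv, hx, hy, hvn, hvm] at h₁ h₂
  by_cases h : n = m
  · obtain ⟨_, _, ⟨_, _, ⟨_, _, ⟨_, _, rfl, rfl, h1⟩, rfl, h2⟩, rfl, h3⟩, rfl, h4⟩ := h₁ h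
    exact ⟨_, _, _, _, h1, h2, h3, h4, fun _ => rfl, fun hne => absurd h hne⟩
  · obtain ⟨_, _, ⟨_, _, ⟨_, _, ⟨_, _, rfl, rfl, h1⟩, rfl, h2⟩, rfl, h3⟩, rfl, h4⟩ := h₂ h
    exact ⟨_, _, _, _, h1, h2, h3, h4, fun he => absurd he h, fun _ => rfl⟩

theorem succ_mem_num {n : B.Ob} (hn : n ∈ B.Num) : ∃ w ∈ B.Num, ∃ z,
    B.App (B.const BTFn.p) n z ∧ B.App z (B.const BTFn.zero) w := by
  obtain ⟨v, -, -, -, hn, -⟩ := B.exists_val n n n hn hn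
  have h0 := BTSort.ty_zero_mem_upTo s
  have hω := BTSort.num_mem_upTo s
  have hl : (BT.pair (.of (BT.nv 0)) (.of BT.zero)).Leaves (BTSort.upTo s) := ⟨⟨h0, hω⟩, hω⟩
  obtain ⟨m, hm⟩ := B.of_ax (.succNum (BT.nv 0)) (.ex hω trivial (BT.fits_eqv h0 trivial
    hl.shift (Ext.leaves_univ _) hω trivial)) v
  rw [sat_eqv_of _ hl.shift hω, env_cons, OpStr.ev_shift] at hm
  obtain ⟨_, _, ⟨_, _, rfl, rfl, h1⟩, rfl, h2⟩ := hm
  simp only [OpStr.tm_nv, hn] at h1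
  exact ⟨_, ⟨m, (Val.cons_zero (S := BTSig) (D := fun _ => B.Ob) _ _ _).symm⟩, _, h1, h2⟩

/-- The partial combinatory algebra of a model of `BT_s`. -/
noncomputable abbrev opAlg : OpAlg where
  toOpStr := B.opStr
  N := B.Num
  pr x y := (B.exists_pair x y).choose
  app_fun := B.app_fun
  combK := B.combK
  combS := B.combS
  app_pr x y := (B.exists_pair x y).choose_spec.1
  app_fst x y := (B.exists_pair x y).choose_spec.2.1
  pr_ne_zero x y := (B.exists_pair x y).choose_spec.2.2
  zero_mem := B.zero_mem_num
  succ_mem n hn := by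
    obtain ⟨w, hw, z, h1, h2⟩ := B.succ_mem_num hn
    obtain ⟨z', h1', h2'⟩ := (B.exists_pair n (B.const .zero)).choose_spec.1
    obtain rfl := B.app_fun h1 h1'
    rwa [B.app_fun h2' h2]
  app_d := B.app_d

/-! ### Sets and induction in models of `BT` -/

/-- Membership for operations that are equal to objects of the types `k` and `k + 1`. -/
def MemOb (k : ℕ) (a b : B.Ob) : Prop :=
  ∃ (Z : B.D (.ty k)) (X : B.D (.ty (k + 1))), B.cls Z = a ∧ B.cls X = b ∧ Mem B.str Z X

theorem mem_iff {k : ℕ} (hk : k + 1 ≤ s) (Z : B.D (.ty k)) (X : B.D (.ty (k + 1))) :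
    Mem B.str Z X ↔ B.MemOb k (B.cls Z) (B.cls X) := by
  refine ⟨fun h => ⟨Z, X, rfl, rfl, h⟩, ?_⟩
  rintro ⟨Y, U, hY, hU, h⟩
  have h0 := BTSort.ty_zero_mem_upTo s
  have hk0 := BTSort.ty_mem_upTo (Nat.le_of_succ_le hk)
  have hk1 := BTSort.ty_mem_upTo hk
  have := B.of_ax (.memSubst k (BT.tv k 0) (BT.tv k 1) (BT.tv (k + 1) 2) (BT.tv (k + 1) 3))
    (.imp (.and (BT.fits_mem hk0 hk1) (.and (BT.fits_eqv h0 trivial hk0 trivial hk0 trivial)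
      (BT.fits_eqv h0 trivial hk1 trivial hk1 trivial))) (BT.fits_mem hk0 hk1))
    ((((B.base.set (.ty k) 0 Y).set (.ty k) 1 Z).set (.ty (k + 1)) 2 U).set (.ty (k + 1)) 3 X)
  simp only [Formula.Sat, sat_mem,
    B.sat_eqv_of (show (Ext.of (BT.tv k 0)).Leaves (BTSort.upTo s) from hk0) hk0,
    B.sat_eqv_of (show (Ext.of (BT.tv (k + 1) 2)).Leaves (BTSort.upTo s) from hk1) hk1] at this
  simp [BT.tv, tm_env, Term.val] at this
  exact this h hY hU

theorem sat_extMem {k : ℕ} (hk : k + 1 ≤ s) {t : Ext} (ht : t.Leaves (BTSort.upTo s))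
    (x : BTTerm (.ty (k + 1))) (v : B.V) : (BT.extMem t x).Sat B.str v ↔
      ∃ a, B.opStr.Ev (B.env v) t a ∧ B.MemOb k a (B.opStr.tm (B.env v) x) := by
  have hk0 := BTSort.ty_mem_upTo (Nat.le_of_succ_le hk)
  have : ∀ Z, (BT.eqv (BT.shift (.ty k) t) (.of (BT.tv k 0)) ⋏
      BT.mem (BT.tv k 0) (x.shift (S := BTSig) (.ty k))).Sat B.str (v.cons (.ty k) Z) ↔
      B.opStr.Ev (B.env v) t (B.cls Z) ∧ B.MemOb k (B.cls Z) (B.opStr.tm (B.env v) x) := by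
    intro Z
    simp only [Formula.Sat, sat_mem, B.sat_eqv_of ht.shift hk0, env_cons, OpStr.ev_shift,
      B.mem_iff hk, tm_env, OpStr.tm_tv]
    simp [BT.tv, Term.val]
  constructor
  · rintro ⟨Z, hZ⟩
    exact ⟨_, (this Z).1 hZ⟩
  · rintro ⟨_, h1, Z, X, rfl, h2, h3⟩
    exact ⟨Z, (this Z).2 ⟨h1, Z, X, rfl, h2, h3⟩⟩

theorem _root_.MSArith.BTSort.upTo_mono {k s : ℕ} (h : k ≤ s) : BTSort.upTo k ⊆ BTSort.upTo s := by
  rintro σ (rfl | ⟨j, hj, rfl⟩)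
  exacts [.inl rfl, .inr ⟨j, hj.trans h, rfl⟩]

theorem _root_.MSArith.BT.Fits.mono {A A' E E' : Set BTSort} {φ : BTFormula} (h : BT.Fits A E φ)
    (hA : A ⊆ A') (hE : E ⊆ E') : BT.Fits A' E' φ := by
  obtain ⟨h1, h2, h3⟩ := h
  induction φ with
  | falsum => exact BT.fits_falsum
  | rel r ts =>
    refine ⟨fun j => (BT.sortsIn_term _).2 (hA ((BT.sortsIn_term _).1 (h1 j))), trivial, ?_⟩
    cases r
    exacts [trivial, hE h3, trivial]
  | and φ ψ ih ih' => exact .and (ih h1.1 h2.1 h3.1) (ih' h1.2 h2.2 h3.2)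
  | or φ ψ ih ih' => exact .or (ih h1.1 h2.1 h3.1) (ih' h1.2 h2.2 h3.2)
  | imp φ ψ ih ih' => exact .imp (ih h1.1 h2.1 h3.1) (ih' h1.2 h2.2 h3.2)
  | all σ φ ih => exact .all (hA h1.1) (hE h2.1) (ih h1.2 h2.2 h3)
  | ex σ φ ih => exact .ex (hA h1.1) (hE h2.1) (ih h1.2 h2.2 h3)

/-- The comprehension axiom in a model. -/
theorem comprehension (e : BT.Abstract) (he : e.Admissible) (hk : e.k + 1 ≤ s) (v : B.V) :
    ∃ U : B.D (.ty (e.k + 1)),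
      B.opStr.Ev (B.env v) (BT.applyTuple (BT.op (.c (G.num e))) e.params) (B.cls U) ∧
      ∀ Z : B.D (.ty e.k), B.MemOb e.k (B.cls Z) (B.cls U) ↔
        e.body.Sat B.str (v.cons (.ty e.k) Z) := by
  have h0 := BTSort.ty_zero_mem_upTo s
  have hk0 := BTSort.ty_mem_upTo (Nat.le_of_succ_le hk)
  have hk1 := BTSort.ty_mem_upTo hk
  have hl : (BT.applyTuple (BT.op (.c (G.num e))) e.params).Leaves (BTSort.upTo s) := by
    have hp : ∀ w ∈ e.params, w.1 ∈ BTSort.upTo s := fun w hw => BTSort.upTo_mono hk (he.1 w hw)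
    have hf : ∀ (l : List (Var BTSig)) (t : Ext), t.Leaves (BTSort.upTo s) →
        (∀ w ∈ l, w.1 ∈ BTSort.upTo s) → (l.foldl (fun t w =>
          BT.pair t (.of (Term.var (S := BTSig) w.1 w.2))) t).Leaves (BTSort.upTo s) := by
      intro l
      induction l with
      | nil => exact fun t ht _ => ht
      | cons w l ih =>
        intro t ht hw
        exact ih _ ⟨⟨h0, ht⟩, hw w List.mem_cons_self⟩ fun w' h => hw w' (List.mem_cons_of_mem _ h)
    revert hp
    generalize e.params = l
    cases l with
    | nil => exact fun _ => h0
    | cons w l => exact fun hp => ⟨h0, hf l _ (hp w List.mem_cons_self)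
        fun w' h => hp w' (List.mem_cons_of_mem _ h)⟩
  have hb : BT.Fits (BTSort.upTo s) Set.univ e.body :=
    BT.Fits.mono (show BT.Fits (BTSort.upTo (e.k + 1)) {σ | σ ≠ .ty (e.k + 1)} e.body from he.2.1)
      (BTSort.upTo_mono hk) (Set.subset_univ _)
  obtain ⟨U, hU, hU'⟩ := B.of_ax (.comprehension e he) (.ex hk1 trivial (.and
    (BT.fits_eqv h0 trivial hl.shift (Ext.leaves_univ _) hk1 trivial)
    (.all hk0 trivial (.iff (BT.fits_mem hk0 hk1) (hb.rename _))))) v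
  refine ⟨U, ?_, fun Z => ?_⟩
  · rw [B.sat_eqv_of hl.shift hk1, env_cons, OpStr.ev_shift] at hU
    rwa [OpStr.tm_tv, Val.cons_zero] at hU
  · have hU' := hU' Z
    rw [Formula.sat_iff, Val.cons_comm (S := BTSig) _ (by simp), Formula.sat_shift, sat_mem,
      B.mem_iff hk] at hU'
    rw [← hU']
    simp [BT.tv, Term.val]

/-- The formula `∃ m (p n 0 ≃ m ∧ φ(m))`. -/
def _root_.MSArith.BT.inductionStep (φ : BTFormula) : BTFormula :=
  BT.ex .num (BT.eqv (BT.pair (.of (BT.nv 1)) (.of BT.zero)) (.of (BT.nv 0)) ⋏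
    φ.shiftAbove (S := BTSig) BTSort.num)

theorem sat_inductionStep (φ : BTFormula) (v : B.V) (n : B.D .num) :
    (BT.inductionStep φ).Sat B.str (v.cons .num n) ↔ ∃ m,
      B.cls m = B.opAlg.pr (B.cls n) (B.const .zero) ∧ φ.Sat B.str (v.cons .num m) := by
  have h0 := BTSort.ty_zero_mem_upTo s
  have hω := BTSort.num_mem_upTo s
  have hl : (BT.pair (.of (BT.nv 1)) (.of BT.zero)).Leaves (BTSort.upTo s) := ⟨⟨h0, hω⟩, hω⟩
  refine exists_congr fun m => and_congr ?_ (Formula.sat_shiftAbove _ _ _ _ _)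
  rw [B.sat_eqv_of hl hω]
  have : B.opStr.Ev (B.env ((v.cons .num n).cons .num m)) (BT.pair (.of (BT.nv 1)) (.of BT.zero))
      (B.opAlg.pr (B.cls n) (B.const .zero)) :=
    OpStr.Ev.pair (P := B.opAlg) rfl rfl
  rw [OpAlg.ev_iff (P := B.opAlg) this]
  rfl

/-- The induction axiom for all formulas follows from the induction rule: the rule is applied to
`φ(0) ∧ ∀ n (φ(n) ⊃ ∃ m (p n 0 ≃ m ∧ φ(m))) ⊃ φ`, whose premises hold in all models and hence are
provable by completeness. -/
theorem induction {φ : BTFormula} (hφ : φ.SortsIn (BTSort.upTo s)) (v : B.V)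
    (hzero : ∀ d, B.cls d = B.const .zero → φ.Sat B.str (v.cons .num d))
    (hsucc : ∀ n, φ.Sat B.str (v.cons .num n) → ∃ m,
      B.cls m = B.opAlg.pr (B.cls n) (B.const .zero) ∧ φ.Sat B.str (v.cons .num m))
    (n : B.D .num) : φ.Sat B.str (v.cons .num n) := by
  have hω := BTSort.num_mem_upTo s
  have h0 := BTSort.ty_zero_mem_upTo s
  have hS : ∀ σ ∈ (BT.theoryCl G s).sorts, ∀ t : Term BTSig σ,
      t.SortsIn (BT.theoryCl G s).sorts := fun σ hσ t => (BT.sortsIn_term t).2 hσ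
  have hl : (BT.pair (.of (BT.nv 1)) (.of BT.zero)).Leaves (BTSort.upTo s) := ⟨⟨h0, hω⟩, hω⟩
  have hstep : ∀ {ψ : BTFormula}, ψ.SortsIn (BTSort.upTo s) →
      (ψ ➝ BT.inductionStep ψ).SortsIn (BTSort.upTo s) := fun {ψ} h =>
    ⟨h, hω, (BT.fits_eqv (u := .of (BT.nv 0)) (E := Set.univ) h0 trivial hl (Ext.leaves_univ _)
      hω trivial).1, (Formula.sortsIn_rename _ _).2 h⟩
  have hzeroS : (φ.inst BT.zero).SortsIn (BTSort.upTo s) :=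
    hφ.inst ((BT.sortsIn_term _).2 hω)
  let H : BTFormula := φ.inst BT.zero ⋏ BT.all .num (φ ➝ BT.inductionStep φ)
  have hH : H.SortsIn (BTSort.upTo s) := ⟨hzeroS, hω, hstep hφ⟩
  let φ' : BTFormula := H.shift (S := BTSig) .num ➝ φ
  have hφ' : φ'.SortsIn (BTSort.upTo s) := ⟨(Formula.sortsIn_shift _ _).2 hH, hφ⟩
  have hsat : ∀ (B : BTModel G s) (v : B.V) (n : B.D .num),
      φ'.Sat B.str (v.cons .num n) ↔ (H.Sat B.str v → φ.Sat B.str (v.cons .num n)) :=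
    fun B v n => imp_congr_left (Formula.sat_shift _ _ _ _)
  have h₁ : (BT.theoryCl G s).Provable (φ'.inst BT.zero) :=
    Theory.provable_of_forall_models hS (hφ'.inst ((BT.sortsIn_term _).2 hω)) fun M hM v =>
      (Formula.sat_inst _ _ _).2 ((hsat ⟨M, hM⟩ v _).2 fun h => (Formula.sat_inst _ _ _).1 h.1)
  have h₂ : (BT.theoryCl G s).Provable (φ' ➝ BT.inductionStep φ') := by
    refine Theory.provable_of_forall_models hS (hstep hφ') fun M hM v => ?_
    let C : BTModel G s := ⟨M, hM⟩
    -- a valuation is the extension of another one by its value at the numerical variable `0`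
    obtain ⟨w, n, rfl⟩ : ∃ (w : C.V) (n : C.D .num), v = w.cons .num n :=
      ⟨fun τ i => v τ (Ren.shift (S := BTSig) BTSort.num τ i), v .num 0,
        Val.ext_cons (S := BTSig) (σ := .num)
        (by simp) (by simp)⟩
    intro h
    rw [C.sat_inductionStep]
    by_cases hh : H.Sat M w
    · obtain ⟨m, hm, hm'⟩ := (C.sat_inductionStep _ _ _).1 (hh.2 n ((hsat C w n).1 h hh))
      exact ⟨m, hm, (hsat C w m).2 fun _ => hm'⟩
    · obtain ⟨m, hm⟩ := C.opAlg.succ_mem _ ⟨n, rfl⟩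
      exact ⟨m, hm, (hsat C w m).2 fun h' => absurd h' hh⟩
  have h₃ : (BT.theoryCl G s).Provable φ' := by
    refine .rule (ps := [φ'.inst BT.zero, φ' ➝ BT.inductionStep φ']) ⟨φ', rfl⟩ ?_ hφ'
    intro p hp
    simp only [List.mem_cons, List.not_mem_nil, or_false] at hp
    rcases hp with rfl | rfl
    exacts [h₁, h₂]
  refine (hsat B v n).1 (B.models _ h₃ _) ⟨?_, fun n h => ?_⟩
  · exact (Formula.sat_inst _ _ _).2 (hzero _ (B.tm_env v BT.zero).symm)
  · exact (B.sat_inductionStep _ _ _).2 (hsucc n h)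

end BTModel

/-! ### Iterated singletons -/

namespace BTModel

variable {G : BT.GodelNumbering} {s : ℕ} (B : BTModel G s)

/-- The expression `Z^k.Y^k.(Z ≃ Y)`. -/
def _root_.MSArith.BT.singletonAbstract (k : ℕ) : BT.Abstract :=
  ⟨k, [⟨BTSort.ty k, 0⟩], BT.eqv (.of (BT.tv k 0)) (.of (BT.tv k 1))⟩

theorem _root_.MSArith.BT.free_eqv_of {σ σ' : BTSort} (x : BTTerm σ) (y : BTTerm σ')
    {τ : BTSort} {i : ℕ}
    (h : (BT.eqv (.of x) (.of y)).Free (S := BTSig) τ i) :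
    x.Occurs (S := BTSig) τ i ∨ y.Occurs (S := BTSig) τ i := by
  have key : ∀ {ρ : BTSort} (z : BTTerm ρ),
      (BT.eqOp (BT.tv 0 0) (z.shift (S := BTSig) (.ty 0))).Free (S := BTSig) τ
        (Ren.shift (S := BTSig) (.ty 0) τ i) → z.Occurs (S := BTSig) τ i := by
    rintro ρ z ⟨j, hj⟩
    fin_cases j
    · obtain ⟨hτ, hj⟩ := hj
      obtain rfl : τ = .ty 0 := hτ
      exact absurd hj (shift_self_ne_zero (S := BTSig) (BTSort.ty 0) i)
    · obtain ⟨j, hj, hij⟩ := (Term.occurs_rename (S := BTSig) _ z _ _).1 hj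
      rwa [← shift_injective (S := BTSig) _ _ hij]
  exact h.imp (key x) (key y)

theorem _root_.MSArith.BT.singletonAbstract_admissible (k : ℕ) :
    (BT.singletonAbstract k).Admissible := by
  have hk : BTSort.ty k ∈ BTSort.upTo (k + 1) := BTSort.ty_mem_upTo (Nat.le_succ k)
  refine ⟨?_, ?_, ?_⟩
  · intro v hv
    obtain rfl := List.mem_singleton.1 hv
    exact hk
  · exact BT.Fits.elementary (BT.fits_eqv (BTSort.ty_zero_mem_upTo _)
      (by simp [BT.singletonAbstract]) hk (by simp [BT.singletonAbstract, Ext.Leaves]) hk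
      (by simp [BT.singletonAbstract, Ext.Leaves]))
  · intro σ i h
    rcases BT.free_eqv_of _ _ h with ⟨rfl, h⟩ | ⟨rfl, h⟩
    · exact absurd h (shift_self_ne_zero (S := BTSig) (.ty k) i)
    · have h : 1 = Ren.shift (S := BTSig) (.ty k) (.ty k) i := h.symm
      rw [shift_self (S := BTSig) (.ty k)] at h
      obtain rfl : i = 0 := by omega
      exact List.mem_singleton.2 rfl

/-- The operation that forms singletons of objects of type `k`. -/
noncomputable def sing (k : ℕ) : B.Ob := B.const (BTFn.c (G.num (BT.singletonAbstract k)))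

/-- Comprehension for `Z ≃ Y` gives the singleton of `Y`. -/
theorem sing_spec {k : ℕ} (hk : k + 1 ≤ s) (Y : B.D (.ty k)) :
    ∃ U : B.D (.ty (k + 1)), B.App (B.sing k) (B.cls Y) (B.cls U) ∧
      ∀ Z : B.D (.ty k), B.MemOb k (B.cls Z) (B.cls U) ↔ B.cls Z = B.cls Y := by
  have hk0 := BTSort.ty_mem_upTo (Nat.le_of_succ_le hk)
  obtain ⟨U, ⟨_, _, rfl, rfl, hU⟩, hU'⟩ : ∃ U : B.D (.ty (k + 1)),
      B.opStr.Ev (B.env (B.base.set (.ty k) 0 Y)) (BT.op (.c (G.num (BT.singletonAbstract k))) ⬝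
        .of (BT.tv k 0)) (B.cls U) ∧ ∀ Z : B.D (.ty k), B.MemOb k (B.cls Z) (B.cls U) ↔
        (BT.eqv (.of (BT.tv k 0)) (.of (BT.tv k 1))).Sat B.str
          ((B.base.set (.ty k) 0 Y).cons (.ty k) Z) :=
    B.comprehension _ (BT.singletonAbstract_admissible k) hk _
  refine ⟨U, ?_, fun Z => ?_⟩
  · have hU : B.App (B.sing k) (B.opStr.tm (B.env (B.base.set (.ty k) 0 Y)) (BT.tv k 0))
        (B.cls U) := hU
    simpa [env] using hU
  · have := hU' Z
    rw [B.sat_eqv_of (show (Ext.of (BT.tv k 0)).Leaves _ from hk0) hk0] at this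
    simpa [env] using this

/-- `b` is the `k`-fold singleton of `a`. -/
def IsSing : ℕ → B.Ob → B.Ob → Prop
  | 0, a, b => b = a
  | k + 1, a, b => ∃ c, IsSing k a c ∧ B.App (B.sing k) c b

variable {B}

theorem ev_iterSingleton {e : B.opStr.Env} {k : ℕ} {t : Ext} {b : B.Ob} :
    B.opStr.Ev e (BT.iterSingleton G k t) b ↔ ∃ a, B.opStr.Ev e t a ∧ B.IsSing k a b := by
  induction k generalizing b with
  | zero => simp [BT.iterSingleton, IsSing]
  | succ k ih =>
    simp only [BT.iterSingleton, BT.singleton, OpStr.ev_app, OpStr.ev_op, ih, IsSing]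
    constructor
    · rintro ⟨_, c, rfl, ⟨a, ha, hc⟩, h⟩
      exact ⟨a, ha, c, hc, h⟩
    · rintro ⟨a, ha, c, hc, h⟩
      exact ⟨_, c, rfl, ⟨a, ha, hc⟩, h⟩

theorem IsSing.unique {k : ℕ} {a b b' : B.Ob} (h : B.IsSing k a b) (h' : B.IsSing k a b') :
    b = b' := by
  induction k generalizing b b' with
  | zero => exact Eq.trans h (Eq.symm h')
  | succ k ih =>
    obtain ⟨c, hc, h⟩ := h
    obtain ⟨c', hc', h'⟩ := h'
    obtain rfl := ih hc hc'
    exact B.app_fun h h'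

variable (B) in
theorem exists_isSing {k : ℕ} (hk : k ≤ s) (a : B.Ob) :
    ∃ U : B.D (.ty k), B.IsSing k a (B.cls U) := by
  induction k with
  | zero => exact B.exists_ob.1 ⟨a, rfl⟩
  | succ k ih =>
    obtain ⟨Y, hY⟩ := ih (Nat.le_of_succ_le hk)
    obtain ⟨U, hU, -⟩ := B.sing_spec hk Y
    exact ⟨U, _, hY, hU⟩

/-- Different objects have different iterated singletons: the only element of a singleton is
recovered from it. -/
theorem IsSing.injective {k : ℕ} (hk : k ≤ s) {a a' b : B.Ob} (h : B.IsSing k a b)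
    (h' : B.IsSing k a' b) : a = a' := by
  induction k generalizing b with
  | zero => exact Eq.trans (Eq.symm h) h'
  | succ k ih =>
    obtain ⟨c, hc, h⟩ := h
    obtain ⟨c', hc', h'⟩ := h'
    obtain ⟨Y, hY⟩ := B.exists_isSing (Nat.le_of_succ_le hk) a
    obtain ⟨Y', hY'⟩ := B.exists_isSing (Nat.le_of_succ_le hk) a'
    obtain rfl := hc.unique hY
    obtain rfl := hc'.unique hY'
    obtain ⟨U, hU, hU'⟩ := B.sing_spec hk Y
    obtain ⟨V, hV, hV'⟩ := B.sing_spec hk Y'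
    obtain rfl := B.app_fun h hU
    rw [B.app_fun h' hV] at hU'
    rw [← (hV' Y).1 ((hU' Y).2 rfl)] at hc'
    exact ih (Nat.le_of_succ_le hk) hc hc'

variable (B)

/-- All elements of the set `b` of type `k + 1` are `k`-fold singletons of numbers. -/
def Coded (k : ℕ) (b : B.Ob) : Prop :=
  ∀ Z : B.D (.ty k), B.MemOb k (B.cls Z) b → ∃ n ∈ B.Num, B.IsSing k n (B.cls Z)

theorem sat_codesSet {k : ℕ} (hk : k + 1 ≤ s) (v : B.V) :
    (BT.codesSet G k).Sat B.str v ↔ B.Coded k (B.env v (.ty (k + 1)) 0) := by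
  have hω := BTSort.num_mem_upTo s
  have h0 := BTSort.ty_zero_mem_upTo s
  have hk0 := BTSort.ty_mem_upTo (Nat.le_of_succ_le hk)
  have hl : ∀ j, (BT.iterSingleton G j (.of (BT.nv 0))).Leaves (BTSort.upTo s) := fun j => by
    induction j with
    | zero => exact hω
    | succ j ih => exact ⟨h0, ih⟩
  refine forall_congr' fun Z => imp_congr ?_ ?_
  · rw [sat_mem, B.mem_iff hk]
    simp [BT.tv, Term.val, env]
  · have : ∀ n : B.D .num, (BT.eqv (BT.iterSingleton G k (.of (BT.nv 0))) (.of (BT.tv k 0))).Sat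
        B.str ((v.cons (.ty k) Z).cons .num n) ↔ B.IsSing k (B.cls n) (B.cls Z) := fun n => by
      rw [B.sat_eqv_of (hl k) hk0, ev_iterSingleton]
      simp [env]
    constructor
    · rintro ⟨n, hn⟩
      exact ⟨_, ⟨n, rfl⟩, (this n).1 hn⟩
    · rintro ⟨_, ⟨n, rfl⟩, hn⟩
      exact ⟨n, (this n).2 hn⟩

/-! ### Addition and multiplication in models of `BT` -/

theorem _root_.MSArith.Ext.Leaves.lam {A : Set BTSort} (h0 : .ty 0 ∈ A) {t : Ext} (h : t.Leaves A)
    (i : ℕ) : (BT.lam i t).Leaves A := by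
  induction t with
  | of t =>
    rcases BT.term_cases t with ⟨j, rfl⟩ | ⟨f, rfl⟩
    · rename_i σ
      rcases σ with _ | _ | k
      · exact ⟨h0, h⟩
      · simp only [BT.lam]
        split_ifs
        exacts [⟨⟨h0, h0⟩, h0⟩, ⟨h0, h0⟩]
      · exact ⟨h0, h⟩
    · cases f <;> exact ⟨h0, h⟩
  | app t u iht ihu => exact ⟨⟨h0, iht h.1⟩, ihu h.2⟩

theorem _root_.MSArith.Ext.Leaves.app {A : Set BTSort} {t u : Ext} (ht : t.Leaves A)
    (hu : u.Leaves A) : (t ⬝ u).Leaves A := ⟨ht, hu⟩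

theorem _root_.MSArith.BT.leaves_recOp {A : Set BTSort} (hω : .num ∈ A) (h0 : .ty 0 ∈ A) :
    BT.recOp.Leaves A := by
  simp only [BT.recOp, BT.recStep]
  repeat' first | exact h0 | exact hω | apply Ext.Leaves.lam h0 | apply Ext.Leaves.app

theorem _root_.MSArith.BT.leaves_addOp {A : Set BTSort} (hω : .num ∈ A) (h0 : .ty 0 ∈ A) :
    BT.addOp.Leaves A := by
  simp only [BT.addOp, BT.pair]
  repeat' first
    | exact h0 | exact hω | exact BT.leaves_recOp hω h0
    | apply Ext.Leaves.lam h0 | apply Ext.Leaves.app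

theorem _root_.MSArith.BT.leaves_mulOp {A : Set BTSort} (hω : .num ∈ A) (h0 : .ty 0 ∈ A) :
    BT.mulOp.Leaves A := by
  simp only [BT.mulOp]
  repeat' first
    | exact h0 | exact hω | exact BT.leaves_recOp hω h0 | exact BT.leaves_addOp hω h0
    | apply Ext.Leaves.lam h0 | apply Ext.Leaves.app

/-- The successor of a number. -/
noncomputable def succ (n : B.Ob) : B.Ob := B.opAlg.pr n (B.const .zero)

/-- A closed term defines a total operation on numbers if it does so recursively in its second
argument. -/
theorem total_of_recursion {t : Ext} {f : B.Ob} (ht : t.Leaves (BTSort.upTo s))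
    (hf : ∀ e, B.opStr.Ev e t f)
    (hzero : ∀ n ∈ B.Num, ∃ r ∈ B.Num, B.opAlg.App₂ f n (B.const .zero) r)
    (hsucc : ∀ n ∈ B.Num, ∀ m ∈ B.Num, ∀ r ∈ B.Num, B.opAlg.App₂ f n m r →
      ∃ r' ∈ B.Num, B.opAlg.App₂ f n (B.succ m) r') (n m : B.Ob) (hn : n ∈ B.Num) (hm : m ∈ B.Num) :
    ∃ r ∈ B.Num, B.opAlg.App₂ f n m r := by
  obtain ⟨n, rfl⟩ := hn
  obtain ⟨m, rfl⟩ := hm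
  have h0 := BTSort.ty_zero_mem_upTo s
  have hω := BTSort.num_mem_upTo s
  have hl : (t ⬝ .of (BT.nv 2) ⬝ .of (BT.nv 1)).Leaves (BTSort.upTo s) := ⟨⟨ht, hω⟩, hω⟩
  let φ : BTFormula := BT.ex .num (BT.eqv (t ⬝ .of (BT.nv 2) ⬝ .of (BT.nv 1)) (.of (BT.nv 0)))
  have hφ : φ.SortsIn (BTSort.upTo s) := ⟨hω, (BT.fits_eqv (u := .of (BT.nv 0)) (E := Set.univ) h0
    trivial hl (Ext.leaves_univ _) hω trivial).1⟩
  have hsat : ∀ m : B.D .num, φ.Sat B.str ((B.base.cons .num n).cons .num m) ↔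
      ∃ r ∈ B.Num, B.opAlg.App₂ f (B.cls n) (B.cls m) r := by
    intro m
    have : ∀ r : B.D .num, (BT.eqv (t ⬝ .of (BT.nv 2) ⬝ .of (BT.nv 1)) (.of (BT.nv 0))).Sat B.str
        (((B.base.cons .num n).cons .num m).cons .num r) ↔
        B.opAlg.App₂ f (B.cls n) (B.cls m) (B.cls r) := by
      intro r
      rw [B.sat_eqv_of hl hω]
      constructor
      · rintro ⟨_, _, ⟨g, _, hg, rfl, h1⟩, rfl, h2⟩
        obtain rfl := OpStr.Ev.unique (P := B.opAlg) hg (hf _)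
        exact ⟨_, h1, h2⟩
      · exact fun h => OpStr.Ev.app₂ (P := B.opAlg) h (hf _) rfl rfl
    constructor
    · rintro ⟨r, hr⟩
      exact ⟨_, ⟨r, rfl⟩, (this r).1 hr⟩
    · rintro ⟨_, ⟨r, rfl⟩, hr⟩
      exact ⟨r, (this r).2 hr⟩
  refine (hsat m).1 (B.induction hφ _ (fun d hd => (hsat d).2 ?_) (fun m hm => ?_) m)
  · rw [hd]
    exact hzero _ ⟨n, rfl⟩
  · obtain ⟨r, hr, h⟩ := (hsat m).1 hm
    obtain ⟨m', hm'⟩ := B.opAlg.succ_mem (B.cls m) ⟨m, rfl⟩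
    refine ⟨m', hm', (hsat m').2 ?_⟩
    rw [hm']
    exact hsucc _ ⟨n, rfl⟩ _ ⟨m, rfl⟩ r hr h

/-- The operation of addition. -/
noncomputable def addOb : B.Ob := B.opAlg.exists_addOp.choose

/-- The operation of multiplication. -/
noncomputable def mulOb : B.Ob := B.opAlg.exists_mulOp.choose

theorem ev_addOp (e : B.opStr.Env) : B.opStr.Ev e BT.addOp B.addOb :=
  B.opAlg.exists_addOp.choose_spec.1 e

theorem ev_mulOp (e : B.opStr.Env) : B.opStr.Ev e BT.mulOp B.mulOb :=
  B.opAlg.exists_mulOp.choose_spec.1 e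

theorem add_zero (n : B.Ob) : B.opAlg.App₂ B.addOb n (B.const .zero) n :=
  (B.opAlg.exists_addOp.choose_spec.2 n).1

theorem add_succ {n m r : B.Ob} (hm : m ∈ B.Num) (h : B.opAlg.App₂ B.addOb n m r) :
    B.opAlg.App₂ B.addOb n (B.succ m) (B.succ r) :=
  (B.opAlg.exists_addOp.choose_spec.2 n).2 m hm r h

theorem mul_zero (n : B.Ob) : B.opAlg.App₂ B.mulOb n (B.const .zero) (B.const .zero) :=
  (B.opAlg.exists_mulOp.choose_spec.2 _ B.ev_addOp n).1

theorem mul_succ {n m r r' : B.Ob} (hm : m ∈ B.Num) (h : B.opAlg.App₂ B.mulOb n m r)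
    (h' : B.opAlg.App₂ B.addOb r n r') : B.opAlg.App₂ B.mulOb n (B.succ m) r' :=
  (B.opAlg.exists_mulOp.choose_spec.2 _ B.ev_addOp n).2 m hm r r' h h'

theorem add_total (n m : B.Ob) (hn : n ∈ B.Num) (hm : m ∈ B.Num) :
    ∃ r ∈ B.Num, B.opAlg.App₂ B.addOb n m r :=
  B.total_of_recursion (BT.leaves_addOp (BTSort.num_mem_upTo s) (BTSort.ty_zero_mem_upTo s))
    B.ev_addOp (fun n hn => ⟨n, hn, B.add_zero n⟩)
    (fun _ _ _ hm _ hr h => ⟨_, B.opAlg.succ_mem _ hr, B.add_succ hm h⟩) n m hn hm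

theorem mul_total (n m : B.Ob) (hn : n ∈ B.Num) (hm : m ∈ B.Num) :
    ∃ r ∈ B.Num, B.opAlg.App₂ B.mulOb n m r :=
  B.total_of_recursion (BT.leaves_mulOp (BTSort.num_mem_upTo s) (BTSort.ty_zero_mem_upTo s))
    B.ev_mulOp (fun n _ => ⟨_, B.zero_mem_num, B.mul_zero n⟩)
    (fun n hn _ hm r hr h =>
      let ⟨r', hr', h'⟩ := B.add_total r n hr hn
      ⟨r', hr', B.mul_succ hm h h'⟩) n m hn hm

end BTModel

/-! ### The translation of formulas of `SA` -/

theorem SASort.toBT_injective : Function.Injective SASort.toBT := by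
  rintro (_ | i) (_ | j) h <;> simp_all [SASort.toBT]

namespace SA

theorem leaves_toExt {A : Set BTSort} (hω : .num ∈ A) (h0 : .ty 0 ∈ A) (t : SATerm .num) :
    (toExt t).Leaves A := by
  have : ∀ (σ : SASig.Srt) (t : Term SASig σ), σ = SASort.num → (toExt t).Leaves A := by
    intro σ t
    induction t with
    | var σ i => rintro rfl; exact hω
    | app f ts ih =>
      intro _
      cases f with
      | zero => exact hω
      | one => exact ⟨⟨h0, hω⟩, hω⟩
      | add => exact ⟨⟨BT.leaves_addOp hω h0, ih 0 rfl⟩, ih 1 rfl⟩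
      | mul => exact ⟨⟨BT.leaves_mulOp hω h0, ih 0 rfl⟩, ih 1 rfl⟩
  exact this _ t rfl

theorem leaves_iterSingleton (G : BT.GodelNumbering) {A : Set BTSort} (h0 : .ty 0 ∈ A) {t : Ext}
    (ht : t.Leaves A) (k : ℕ) : (BT.iterSingleton G k t).Leaves A := by
  induction k with
  | zero => exact ht
  | succ k ih => exact ⟨h0, ih⟩

theorem fits_codesSet (G : BT.GodelNumbering) {A E : Set BTSort} {k : ℕ} (hω : .num ∈ A)
    (h0 : .ty 0 ∈ A) (hω' : .num ∈ E) (h0' : .ty 0 ∈ E) (hk : .ty k ∈ A) (hk' : .ty k ∈ E)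
    (hk1 : .ty (k + 1) ∈ A) : BT.Fits A E (BT.codesSet G k) :=
  .all hk hk' (.imp (BT.fits_mem hk hk1) (.ex hω hω' (BT.fits_eqv h0 h0'
    (leaves_iterSingleton G h0 (t := .of (BT.nv 0)) hω k)
    (leaves_iterSingleton G h0' (t := .of (BT.nv 0)) hω' k) hk hk')))

/-- The sorts in a translated formula.  The translation of an atomic formula `t ∈_k x` quantifies
over the type `k - 1`, and that of a quantifier over the sort `k` over the types `k` and
`k - 1`. -/
theorem fits_star (G : BT.GodelNumbering) {n : ℕ} {E : Set BTSort} (hω : .num ∈ E)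
    (hE : ∀ j < n, .ty j ∈ E) (h0 : .ty 0 ∈ E) {φ : SAFormula}
    (hφ : φ.SortsIn {σ : SASort | σ.index ≤ n})
    (hq : φ.QuantifiersIn {σ : SASort | σ.toBT ∈ E}) :
    BT.Fits (BTSort.upTo n) E (star G φ) := by
  have hω' := BTSort.num_mem_upTo n
  have h0' := BTSort.ty_zero_mem_upTo n
  have ht : ∀ {j}, j ≤ n → BTSort.ty j ∈ BTSort.upTo n := BTSort.ty_mem_upTo
  induction φ with
  | falsum => exact BT.fits_falsum
  | rel r ts =>
    cases r with
    | eq =>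
      exact BT.fits_eqv h0' h0 (leaves_toExt hω' h0' _) (leaves_toExt hω h0 _)
        (leaves_toExt hω' h0' _) (leaves_toExt hω h0 _)
    | mem k =>
      have hk : k + 1 ≤ n := (hφ 1).mem
      exact BT.fits_extMem h0' h0 (ht (by omega)) (hE k (by omega)) (ht hk)
        (leaves_iterSingleton G h0' (leaves_toExt hω' h0' _) k)
        (leaves_iterSingleton G h0 (leaves_toExt hω h0 _) k)
  | and φ ψ h1 h2 => exact .and (h1 hφ.1 hq.1) (h2 hφ.2 hq.2)
  | or φ ψ h1 h2 => exact .or (h1 hφ.1 hq.1) (h2 hφ.2 hq.2)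
  | imp φ ψ h1 h2 => exact .imp (h1 hφ.1 hq.1) (h2 hφ.2 hq.2)
  | all σ φ ih =>
    cases σ with
    | num => exact .all hω' hω (ih hφ.2 hq.2)
    | set k =>
      have hk : k + 1 ≤ n := hφ.1
      exact .all (ht hk) hq.1 (.imp (fits_codesSet G hω' h0' hω h0 (ht (by omega))
        (hE k (by omega)) (ht hk)) (ih hφ.2 hq.2))
  | ex σ φ ih =>
    cases σ with
    | num => exact .ex hω' hω (ih hφ.2 hq.2)
    | set k =>
      have hk : k + 1 ≤ n := hφ.1
      exact .ex (ht hk) hq.1 (.and (fits_codesSet G hω' h0' hω h0 (ht (by omega))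
        (hE k (by omega)) (ht hk)) (ih hφ.2 hq.2))

theorem quantifiersIn_univ {S : Sig} (φ : Formula S) : φ.QuantifiersIn Set.univ := by
  induction φ with
  | falsum => trivial
  | rel => trivial
  | and _ _ h1 h2 => exact ⟨h1, h2⟩
  | or _ _ h1 h2 => exact ⟨h1, h2⟩
  | imp _ _ h1 h2 => exact ⟨h1, h2⟩
  | all _ _ h => exact ⟨trivial, h⟩
  | ex _ _ h => exact ⟨trivial, h⟩

theorem sortsIn_star (G : BT.GodelNumbering) {n : ℕ} {φ : SAFormula}
    (hφ : φ.SortsIn {σ : SASort | σ.index ≤ n}) : (star G φ).SortsIn (BTSort.upTo n) :=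
  (fits_star G (E := Set.univ) trivial (fun _ _ => trivial) trivial hφ (quantifiersIn_univ φ)).1

end SA

/-! ### The arithmetical structure of a model of `BT` -/

namespace BTModel

variable {G : BT.GodelNumbering} {s : ℕ} (B : BTModel G s)

/-- The objects that interpret the sorts of `SA`: the numbers, and the sets all of whose elements
are iterated singletons of numbers.  No condition is imposed on the sorts outside the language. -/
def SAOb : SASort → Set B.Ob
  | .num => B.Num
  | .set k => {b | (∃ X : B.D (.ty (k + 1)), B.cls X = b) ∧ (k + 1 ≤ s → B.Coded k b)}

theorem exists_saOb (σ : SASort) : ∃ a, a ∈ B.SAOb σ := by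
  rcases σ with _ | k
  · exact ⟨_, B.zero_mem_num⟩
  · by_cases hk : k + 1 ≤ s
    · -- the empty set
      obtain ⟨U, -, hU⟩ := B.comprehension ⟨k, [], .falsum⟩
        ⟨by simp, BT.fits_falsum, fun _ _ h => h.elim⟩ hk B.base
      exact ⟨B.cls U, ⟨U, rfl⟩, fun _ Z hZ => ((hU Z).1 hZ).elim⟩
    · exact ⟨_, ⟨B.str.pt _, rfl⟩, fun h => absurd h hk⟩

/-- The interpretation of the function symbols of `SA`. -/
noncomputable def saFn : {l : List SASort} → {σ : SASort} → SAFn l σ →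
    ((j : Fin l.length) → B.SAOb (l.get j)) → B.SAOb σ
  | _, _, .zero, _ => ⟨B.const .zero, B.zero_mem_num⟩
  | _, _, .one, _ => ⟨B.succ (B.const .zero), B.opAlg.succ_mem _ B.zero_mem_num⟩
  | _, _, .add, a => ⟨_, (B.add_total _ _ (a 0).2 (a 1).2).choose_spec.1⟩
  | _, _, .mul, a => ⟨_, (B.mul_total _ _ (a 0).2 (a 1).2).choose_spec.1⟩

/-- The structure for the language of `SA` given by a model of `BT_s`; equality of numbers is
interpreted by equality, and membership of `n` in a set of sort `k + 1` by membership of the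
`k`-fold singleton of `n`. -/
noncomputable def sa : Str SASig where
  D σ := B.SAOb σ
  pt σ := ⟨_, (B.exists_saOb σ).choose_spec⟩
  fn := B.saFn
  rel {l} r := match l, r with
    | _, .eq => fun a => (a 0).1 = (a 1).1
    | _, .mem k => fun a => ∃ z, B.IsSing k (a 0).1 z ∧ B.MemOb k z (a 1).1

/-- The value of the external term of an arithmetical term is the value of that term. -/
theorem ev_toExt (v : Val B.sa.D) (e : B.opStr.Env) {σ : SASig.Srt} (t : Term SASig σ)
    (h : ∀ τ i, t.Occurs τ i → e (SASort.toBT τ) i = (v τ i).1) :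
    B.opStr.Ev e (SA.toExt t) (t.val B.sa v).1 := by
  induction t with
  | var σ i => exact h σ i ⟨rfl, rfl⟩
  | app f ts ih =>
    have ih : ∀ j, B.opStr.Ev e (SA.toExt (ts j)) ((ts j).val B.sa v).1 :=
      fun j => ih j fun τ i hi => h τ i ⟨j, hi⟩
    cases f with
    | zero => rfl
    | one => exact OpStr.Ev.pair (P := B.opAlg) rfl rfl
    | add =>
      exact OpStr.Ev.app₂ (P := B.opAlg)
        (B.add_total _ _ ((ts 0).val B.sa v).2 ((ts 1).val B.sa v).2).choose_spec.2
        (B.ev_addOp e) (ih 0) (ih 1)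
    | mul =>
      exact OpStr.Ev.app₂ (P := B.opAlg)
        (B.mul_total _ _ ((ts 0).val B.sa v).2 ((ts 1).val B.sa v).2).choose_spec.2
        (B.ev_mulOp e) (ih 0) (ih 1)

/-- Corresponding valuations remain so when corresponding values are assigned to a new variable. -/
theorem agree_cons {w : B.V} {v : Val B.sa.D} {P : SASort → ℕ → Prop} {σ : SASort}
    {d : B.D σ.toBT} {a : B.sa.D σ} (hda : B.cls d = a.1)
    (h : ∀ τ i, P τ (Ren.shift (S := SASig) σ τ i) → B.env w (SASort.toBT τ) i = (v τ i).1)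
    (τ : SASort) (i : ℕ) (hi : P τ i) :
    B.env (w.cons σ.toBT d) (SASort.toBT τ) i = (Val.cons v σ a τ i).1 := by
  rw [env_cons]
  rcases var_cases (S := SASig) σ τ i with ⟨rfl, rfl⟩ | ⟨j, rfl⟩
  · rw [Val.cons_zero, Val.cons_zero, hda]
  · have : Ren.shift (S := SASig) σ τ j = Ren.shift (S := BTSig) σ.toBT τ.toBT j := by
      by_cases hτ : τ = σ
      · simp [Ren.shift, hτ]
      · simp [Ren.shift, hτ, SASort.toBT_injective.eq_iff]
    have h1 := Val.cons_shift (S := SASig) v (σ := σ) a (τ := τ) j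
    have h2 := Val.cons_shift (S := BTSig) (B.env w) (σ := σ.toBT) (B.cls d) (τ := τ.toBT) j
    rw [h1, ← h τ j hi, this, h2]

/-- The translation of a formula holds in a model of `BT_s` if and only if the formula holds in the
arithmetical structure of the model. -/
theorem sat_star {φ : SAFormula} (hφ : φ.SortsIn {σ : SASort | σ.index ≤ s}) (w : B.V)
    (v : Val B.sa.D)
    (h : ∀ (τ : SASort) i, φ.Free (S := SASig) τ i → B.env w (SASort.toBT τ) i = (v τ i).1) :
    (SA.star G φ).Sat B.str w ↔ φ.Sat B.sa v := by
  have hω := BTSort.num_mem_upTo s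
  have h0 := BTSort.ty_zero_mem_upTo s
  induction φ generalizing w v with
  | falsum => rfl
  | rel r ts =>
    have he : ∀ j, B.opStr.Ev (B.env w) (SA.toExt (ts j)) ((ts j).val B.sa v).1 := fun j =>
      B.ev_toExt v _ (ts j) fun τ i hi => h τ i ⟨j, hi⟩
    cases r with
    | eq =>
      refine (B.sat_eqv (SA.leaves_toExt hω h0 _) (SA.leaves_toExt hω h0 _) w).trans ?_
      constructor
      · rintro ⟨a, ha, hb⟩
        exact (OpStr.Ev.unique (P := B.opAlg) (he 0) ha).trans
          (OpStr.Ev.unique (P := B.opAlg) hb (he 1))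
      · intro hab
        refine ⟨_, he 0, ?_⟩
        have hab : ((ts 0).val B.sa v).1 = ((ts 1).val B.sa v).1 := hab
        rw [hab]
        exact he 1
    | mem k =>
      have hk : k + 1 ≤ s := (hφ 1).mem
      refine (B.sat_extMem hk (SA.leaves_iterSingleton G h0 (SA.leaves_toExt hω h0 _) k) _
        w).trans ?_
      have hset : ∀ t : SATerm (.set k), (∀ (τ : SASort) i, t.Occurs (S := SASig) τ i →
          B.env w (SASort.toBT τ) i = (v τ i).1) →
          B.opStr.tm (B.env w) (BT.tv (k + 1) (SA.setIndex t)) = (t.val B.sa v).1 := by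
        intro t ht
        match t with
        | .var _ i => exact ht _ i ⟨rfl, rfl⟩
      rw [hset (ts 1) fun τ i hi => h τ i ⟨1, hi⟩]
      simp only [ev_iterSingleton]
      constructor
      · rintro ⟨z, ⟨a, ha, hz⟩, hm⟩
        obtain rfl := OpStr.Ev.unique (P := B.opAlg) ha (he 0)
        exact ⟨z, hz, hm⟩
      · rintro ⟨z, hz, hm⟩
        exact ⟨z, ⟨_, he 0, hz⟩, hm⟩
  | and φ ψ h1 h2 =>
    exact and_congr (h1 hφ.1 w v fun τ i hi => h τ i (.inl hi))
      (h2 hφ.2 w v fun τ i hi => h τ i (.inr hi))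
  | or φ ψ h1 h2 =>
    exact or_congr (h1 hφ.1 w v fun τ i hi => h τ i (.inl hi))
      (h2 hφ.2 w v fun τ i hi => h τ i (.inr hi))
  | imp φ ψ h1 h2 =>
    exact imp_congr (h1 hφ.1 w v fun τ i hi => h τ i (.inl hi))
      (h2 hφ.2 w v fun τ i hi => h τ i (.inr hi))
  | all σ φ ih =>
    cases σ with
    | num =>
      constructor
      · rintro hall ⟨_, d, rfl⟩
        exact (ih hφ.2 _ _ (B.agree_cons (σ := .num) rfl h)).1 (hall d)
      · intro hall d
        exact (ih hφ.2 _ _ (B.agree_cons (σ := .num) (a := ⟨_, d, rfl⟩) rfl h)).2 (hall _)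
    | set k =>
      have hk : k + 1 ≤ s := hφ.1
      have hc : ∀ X, (BT.codesSet G k).Sat B.str (w.cons (.ty (k + 1)) X) ↔
          B.Coded k (B.cls X) := fun X => by
        rw [B.sat_codesSet hk, env_cons, Val.cons_zero]
      constructor
      · rintro hall ⟨_, ⟨X, rfl⟩, hX⟩
        exact (ih hφ.2 _ _ (B.agree_cons (σ := .set k) rfl h)).1 (hall X ((hc X).2 (hX hk)))
      · intro hall X hX
        exact (ih hφ.2 _ _ (B.agree_cons (σ := .set k)
          (a := ⟨_, ⟨X, rfl⟩, fun _ => (hc X).1 hX⟩) rfl h)).2 (hall _)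
  | ex σ φ ih =>
    cases σ with
    | num =>
      constructor
      · rintro ⟨d, hd⟩
        exact ⟨⟨_, d, rfl⟩, (ih hφ.2 _ _ (B.agree_cons (σ := .num) rfl h)).1 hd⟩
      · rintro ⟨⟨_, d, rfl⟩, hd⟩
        exact ⟨d, (ih hφ.2 _ _ (B.agree_cons (σ := .num) rfl h)).2 hd⟩
    | set k =>
      have hk : k + 1 ≤ s := hφ.1
      have hc : ∀ X, (BT.codesSet G k).Sat B.str (w.cons (.ty (k + 1)) X) ↔
          B.Coded k (B.cls X) := fun X => by
        rw [B.sat_codesSet hk, env_cons, Val.cons_zero]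
      constructor
      · rintro ⟨X, hX, hd⟩
        exact ⟨⟨_, ⟨X, rfl⟩, fun _ => (hc X).1 hX⟩,
          (ih hφ.2 _ _ (B.agree_cons (σ := .set k) rfl h)).1 hd⟩
      · rintro ⟨⟨_, ⟨X, rfl⟩, hX⟩, hd⟩
        exact ⟨X, (hc X).2 (hX hk), (ih hφ.2 _ _ (B.agree_cons (σ := .set k) rfl h)).2 hd⟩

end BTModel

namespace BTModel

variable {G : BT.GodelNumbering} {s : ℕ} (B : BTModel G s)

/-! ### Arithmetic in models of `BT` -/

/-- The numbers of the arithmetical structure. -/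
abbrev Nb : Type := B.sa.D SASort.num

/-- A valuation in the arithmetical structure comes from a valuation in the model. -/
theorem exists_lift (v : Val B.sa.D) :
    ∃ w : B.V, ∀ (τ : SASort) i, B.env w τ.toBT i = (v τ i).1 := by
  have h : ∀ (σ : BTSort) (i : ℕ), ∃ d : B.D σ, ∀ τ : SASort, τ.toBT = σ →
      B.cls d = (v τ i).1 := by
    rintro (_ | _ | k) i
    · obtain ⟨d, hd⟩ := (v .num i).2
      refine ⟨d, fun τ hτ => ?_⟩
      obtain rfl : τ = .num := SASort.toBT_injective hτ
      exact hd
    · refine ⟨B.str.pt _, fun τ hτ => ?_⟩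
      cases τ <;> cases hτ
    · obtain ⟨d, hd⟩ := (v (.set k) i).2.1
      refine ⟨d, fun τ hτ => ?_⟩
      obtain rfl : τ = .set k := SASort.toBT_injective hτ
      exact hd
  choose w hw using h
  exact ⟨w, fun τ i => hw _ i τ rfl⟩

noncomputable instance : Zero B.Nb := ⟨B.saFn .zero fun j => j.elim0⟩

noncomputable instance : One B.Nb := ⟨B.saFn .one fun j => j.elim0⟩

noncomputable instance : Add B.Nb := ⟨fun a b => B.saFn .add fun j => match j with
  | 0 => a
  | 1 => b⟩

noncomputable instance : Mul B.Nb := ⟨fun a b => B.saFn .mul fun j => match j with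
  | 0 => a
  | 1 => b⟩

section

variable (v : Val B.sa.D) (t u : SATerm .num)

@[simp] theorem val_zero : SA.zero.val B.sa v = (0 : B.Nb) := rfl

@[simp] theorem val_one : SA.one.val B.sa v = (1 : B.Nb) := rfl

@[simp] theorem val_add :
    (SA.add t u).val B.sa v = (t.val B.sa v + u.val B.sa v : B.Nb) := rfl

@[simp] theorem val_mul :
    (SA.mul t u).val B.sa v = (t.val B.sa v * u.val B.sa v : B.Nb) := rfl

@[simp] theorem val_nv (i : ℕ) : (SA.nv i).val B.sa v = v SASort.num i := rfl

@[simp] theorem val_sv (k i : ℕ) : (SA.sv k i).val B.sa v = v (SASort.set k) i := rfl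

@[simp] theorem sat_eq : (SA.eq t u).Sat B.sa v ↔ t.val B.sa v = u.val B.sa v :=
  Subtype.ext_iff.symm

end

section Peano

variable {B} (a b c : B.Nb)

theorem coe_add : B.opAlg.App₂ B.addOb a.1 b.1 (a + b : B.Nb).1 :=
  (B.add_total _ _ a.2 b.2).choose_spec.2

theorem coe_mul : B.opAlg.App₂ B.mulOb a.1 b.1 (a * b : B.Nb).1 :=
  (B.mul_total _ _ a.2 b.2).choose_spec.2

theorem nb_add_zero : a + 0 = a := Subtype.ext ((coe_add a 0).unique (B.add_zero a.1))

theorem coe_add_one : (a + 1 : B.Nb).1 = B.succ a.1 :=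
  (coe_add a 1).unique (B.add_succ B.zero_mem_num (B.add_zero a.1))

theorem nb_add_add_one : a + (b + 1) = a + b + 1 := by
  refine Subtype.ext ((coe_add a (b + 1)).unique ?_)
  rw [coe_add_one, coe_add_one]
  exact B.add_succ b.2 (coe_add a b)

theorem nb_mul_zero : a * 0 = 0 := Subtype.ext ((coe_mul a 0).unique (B.mul_zero a.1))

theorem nb_mul_add_one : a * (b + 1) = a * b + a := by
  refine Subtype.ext ((coe_mul a (b + 1)).unique ?_)
  rw [coe_add_one]
  exact B.mul_succ b.2 (coe_mul a b) (coe_add (a * b) a)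

theorem nb_add_one_ne_zero : a + 1 ≠ 0 := fun h => by
  have := congrArg Subtype.val h
  rw [coe_add_one] at this
  exact B.opAlg.pr_ne_zero _ _ this

theorem nb_add_one_injective (h : a + 1 = b + 1) : a = b := by
  have := congrArg Subtype.val h
  rw [coe_add_one, coe_add_one] at this
  have h1 := B.opAlg.app_fst a.1 (B.const .zero)
  have h2 := B.opAlg.app_fst b.1 (B.const .zero)
  refine Subtype.ext (B.app_fun h1 ?_)
  rw [show B.opAlg.pr a.1 (B.const .zero) = B.opAlg.pr b.1 (B.const .zero) from this]
  exact h2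

end Peano

theorem sat_star_cons {φ : SAFormula} (hφ : φ.SortsIn {σ : SASort | σ.index ≤ s}) {w : B.V}
    {v : Val B.sa.D} (hw : ∀ (τ : SASort) i, B.env w τ.toBT i = (v τ i).1) {d : B.D .num}
    {a : B.Nb} (hda : B.cls d = a.1) :
    (SA.star G φ).Sat B.str (w.cons .num d) ↔ φ.Sat B.sa (v.cons SASort.num a) :=
  B.sat_star hφ _ _ (B.agree_cons (σ := .num) (P := fun τ i => φ.Free (S := SASig) τ i) hda
    fun τ i _ => hw τ i)

/-- Induction for the formulas of `SA_s` in the arithmetical structure. -/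
theorem sa_induction {φ : SAFormula} (hφ : φ.SortsIn {σ : SASort | σ.index ≤ s})
    (v : Val B.sa.D) (h0 : φ.Sat B.sa (v.cons SASort.num (0 : B.Nb)))
    (hs : ∀ n : B.Nb, φ.Sat B.sa (v.cons SASort.num n) →
      φ.Sat B.sa (v.cons SASort.num (n + 1 : B.Nb))) (n : B.Nb) :
    φ.Sat B.sa (v.cons SASort.num n) := by
  obtain ⟨w, hw⟩ := B.exists_lift v
  have key : ∀ (d : B.D .num) (a : B.Nb), B.cls d = a.1 →
      ((SA.star G φ).Sat B.str (w.cons .num d) ↔ φ.Sat B.sa (v.cons SASort.num a)) :=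
    fun d a hda => B.sat_star_cons hφ hw hda
  obtain ⟨d, hd⟩ := n.2
  refine (key d n hd).1 (B.induction (SA.sortsIn_star G hφ) w (fun d hd => (key d 0 hd).2 h0)
    (fun m hm => ?_) d)
  let a : B.Nb := ⟨B.cls m, m, rfl⟩
  obtain ⟨m', hm'⟩ := (a + 1).2
  exact ⟨m', hm'.trans (coe_add_one a), (key m' (a + 1) hm').2 (hs a ((key m a rfl).1 hm))⟩

/-- A valuation with given values of the numerical variables `0` and `1`. -/
noncomputable def valuation₂ (a b : B.Nb) : Val B.sa.D :=
  Val.cons (S := SASig) (Val.cons (S := SASig) (fun σ _ => B.sa.pt σ) SASort.num b) SASort.num a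

theorem _root_.MSArith.SA.sortsIn_term {A : Set SASort} {σ : SASig.Srt} (t : Term SASig σ) :
    t.SortsIn A ↔ σ ∈ A := by
  refine ⟨Term.SortsIn.mem, fun h => ?_⟩
  induction t with
  | var => exact h
  | app f ts ih =>
    refine ⟨h, fun j => ih j ?_⟩
    cases f with
    | zero => exact j.elim0
    | one => exact j.elim0
    | add | mul => fin_cases j <;> exact h

theorem _root_.MSArith.SA.sortsIn_eq {n : ℕ} (t u : SATerm .num) :
    (SA.eq t u).SortsIn {σ : SASort | σ.index ≤ n} := fun j =>
  (SA.sortsIn_term _).2 (by fin_cases j <;> exact Nat.zero_le n)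

/-- An equation holds for all values of its variable `0` if its validity is inductive. -/
theorem eq_induction (t u : SATerm .num) (v : Val B.sa.D)
    (h0 : t.val B.sa (v.cons SASort.num (0 : B.Nb)) = u.val B.sa (v.cons SASort.num (0 : B.Nb)))
    (hs : ∀ n : B.Nb, t.val B.sa (v.cons SASort.num n) = u.val B.sa (v.cons SASort.num n) →
      t.val B.sa (v.cons SASort.num (n + 1 : B.Nb)) = u.val B.sa (v.cons SASort.num (n + 1 : B.Nb)))
    (n : B.Nb) : t.val B.sa (v.cons SASort.num n) = u.val B.sa (v.cons SASort.num n) :=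
  (B.sat_eq _ t u).1 (B.sa_induction (SA.sortsIn_eq t u) v ((B.sat_eq _ _ _).2 h0)
    (fun n hn => (B.sat_eq _ _ _).2 (hs n ((B.sat_eq _ _ _).1 hn))) n)

section Semiring

open SA

variable {B} (a b c : B.Nb)

theorem nb_zero_add : 0 + a = a :=
  B.eq_induction (add zero (nv 0)) (nv 0) (B.valuation₂ 0 0) (nb_add_zero 0)
    (fun n (ih : 0 + n = n) => show 0 + (n + 1) = n + 1 by rw [nb_add_add_one, ih]) a

theorem nb_add_one_add : a + 1 + b = a + b + 1 :=
  B.eq_induction (add (add (nv 1) one) (nv 0)) (add (add (nv 1) (nv 0)) one) (B.valuation₂ a 0)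
    (show a + 1 + 0 = a + 0 + 1 by rw [nb_add_zero, nb_add_zero])
    (fun n (ih : a + 1 + n = a + n + 1) => show a + 1 + (n + 1) = a + (n + 1) + 1 by
      rw [nb_add_add_one, ih, nb_add_add_one]) b

theorem nb_add_comm : a + b = b + a :=
  B.eq_induction (add (nv 1) (nv 0)) (add (nv 0) (nv 1)) (B.valuation₂ a 0)
    (show a + 0 = 0 + a by rw [nb_add_zero, nb_zero_add])
    (fun n (ih : a + n = n + a) => show a + (n + 1) = n + 1 + a by
      rw [nb_add_add_one, ih, nb_add_one_add]) b

theorem nb_add_assoc : a + b + c = a + (b + c) :=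
  B.eq_induction (add (add (nv 1) (nv 2)) (nv 0)) (add (nv 1) (add (nv 2) (nv 0)))
    (B.valuation₂ a b) (show a + b + 0 = a + (b + 0) by rw [nb_add_zero, nb_add_zero])
    (fun n (ih : a + b + n = a + (b + n)) => show a + b + (n + 1) = a + (b + (n + 1)) by
      rw [nb_add_add_one, ih, nb_add_add_one, nb_add_add_one]) c

theorem nb_zero_mul : 0 * a = 0 :=
  B.eq_induction (mul zero (nv 0)) zero (B.valuation₂ 0 0) (nb_mul_zero 0)
    (fun n (ih : 0 * n = 0) => show 0 * (n + 1) = 0 by rw [nb_mul_add_one, ih, nb_add_zero]) a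

theorem nb_add_one_mul : (a + 1) * b = a * b + b :=
  B.eq_induction (mul (add (nv 1) one) (nv 0)) (add (mul (nv 1) (nv 0)) (nv 0)) (B.valuation₂ a 0)
    (show (a + 1) * 0 = a * 0 + 0 by rw [nb_mul_zero, nb_mul_zero, nb_add_zero])
    (fun n (ih : (a + 1) * n = a * n + n) => show (a + 1) * (n + 1) = a * (n + 1) + (n + 1) by
      rw [nb_mul_add_one, ih, nb_mul_add_one, nb_add_add_one, nb_add_add_one,
        nb_add_assoc (a * n) n, nb_add_assoc (a * n) a, nb_add_comm n a]) b

theorem nb_mul_comm : a * b = b * a :=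
  B.eq_induction (mul (nv 1) (nv 0)) (mul (nv 0) (nv 1)) (B.valuation₂ a 0)
    (show a * 0 = 0 * a by rw [nb_mul_zero, nb_zero_mul])
    (fun n (ih : a * n = n * a) => show a * (n + 1) = (n + 1) * a by
      rw [nb_mul_add_one, ih, nb_add_one_mul]) b

theorem nb_mul_add : a * (b + c) = a * b + a * c :=
  B.eq_induction (mul (nv 1) (add (nv 2) (nv 0))) (add (mul (nv 1) (nv 2)) (mul (nv 1) (nv 0)))
    (B.valuation₂ a b)
    (show a * (b + 0) = a * b + a * 0 by rw [nb_add_zero, nb_mul_zero, nb_add_zero])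
    (fun n (ih : a * (b + n) = a * b + a * n) => show a * (b + (n + 1)) = a * b + a * (n + 1) by
      rw [nb_add_add_one, nb_mul_add_one, ih, nb_mul_add_one, nb_add_assoc]) c

theorem nb_mul_assoc : a * b * c = a * (b * c) :=
  B.eq_induction (mul (mul (nv 1) (nv 2)) (nv 0)) (mul (nv 1) (mul (nv 2) (nv 0)))
    (B.valuation₂ a b) (show a * b * 0 = a * (b * 0) by rw [nb_mul_zero, nb_mul_zero, nb_mul_zero])
    (fun n (ih : a * b * n = a * (b * n)) => show a * b * (n + 1) = a * (b * (n + 1)) by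
      rw [nb_mul_add_one, ih, nb_mul_add_one, nb_mul_add]) c

theorem nb_mul_one : a * 1 = a := by
  rw [← nb_zero_add 1, nb_mul_add_one, nb_mul_zero, nb_zero_add]

noncomputable instance : CommSemiring B.Nb where
  add_assoc := nb_add_assoc
  zero_add := nb_zero_add
  add_zero := nb_add_zero
  add_comm := nb_add_comm
  left_distrib := nb_mul_add
  right_distrib a b c := by rw [nb_mul_comm, nb_mul_add, nb_mul_comm c, nb_mul_comm c]
  zero_mul := nb_zero_mul
  mul_zero := nb_mul_zero
  mul_assoc := nb_mul_assoc
  one_mul a := by rw [nb_mul_comm, nb_mul_one]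
  mul_one := nb_mul_one
  mul_comm := nb_mul_comm
  nsmul := nsmulRec
  npow := npowRec

end Semiring

section Cantor

open SA

variable {B} {a b c : B.Nb}

/-- Induction for a predicate that is defined by a formula. -/
theorem induction_of_sat {P : B.Nb → Prop} {φ : SAFormula}
    (hφ : φ.SortsIn {σ : SASort | σ.index ≤ s}) (v : Val B.sa.D)
    (hP : ∀ n : B.Nb, φ.Sat B.sa (v.cons SASort.num n) ↔ P n) (h0 : P 0)
    (hs : ∀ n, P n → P (n + 1)) (n : B.Nb) : P n :=
  (hP n).1 (B.sa_induction hφ v ((hP 0).2 h0) (fun n hn => (hP _).2 (hs n ((hP n).1 hn))) n)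

theorem nb_add_right_cancel : a + c = b + c → a = b :=
  induction_of_sat (P := fun c => a + c = b + c → a = b)
    (φ := eq (add (nv 1) (nv 0)) (add (nv 2) (nv 0)) ➝ eq (nv 1) (nv 2))
    ⟨sortsIn_eq _ _, sortsIn_eq _ _⟩ (B.valuation₂ a b)
    (fun _ => imp_congr (B.sat_eq _ _ _) (B.sat_eq _ _ _))
    (fun h => ((nb_add_zero a).symm.trans h).trans (nb_add_zero b))
    (fun n ih h => ih (nb_add_one_injective (a + n) (b + n) (by
      rwa [← nb_add_add_one, ← nb_add_add_one]))) c

theorem nb_add_left_cancel (h : c + a = c + b) : a = b :=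
  nb_add_right_cancel (c := c) (by rw [add_comm, h, add_comm])

theorem nb_eq_zero_or (a : B.Nb) : a = 0 ∨ ∃ b, a = b + 1 :=
  induction_of_sat (P := fun a => a = 0 ∨ ∃ b, a = b + 1)
    (φ := eq (nv 0) zero ⋎ ex .num (eq (nv 1) (add (nv 0) one)))
    ⟨sortsIn_eq _ _, Nat.zero_le s, sortsIn_eq _ _⟩ (B.valuation₂ 0 0)
    (fun _ => or_congr (B.sat_eq _ _ _) (exists_congr fun _ => B.sat_eq _ _ _))
    (.inl rfl) (fun n _ => .inr ⟨n, rfl⟩) a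

/-- Any two numbers are comparable. -/
theorem nb_total (a b : B.Nb) : ∃ c, a + c = b ∨ b + c = a := by
  refine induction_of_sat (P := fun b => ∃ c, a + c = b ∨ b + c = a)
    (φ := ex .num (eq (add (nv 2) (nv 0)) (nv 1) ⋎ eq (add (nv 1) (nv 0)) (nv 2)))
    ⟨Nat.zero_le s, sortsIn_eq _ _, sortsIn_eq _ _⟩ (B.valuation₂ a 0)
    (fun _ => exists_congr fun _ => or_congr (B.sat_eq _ _ _) (B.sat_eq _ _ _))
    ⟨a, .inr (_root_.zero_add a)⟩ ?_ b
  rintro n ⟨c, rfl | rfl⟩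
  · exact ⟨c + 1, .inl (add_assoc a c 1).symm⟩
  · rcases nb_eq_zero_or c with rfl | ⟨c, rfl⟩
    · exact ⟨1, .inl (by rw [_root_.add_zero])⟩
    · exact ⟨c, .inr (by ring)⟩

theorem nb_double_injective {a b : B.Nb} (h : a + a = b + b) : a = b := by
  -- if the difference is not zero, then twice the difference is a successor
  have key : ∀ a c : B.Nb, a + a = a + c + (a + c) → c = 0 := by
    intro a c h
    rcases nb_eq_zero_or c with rfl | ⟨c, rfl⟩
    · rfl
    · refine absurd (nb_add_left_cancel (c := a + a) (a := c + c + 1 + 1) (b := 0) ?_)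
        (nb_add_one_ne_zero _)
      rw [_root_.add_zero]
      exact Eq.trans (by ring) h.symm
  obtain ⟨c, rfl | rfl⟩ := nb_total a b
  · rw [key a c h, _root_.add_zero]
  · rw [key b c h.symm, _root_.add_zero]

/-- Cantor's numbering of pairs: `q` is the number of `(n, m)`. -/
def PairCode (n m q : B.Nb) : Prop := q + q = (n + m) * (n + m + 1) + (m + m)

theorem exists_pairCode (n m : B.Nb) : ∃ q, PairCode n m q := by
  have : ∀ k : B.Nb, ∃ p, p + p = k * (k + 1) := by
    refine induction_of_sat
      (φ := ex .num (eq (add (nv 0) (nv 0)) (mul (nv 1) (add (nv 1) one))))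
      ⟨Nat.zero_le s, sortsIn_eq _ _⟩ (B.valuation₂ 0 0)
      (fun _ => exists_congr fun _ => B.sat_eq _ _ _) ⟨0, by simp⟩ ?_
    rintro k ⟨p, hp⟩
    refine ⟨p + (k + 1), ?_⟩
    calc p + (k + 1) + (p + (k + 1)) = (p + p) + 2 * (k + 1) := by ring
      _ = (k + 1) * (k + 1 + 1) := by rw [hp]; ring
  -- the number of `(n, m)` is half of `(n + m)(n + m + 1)`, plus `m`
  obtain ⟨p, hp⟩ := this (n + m)
  refine ⟨p + m, ?_⟩
  rw [PairCode, ← hp]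
  ring

theorem PairCode.injective {n m n' m' q : B.Nb} (h : PairCode n m q) (h' : PairCode n' m' q) :
    n = n' ∧ m = m' := by
  -- pairs with a smaller sum have smaller numbers
  have key : ∀ n m n' m' c : B.Nb, n' + m' = n + m + (c + 1) →
      (n + m) * (n + m + 1) + (m + m) ≠ (n' + m') * (n' + m' + 1) + (m' + m') := by
    intro n m n' m' c hw h
    rw [hw] at h
    refine nb_add_one_ne_zero (2 * n + 1 + c * (2 * (n + m) + c + 3) + (m' + m')) ?_
    refine nb_add_left_cancel (c := (n + m) * (n + m + 1) + (m + m)) ?_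
    rw [_root_.add_zero]
    exact Eq.trans (by ring) h.symm
  have e : (n + m) * (n + m + 1) + (m + m) = (n' + m') * (n' + m' + 1) + (m' + m') :=
    Eq.trans (Eq.symm h) h'
  have hs : n + m = n' + m' := by
    obtain ⟨c, hc | hc⟩ := nb_total (n + m) (n' + m')
    · rcases nb_eq_zero_or c with rfl | ⟨c, rfl⟩
      · rwa [_root_.add_zero] at hc
      · exact absurd e (key n m n' m' c hc.symm)
    · rcases nb_eq_zero_or c with rfl | ⟨c, rfl⟩
      · rw [_root_.add_zero] at hc
        exact hc.symm
      · exact absurd e.symm (key n' m' n m c hc.symm)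
  rw [hs] at e
  obtain rfl := nb_double_injective (nb_add_left_cancel e)
  exact ⟨nb_add_right_cancel hs, rfl⟩

end Cantor

end BTModel

/-! ### Comprehension and choice in models of `BT` -/

theorem SA.quantifiersIn_toBT {k : ℕ} {φ : SAFormula}
    (hq : φ.QuantifiersIn {σ : SASort | σ.index ≤ k}) :
    φ.QuantifiersIn {σ : SASort | σ.toBT ∈ {σ : BTSort | σ ≠ .ty (k + 1)}} := by
  refine hq.mono fun σ hσ h => ?_
  rcases σ with _ | j
  · cases h
  · cases h
    exact absurd hσ (Nat.not_succ_le_self k)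

theorem SA.Simple.quantifiersIn {j k : ℕ} {φ : SAFormula} (h : SA.Simple j φ) :
    φ.QuantifiersIn {σ : SASort | σ.index ≤ k} :=
  h.2.mono fun σ hσ => by
    obtain rfl : σ = SASort.num := hσ
    exact Nat.zero_le k

namespace BTModel

variable {G : BT.GodelNumbering} {s : ℕ} (B : BTModel G s)

/-- Membership of numbers in sets of the arithmetical structure. -/
def NumMem {k : ℕ} (n : B.Nb) (x : B.sa.D (SASort.set k)) : Prop :=
  ∃ z, B.IsSing k n.1 z ∧ B.MemOb k z x.1

@[simp] theorem sat_saMem {k : ℕ} (t : SATerm .num) (x : SATerm (.set k)) (v : Val B.sa.D) :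
    (SA.mem t x).Sat B.sa v ↔ B.NumMem (t.val B.sa v) (x.val B.sa v) := Iff.rfl

/-- The expression `Z^k. ∃ n ({n}^k ≃ Z ∧ φ*(n))`, with all its parameters; `n` is the numerical
variable `0` of `φ`. -/
noncomputable def _root_.MSArith.SA.starAbstract (G : BT.GodelNumbering) (k : ℕ) (φ : SAFormula) :
    BT.Abstract :=
  let body : BTFormula := BT.ex .num (BT.eqv (BT.iterSingleton G k (.of (BT.nv 0)))
    (.of (BT.tv k 0)) ⋏ (SA.star G φ).shift (S := BTSig) (.ty k))
  open Classical in
  ⟨k, (BT.all (.ty k) body).exists_bound.choose.filter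
    fun v => (BT.all (.ty k) body).Free v.1 v.2, body⟩

open Classical in
theorem _root_.MSArith.SA.starAbstract_admissible (G : BT.GodelNumbering) {k : ℕ} {φ : SAFormula}
    (hφ : φ.SortsIn {σ : SASort | σ.index ≤ k + 1})
    (hq : φ.QuantifiersIn {σ : SASort | σ.index ≤ k}) : (SA.starAbstract G k φ).Admissible := by
  have hω := BTSort.num_mem_upTo (k + 1)
  have h0 := BTSort.ty_zero_mem_upTo (k + 1)
  have hk := BTSort.ty_mem_upTo (Nat.le_succ k)
  have hE : ∀ j < k + 1, BTSort.ty j ∈ {σ : BTSort | σ ≠ .ty (k + 1)} := fun j hj h => by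
    cases h
    exact absurd hj (lt_irrefl _)
  have hω' : BTSort.num ∈ {σ : BTSort | σ ≠ .ty (k + 1)} := fun h => by cases h
  have h0' := hE 0 (Nat.succ_pos k)
  have hb : BT.Fits (BTSort.upTo (k + 1)) {σ | σ ≠ .ty (k + 1)} (SA.starAbstract G k φ).body :=
    .ex hω hω' (.and (BT.fits_eqv h0 h0' (SA.leaves_iterSingleton G h0 (t := .of (BT.nv 0)) hω k)
      (SA.leaves_iterSingleton G h0' (t := .of (BT.nv 0)) hω' k) hk (hE k (Nat.lt_succ_self k)))
      ((SA.fits_star G hω' hE h0' hφ (SA.quantifiersIn_toBT hq)).rename _))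
  refine ⟨fun v hv => ?_, hb.elementary, fun σ i h => ?_⟩
  · have := (List.mem_filter.1 hv).2
    exact Formula.SortsIn.of_free (S := BTSig) (φ := BT.all (.ty k) (SA.starAbstract G k φ).body)
      ⟨hk, hb.1⟩ (of_decide_eq_true this)
  · exact List.mem_filter.2 ⟨(BT.all (.ty k) _).exists_bound.choose_spec σ i h,
      decide_eq_true h⟩

/-- Comprehension in the arithmetical structure, for formulas with quantifiers over sets of sorts
lower than that of the set to be formed.  The set is `{{n}^k : φ(n)}`; it determines the numbers `n`
since iterated singletons are injective. -/
theorem sa_comprehension {k : ℕ} (hk : k + 1 ≤ s) {φ : SAFormula}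
    (hφ : φ.SortsIn {σ : SASort | σ.index ≤ k + 1})
    (hq : φ.QuantifiersIn {σ : SASort | σ.index ≤ k}) (v : Val B.sa.D) :
    ∃ z : B.sa.D (SASort.set k), ∀ n : B.Nb, B.NumMem n z ↔ φ.Sat B.sa (v.cons SASort.num n) := by
  obtain ⟨w, hw⟩ := B.exists_lift v
  have hφs : φ.SortsIn {σ : SASort | σ.index ≤ s} := hφ.mono fun σ hσ => le_trans hσ hk
  obtain ⟨U, -, hU⟩ := B.comprehension _ (SA.starAbstract_admissible G hφ hq) hk w
  have hω := BTSort.num_mem_upTo s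
  have h0 := BTSort.ty_zero_mem_upTo s
  have hk0 := BTSort.ty_mem_upTo (Nat.le_of_succ_le hk)
  have hU : ∀ Z : B.D (.ty k), B.MemOb k (B.cls Z) (B.cls U) ↔ ∃ n : B.Nb,
      B.IsSing k n.1 (B.cls Z) ∧ φ.Sat B.sa (v.cons SASort.num n) := by
    intro Z
    have key : ∀ d : B.D .num, (BT.eqv (BT.iterSingleton G k (.of (BT.nv 0))) (.of (BT.tv k 0)) ⋏
        (SA.star G φ).shift (S := BTSig) (.ty k)).Sat B.str ((w.cons (.ty k) Z).cons .num d) ↔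
        B.IsSing k (B.cls d) (B.cls Z) ∧
          φ.Sat B.sa (v.cons SASort.num (⟨B.cls d, d, rfl⟩ : B.Nb)) := by
      intro d
      refine and_congr ?_ ?_
      · rw [B.sat_eqv_of (SA.leaves_iterSingleton G h0 (t := .of (BT.nv 0)) hω k) hk0,
          ev_iterSingleton]
        simp [env]
      · rw [Val.cons_comm (S := BTSig) _ (by simp), Formula.sat_shift]
        exact B.sat_star_cons hφs hw rfl
    refine (hU Z).trans ⟨?_, ?_⟩
    · rintro ⟨d, hd⟩
      exact ⟨⟨_, d, rfl⟩, (key d).1 hd⟩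
    · rintro ⟨⟨_, d, rfl⟩, hn⟩
      exact ⟨d, (key d).2 hn⟩
  refine ⟨⟨B.cls U, ⟨U, rfl⟩, fun _ Z hZ => ?_⟩, fun n => ⟨?_, fun hn => ?_⟩⟩
  · obtain ⟨n, hn, -⟩ := (hU Z).1 hZ
    exact ⟨n.1, n.2, hn⟩
  · rintro ⟨z, hz, hm⟩
    obtain ⟨Z, hZ⟩ := B.exists_isSing (Nat.le_of_succ_le hk) n.1
    obtain rfl := hz.unique hZ
    obtain ⟨n', hn', h⟩ := (hU Z).1 hm
    obtain rfl : n = n' := Subtype.ext (hZ.injective (Nat.le_of_succ_le hk) hn')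
    exact h
  · obtain ⟨Z, hZ⟩ := B.exists_isSing (Nat.le_of_succ_le hk) n.1
    exact ⟨_, hZ, (hU Z).2 ⟨n, hZ, hn⟩⟩

/-- The formula `∃ n ∃ x (φ(n, x) ∧ ∃ m ((n, m) = q ∧ m ∈ x))` for `q = nv 0`, which defines the set
asserted to exist by the axiom of choice for `φ`. -/
def _root_.MSArith.SA.choiceSet (k : ℕ) (φ : SAFormula) : SAFormula :=
  open SA in
  ex .num (ex (.set k) (φ.shiftAbove (S := SASig) SASort.num ⋏ ex .num
    (eq (add (nv 2) (nv 2))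
      (add (mul (add (nv 1) (nv 0)) (add (add (nv 1) (nv 0)) one)) (add (nv 0) (nv 0))) ⋏
      mem (nv 0) (sv k 0))))

theorem sat_choiceSet (k : ℕ) (φ : SAFormula) (v : Val B.sa.D) (q : B.Nb) :
    (SA.choiceSet k φ).Sat B.sa (v.cons SASort.num q) ↔
      ∃ (n : B.Nb) (x : B.sa.D (SASort.set k)),
        φ.Sat B.sa ((v.cons SASort.num n).cons (SASort.set k) x) ∧
          ∃ m, PairCode n m q ∧ B.NumMem m x := by
  refine exists_congr fun n => exists_congr fun x => and_congr ?_ (exists_congr fun m =>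
    and_congr ((B.sat_eq _ _ _).trans ?_) ((B.sat_saMem _ _ _).trans ?_))
  · rw [Val.cons_comm (S := SASig) _ (by simp), Val.cons_comm (S := SASig) v (by simp),
    Formula.sat_shiftAbove, Val.cons_comm (S := SASig) _ (by simp)]
  · simp [PairCode]
  · simp

theorem sat_pairMem {k : ℕ} (v : Val B.sa.D) (n m : SATerm .num) (y : SATerm (.set k)) :
    (SA.pairMem n m y).Sat B.sa v ↔
      ∃ q : B.Nb, PairCode (n.val B.sa v) (m.val B.sa v) q ∧ B.NumMem q (y.val B.sa v) := by
  refine exists_congr fun q => and_congr ((B.sat_eq _ _ _).trans ?_) ?_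
  · simp [PairCode]
  · simp

/-- The set `y` defined by `choiceSet` satisfies the axiom of choice: by extensional uniqueness it
does not matter which `x` with `φ(n, x)` is used for a given `n`.  The formula `choiceSet`
quantifies over the sort of `x`, which is admitted since the sort of `y` is the next one. -/
theorem sat_choice {k : ℕ} (hk : k + 2 ≤ s) {φ : SAFormula} (hφ : SA.Simple (k + 1) φ)
    (v : Val B.sa.D) : (SA.choice k φ).Sat B.sa v := by
  intro h
  have hnum : ∀ {j}, SASort.num ∈ {σ : SASort | σ.index ≤ j} := Nat.zero_le _
  have h1 : SASort.set k ∈ {σ : SASort | σ.index ≤ k + 1} := Nat.le_refl (k + 1)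
  have h2 : SASort.set k ∈ {σ : SASort | σ.index ≤ k + 2} := Nat.le_succ (k + 1)
  obtain ⟨y, hy⟩ := B.sa_comprehension (k := k + 1) hk (φ := SA.choiceSet k φ)
    ⟨hnum, h2, (Formula.sortsIn_rename _ _).2 (hφ.1.mono fun σ hσ => Nat.le_succ_of_le hσ), hnum,
      SA.sortsIn_eq _ _, fun j => (SA.sortsIn_term _).2 (by fin_cases j; exacts [hnum, h2])⟩
    ⟨hnum, h1, (Formula.quantifiersIn_rename _ _).2 hφ.quantifiersIn, hnum, trivial, trivial⟩ v
  refine ⟨y, fun n => ?_⟩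
  obtain ⟨x, hx, -⟩ := h n
  refine ⟨x, ?_, fun m => (Formula.sat_iff).2 ?_⟩
  · rw [Val.cons_comm (S := SASig) v (by simp), Val.cons_comm (S := SASig) _ (by simp),
      Formula.sat_shift]
    exact hx
  · rw [sat_pairMem, sat_saMem]
    suffices h' : B.NumMem m x ↔ ∃ q, PairCode n m q ∧ B.NumMem q y by simpa using h'
    constructor
    · intro hm
      obtain ⟨q, hq⟩ := exists_pairCode n m
      exact ⟨q, hq, (hy q).2 ((B.sat_choiceSet k φ v q).2 ⟨n, x, hx, m, hq, hm⟩)⟩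
    · rintro ⟨q, hq, hqy⟩
      obtain ⟨n', x', hx', m', hq', hm'⟩ := (B.sat_choiceSet k φ v q).1 ((hy q).1 hqy)
      obtain ⟨rfl, rfl⟩ := hq.injective hq'
      obtain ⟨x₀, -, hx₀⟩ := h n
      have hu : ∀ z : B.sa.D (SASort.set k),
          φ.Sat B.sa ((v.cons SASort.num n).cons (SASort.set k) z) →
            (B.NumMem m x₀ ↔ B.NumMem m z) :=
        fun z hz => by
          have := Formula.sat_iff.1 (hx₀ z ((Formula.sat_shiftAbove _ _ _ _ _).2 hz) m)
          simpa using this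
      exact (hu x hx).1 ((hu x' hx').2 hm')

/-! ### The axioms of `SA` -/

theorem sat_of_ax {φ : SAFormula} (h : SA.Axiom φ) (hs : φ.SortsIn {σ : SASort | σ.index ≤ s})
    (v : Val B.sa.D) : φ.Sat B.sa v := by
  cases h with
  | eqRefl t => exact (B.sat_eq v t t).2 rfl
  | eqSubst t u φ =>
    intro he h
    rw [Formula.sat_inst] at h ⊢
    rwa [← (B.sat_eq v t u).1 he]
  | succNeZero n => exact fun h => nb_add_one_ne_zero _ ((B.sat_eq _ _ _).1 h)
  | succInj n m =>
    exact fun h => (B.sat_eq _ _ _).2 (nb_add_one_injective _ _ ((B.sat_eq _ _ _).1 h))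
  | addZero n => exact (B.sat_eq _ _ _).2 (nb_add_zero _)
  | addSucc n m => exact (B.sat_eq _ _ _).2 (nb_add_add_one _ _)
  | mulZero n => exact (B.sat_eq _ _ _).2 (nb_mul_zero _)
  | mulSucc n m => exact (B.sat_eq _ _ _).2 (nb_mul_add_one _ _)
  | induction φ =>
    rintro ⟨h0, h1⟩ n
    exact B.sa_induction hs.2.2 v ((Formula.sat_inst _ _ _).1 h0)
      (fun n hn => (Formula.sat_single _ _ _ _).1 (h1 n hn)) n
  | comprehension k φ hφ =>
    have hk : k + 1 ≤ s := hs.1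
    obtain ⟨z, hz⟩ := B.sa_comprehension hk hφ.1 hφ.quantifiersIn v
    refine ⟨z, fun n => Formula.sat_iff.2 ?_⟩
    rw [Val.cons_comm (S := SASig) v (by simp), Formula.sat_shift]
    simpa using hz n
  | choice k φ hφ => exact B.sat_choice hs.2.1 hφ v

/-- The arithmetical structure of a model of `BT_s` is a model of `SA_s`. -/
theorem sa_models : B.sa.Models (SA.theory s) :=
  Str.models_of_axioms rfl fun _ h hs v => B.sat_of_ax h hs v

end BTModel

/-! ### Closures -/

section Closure

variable {S : Sig}

theorem Formula.free_allVars {φ : Formula S} {l : List (Var S)} {τ : S.Srt} {i : ℕ}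
    (h : (φ.allVars l).Free τ i) : φ.Free τ i ∧ (⟨τ, i⟩ : Var S) ∉ l := by
  induction l with
  | nil => exact ⟨h, List.not_mem_nil⟩
  | cons v l ih =>
    obtain ⟨j, hj, hji⟩ := (Formula.free_rename _ _ _ _).1 h
    obtain ⟨σ, k⟩ := v
    have : j = i ∧ ¬ (τ = σ ∧ j = k) := by
      by_cases hτ : τ = σ
      · by_cases hjk : j = k <;> simp_all [Ren.bind, Ren.shift]
      · simp_all [Ren.bind, Ren.shift]
    obtain ⟨rfl, hne⟩ := this
    refine ⟨(ih hj).1, fun hm => ?_⟩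
    rcases List.mem_cons.1 hm with hm | hm
    · cases hm
      exact hne ⟨rfl, rfl⟩
    · exact (ih hj).2 hm

theorem Formula.IsClosure.not_free {φ χ : Formula S} (h : φ.IsClosure χ) (τ : S.Srt) (i : ℕ) :
    ¬ χ.Free τ i := by
  obtain ⟨l, -, hl, rfl⟩ := h
  intro hi
  obtain ⟨h1, h2⟩ := Formula.free_allVars hi
  exact h2 ((hl ⟨τ, i⟩).2 h1)

theorem Formula.IsClosure.sat {M : Str S} {φ χ : Formula S} (h : φ.IsClosure χ)
    (hφ : ∀ v, φ.Sat M v) (v : Val M.D) : χ.Sat M v := by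
  obtain ⟨l, -, -, rfl⟩ := h
  induction l generalizing v with
  | nil => exact hφ v
  | cons w l ih => exact fun d => (Formula.sat_rename _ _ _).2 (ih _)

theorem Formula.IsClosure.sortsIn {A : Set S.Srt} {φ χ : Formula S} (h : φ.IsClosure χ)
    (hφ : φ.SortsIn A) : χ.SortsIn A := by
  obtain ⟨l, -, hl, rfl⟩ := h
  have hA : ∀ w ∈ l, w.1 ∈ A := fun w hw => hφ.of_free ((hl w).1 hw)
  clear hl
  induction l with
  | nil => exact hφ
  | cons w l ih =>
    exact ⟨hA w List.mem_cons_self, (Formula.sortsIn_rename _ _).2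
      (ih fun w' h => hA w' (List.mem_cons_of_mem _ h))⟩

end Closure

/-! ### The interpretation -/

theorem PATerm.toExt_toSA (t : PATerm) : SA.toExt t.toSA = t.toBT := by
  induction t with
  | var => rfl
  | zero => rfl
  | one => rfl
  | add t u iht ihu => exact congrArg₂ (fun a b => BT.addOp ⬝ a ⬝ b) iht ihu
  | mul t u iht ihu => exact congrArg₂ (fun a b => BT.mulOp ⬝ a ⬝ b) iht ihu

/-- On arithmetical formulas the translation is the identity. -/
theorem PAFormula.star_toSA (G : BT.GodelNumbering) (ψ : PAFormula) :
    SA.star G ψ.toSA = ψ.toBT := by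
  induction ψ with
  | falsum => rfl
  | eq t u => exact congrArg₂ BT.eqv t.toExt_toSA u.toExt_toSA
  | and φ ψ h1 h2 => exact congrArg₂ Formula.and h1 h2
  | or φ ψ h1 h2 => exact congrArg₂ Formula.or h1 h2
  | imp φ ψ h1 h2 => exact congrArg₂ Formula.imp h1 h2
  | all φ ih => exact congrArg (BT.all .num) ih
  | ex φ ih => exact congrArg (BT.ex .num) ih

theorem PAFormula.sortsIn_toSA (ψ : PAFormula) :
    ψ.toSA.SortsIn {σ : SASort | σ.index ≤ 0} := by
  induction ψ with
  | falsum => trivial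
  | eq t u => exact SA.sortsIn_eq _ _
  | and φ ψ h1 h2 => exact ⟨h1, h2⟩
  | or φ ψ h1 h2 => exact ⟨h1, h2⟩
  | imp φ ψ h1 h2 => exact ⟨h1, h2⟩
  | all φ ih => exact ⟨le_refl 0, ih⟩
  | ex φ ih => exact ⟨le_refl 0, ih⟩

/-- The interpretation of `SA_s` in `BT_s`: the closure of a theorem of `SA_s` holds in the
arithmetical structure of any model of `BT_s`, hence its translation holds in the model. -/
theorem SA.provable_star (G : BT.GodelNumbering) {s : ℕ} {ψ χ : SAFormula}
    (h : (SA.theory s).Provable ψ) (hχ : ψ.IsClosure χ) :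
    (BT.theoryCl G s).Provable (SA.star G χ) := by
  have hs : χ.SortsIn {σ : SASort | σ.index ≤ s} := hχ.sortsIn h.sortsIn
  refine Theory.provable_of_forall_models (fun σ hσ t => (BT.sortsIn_term t).2 hσ)
    (SA.sortsIn_star G hs) fun M hM w => ?_
  let B : BTModel G s := ⟨M, hM⟩
  exact (B.sat_star hs w (fun σ _ => B.sa.pt σ) fun τ i hi => (hχ.not_free τ i hi).elim).2
    (hχ.sat (B.sa_models ψ h) _)

end MSArith

theorem mainTheorem6 (G : MSArith.BT.GodelNumbering) :
    (∀ ψ : MSArith.PAFormula,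
      (MSArith.BT.theoryCl G 0).Provable
        (MSArith.Formula.iff (MSArith.SA.star G ψ.toSA) ψ.toBT)) ∧
    (∀ (s : ℕ) (ψ χ : MSArith.SAFormula),
      (MSArith.SA.theory s).Provable ψ → ψ.IsClosure χ →
        (MSArith.BT.theoryCl G s).Provable (MSArith.SA.star G χ)) := by
  refine ⟨fun ψ => ?_, fun s ψ χ h hχ => MSArith.SA.provable_star G h hχ⟩
  rw [ψ.star_toSA G]
  have hψ : ψ.toBT.SortsIn (MSArith.BT.theoryCl G 0).sorts := by
    rw [← ψ.star_toSA G]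
    exact MSArith.SA.sortsIn_star G ψ.sortsIn_toSA
  exact MSArith.Theory.provable_of_forall_models
    (fun σ hσ t => (MSArith.BT.sortsIn_term t).2 hσ) ⟨⟨hψ, hψ⟩, hψ, hψ⟩
    fun M _ v => ⟨id, id⟩
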